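/- **Theorem (generalized Jarník–Besicovitch theorem).** Let $(X,d)$ be a Gromov hyperbolic metric space (not necessarily geodesic or proper), let $o\in X$, let $\langle x|y\rangle_z=\frac12[d(x,z)+d(y,z)-d(x,y)]$ be the Gromov product, let $\partial X$ be the Gromov boundary (Gromov sequences modulo equivalence), and extend the Gromov product to the boundary by $\langle\xi|\eta\rangle_z=\inf\{\liminf_{n,m}\langle x_n|y_m\rangle_z:(x_n)\in\xi,(y_m)\in\eta\}$ and $\langle y|\xi\rangle_z=\inf\{\liminf_n\langle x_n|y\rangle_z:(x_n)\in\xi\}$. Let $b>1$ be such that $\partial X$ admits a visual metric, and let $D$ be such a metric, i.e. a metric on $\partial X$ with $D(\xi,\eta)\asymp b^{-\langle\xi|\eta\rangle_o}$ up to a multiplicative constant. Balls $B(\xi,r)$ (closed), diameters and the Hausdorff dimension $\mathrm{HD}$ are taken with respect to $D$. Let $G\leq\mathrm{Isom}(X)$ be strongly discrete (for every $r>0$ only finitely many $g\in G$ satisfy $d(o,g(o))\leq r$) and of general type ($G$ contains two loxodromic isometries having no common fixed point in $\partial X$; an isometry $g$ is loxodromic if it has two distinct fixed points $g_+,g_-\in\partial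 X$ such that $g^n\to g_+$ uniformly on the complement of every neighbourhood of $g_-$, and $g^{-n}\to g_-$ uniformly on the complement of every neighbourhood of $g_+$). Let $\delta=\inf\{s\geq0:\sum_{g\in G}b^{-s\,d(o,g(o))}<\infty\}$ be its Poincaré exponent relative to $b$, and suppose $\delta<\infty$. For $\sigma>0$ let $\Lambda_{r,\sigma}$ be the set of all $\eta\in\partial X$ for which there is a sequence $(g_n)$ in $G$ with $\langle g_n(o)|\eta\rangle_o\to\infty$ and $\langle o|\eta\rangle_{g_n(o)}\leq\sigma$ for all $n$, and let $\Lambda_r=\bigcup_{\sigma>0}\Lambda_{r,\sigma}$ be the radial limit set. Fix $\xi\in\partial X$. For $\eta\in\partial X$ and $c>0$ let $$\omega_\xi(\eta)=\limsup_{g\in G,\ d(o,g(o))\to\infty}\frac{-\log_bD(g(\xi),\eta)}{d(o,g(o))},\qquad W_{c,\xi}=\{\eta\in\Lambda_r:\omega_\xi(\eta)\geq1+c\},$$ $$\mathrm{VWA}_\xi=\{\eta\in\Lambda_r:\omega_\xi(\eta)>1\},\qquad \mathrm{Liou}_\xi=\{\eta\in\Lambda_r:\omega_\xi(\eta)=+\infty\}.$$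 For $s\in[0,\delta]$ let $$P_\xi(s)=\lim_{\sigma\to\infty}\liminf_{r\to0}\frac{\log_b\mathcal H^s_\infty\big(B(\xi,r)\cap\Lambda_{r,\sigma}\big)}{\log_b r}\in[0,\infty],$$ where $\mathcal H^s_\infty(S)=\inf\{\sum_{A\in\mathcal C}\mathrm{diam}(A)^s:\mathcal C\text{ a countable cover of }S\}$ is the $s$-dimensional Hausdorff content and $\log_b 0=-\infty$. Then for every $c>0$ $$\mathrm{HD}(W_{c,\xi})=\sup\Big\{s\in(0,\delta):P_\xi(s)\leq\frac{\delta-s}{c}\Big\}=\inf\Big\{s\in(0,\delta):P_\xi(s)\geq\frac{\delta-s}{c}\Big\}\leq\frac{\delta}{c+1}.$$ In particular $$\mathrm{HD}(\mathrm{VWA}_\xi)=\sup\{s\in(0,\delta):P_\xi(s)<+\infty\}=\inf\{s\in(0,\delta):P_\xi(s)=+\infty\}$$ and $\mathrm{HD}(\mathrm{Liou}_\xi)=0$. In these formulas $\sup\emptyset=0$ and $\inf\emptyset=\delta$. -/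

import Mathlib

open Set Filter Topology
open scoped ENNReal NNReal

noncomputable section

namespace HypDioph

/-! ### Gromov hyperbolic metric spaces and their boundary -/

section Space

variable {X : Type*} [MetricSpace X]

/-- The Gromov product `⟨x|y⟩_z`. -/
def gromovProd (z x y : X) : ℝ := (dist x z + dist y z - dist x y) / 2

/-- Gromov hyperbolicity: the Gromov inequality with a uniform additive error, for all
quadruples of points.  The space is not assumed to be geodesic, proper or complete. -/
class GromovHyperbolic (X : Type*) [MetricSpace X] : Prop where
  gromov_inequality : ∃ K : ℝ, ∀ x y z w : X,
    min (gromovProd w x y) (gromovProd w y z) - K ≤ gromovProd w x z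

/-- A Gromov sequence: `⟨x_n|x_m⟩_o → ∞` as `n, m → ∞`, for every base point `o`
(equivalently, for one base point: see `isGromovSeq_iff`). -/
def IsGromovSeq (x : ℕ → X) : Prop :=
  ∀ o : X, Tendsto (fun p : ℕ × ℕ => gromovProd o (x p.1) (x p.2)) atTop atTop

/-- Equivalence of sequences: `⟨x_n|y_n⟩_o → ∞`, for every base point `o`
(equivalently, for one base point: see `gromovEquiv_iff`). -/
def GromovEquiv (x y : ℕ → X) : Prop :=
  ∀ o : X, Tendsto (fun n => gromovProd o (x n) (y n)) atTop atTop

theorem gromovProd_comm (z x y : X) : gromovProd z x y = gromovProd z y x := by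
  unfold gromovProd; rw [dist_comm x y]; ring

theorem gromovProd_le_add (o z x y : X) :
    gromovProd z x y - dist o z ≤ gromovProd o x y := by
  unfold gromovProd
  have h1 := dist_triangle x o z
  have h2 := dist_triangle y o z
  linarith

theorem isGromovSeq_iff (o : X) (x : ℕ → X) : IsGromovSeq x ↔
    Tendsto (fun p : ℕ × ℕ => gromovProd o (x p.1) (x p.2)) atTop atTop :=
  ⟨fun h => h o, fun h z => tendsto_atTop_mono (fun _ => gromovProd_le_add z o _ _)
    (tendsto_atTop_add_const_right _ (-dist z o) h)⟩

theorem gromovEquiv_iff (o : X) (x y : ℕ → X) : GromovEquiv x y ↔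
    Tendsto (fun n => gromovProd o (x n) (y n)) atTop atTop :=
  ⟨fun h => h o, fun h z => tendsto_atTop_mono (fun _ => gromovProd_le_add z o _ _)
    (tendsto_atTop_add_const_right _ (-dist z o) h)⟩

theorem gromovProd_isometry (g : X ≃ᵢ X) (z x y : X) :
    gromovProd z (g x) (g y) = gromovProd (g.symm z) x y := by
  have h : ∀ u : X, dist (g u) z = dist u (g.symm z) := fun u => by
    conv_lhs => rw [← g.apply_symm_apply z]
    exact g.dist_eq _ _
  simp only [gromovProd, h, g.dist_eq]

variable (X) in
/-- The type of Gromov sequences in `X`. -/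
def GromovSeq : Type _ := {x : ℕ → X // IsGromovSeq x}

variable (X) in
/-- Equivalence of Gromov sequences, as an equivalence relation. -/
def gromovSetoid [GromovHyperbolic X] : Setoid (GromovSeq X) where
  r x y := GromovEquiv x.1 y.1
  iseqv :=
    { refl := fun x o => (x.2 o).comp (tendsto_atTop_diagonal : Tendsto (fun n : ℕ => (n, n)) _ _)
      symm := fun {x y} h o => by simpa only [gromovProd_comm] using h o
      trans := fun {x y z} h1 h2 o => by
        obtain ⟨K, hK⟩ := GromovHyperbolic.gromov_inequality (X := X)
        refine tendsto_atTop_mono (fun n => hK (x.1 n) (y.1 n) (z.1 n) o) ?_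
        refine tendsto_atTop_add_const_right _ (-K) (tendsto_atTop.2 fun a => ?_)
        filter_upwards [tendsto_atTop.1 (h1 o) a, tendsto_atTop.1 (h2 o) a] with n ha hb
        exact le_min ha hb }

variable (X) in
/-- The Gromov boundary `∂X`: Gromov sequences modulo equivalence. -/
def GromovBoundary [GromovHyperbolic X] : Type _ := Quotient (gromovSetoid X)

variable [GromovHyperbolic X]

/-- The boundary point represented by a Gromov sequence. -/
def GromovSeq.toBoundary (x : GromovSeq X) : GromovBoundary X := Quotient.mk (gromovSetoid X) x

/-- The Gromov product `⟨ξ|η⟩_z` of two boundary points: the infimum of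
`liminf_{n,m} ⟨x_n|y_m⟩_z` over all sequences `x` representing `ξ` and `y` representing `η`. -/
def boundaryProd (z : X) (ξ η : GromovBoundary X) : EReal :=
  ⨅ (x : GromovSeq X) (_ : x.toBoundary = ξ) (y : GromovSeq X) (_ : y.toBoundary = η),
    liminf (fun p : ℕ × ℕ => ((gromovProd z (x.1 p.1) (y.1 p.2) : ℝ) : EReal)) atTop

/-- The Gromov product `⟨y|ξ⟩_z` of a point `y` of `X` and a boundary point `ξ`. -/
def mixedProd (z y : X) (ξ : GromovBoundary X) : EReal :=
  ⨅ (x : GromovSeq X) (_ : x.toBoundary = ξ),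
    liminf (fun n : ℕ => ((gromovProd z (x.1 n) y : ℝ) : EReal)) atTop

/-- The image of a Gromov sequence under an isometry. -/
def GromovSeq.map (g : X ≃ᵢ X) (x : GromovSeq X) : GromovSeq X :=
  ⟨fun n => g (x.1 n), fun o => by simpa only [gromovProd_isometry] using x.2 (g.symm o)⟩

/-- The extension of an isometry of `X` to the Gromov boundary. -/
def boundaryMap (g : X ≃ᵢ X) : GromovBoundary X → GromovBoundary X :=
  Quotient.map (sa := gromovSetoid X) (sb := gromovSetoid X) (GromovSeq.map g)
    (fun x y (h : GromovEquiv x.1 y.1) => show GromovEquiv (x.map g).1 (y.map g).1 from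
      fun o => by simpa only [GromovSeq.map, gromovProd_isometry] using h (g.symm o))

/-- A metric on `∂X` (given as an instance) is a visual metric with respect to the parameter
`b` and the base point `o` if `D(ξ, η) ≍ b ^ (-⟨ξ|η⟩_o)` up to a multiplicative constant. Here
`b ^ (-⟨ξ|ξ⟩_o) = b ^ (-∞) = 0`. -/
def IsVisualMetric (b : ℝ) (o : X) [MetricSpace (GromovBoundary X)] : Prop :=
  ∃ C : ℝ≥0, ∀ ξ η : GromovBoundary X,
    edist ξ η ≤ C * EReal.exp (-((Real.log b : ℝ) : EReal) * boundaryProd o ξ η) ∧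
    EReal.exp (-((Real.log b : ℝ) : EReal) * boundaryProd o ξ η) ≤ C * edist ξ η

/-! ### Groups of isometries -/

/-- Strong discreteness (metric properness) of a group of isometries. -/
def StronglyDiscrete (o : X) (G : Subgroup (X ≃ᵢ X)) : Prop :=
  ∀ r : ℝ, 0 < r → {g : X ≃ᵢ X | g ∈ G ∧ g o ∈ Metric.closedBall o r}.Finite

/-- A loxodromic isometry: it has an attracting fixed point `p` and a repelling fixed point `q`
in `∂X`, with uniform convergence of the iterates away from the repelling point, and the same for
the inverse.  The topology and uniformity of `∂X` are those of the given (visual) metric. -/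
def IsLoxodromic [MetricSpace (GromovBoundary X)] (g : X ≃ᵢ X) : Prop :=
  ∃ p q : GromovBoundary X, p ≠ q ∧ boundaryMap g p = p ∧ boundaryMap g q = q ∧
    (∀ U ∈ 𝓝 q, TendstoUniformlyOn (fun n : ℕ => boundaryMap (g ^ n)) (fun _ => p) atTop Uᶜ) ∧
    (∀ U ∈ 𝓝 p, TendstoUniformlyOn (fun n : ℕ => boundaryMap (g⁻¹ ^ n)) (fun _ => q) atTop Uᶜ)

/-- A group of general type: it contains two loxodromic isometries without a common fixed point
in `∂X`. -/
def IsGeneralType [MetricSpace (GromovBoundary X)] (G : Subgroup (X ≃ᵢ X)) : Prop :=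
  ∃ g₁ ∈ G, ∃ g₂ ∈ G, IsLoxodromic g₁ ∧ IsLoxodromic g₂ ∧
    Disjoint (Function.fixedPoints (boundaryMap g₁)) (Function.fixedPoints (boundaryMap g₂))

/-- The Poincaré series `∑_{g ∈ G} b ^ (-s d(o, g o))`. -/
def poincareSeries (b : ℝ) (o : X) (G : Subgroup (X ≃ᵢ X)) (s : ℝ) : ℝ≥0∞ :=
  ∑' g : G, ENNReal.ofReal (b ^ (-s * dist o (g.1 o)))

/-- The Poincaré exponent `inf {s ≥ 0 : ∑_{g ∈ G} b ^ (-s d(o, g o)) < ∞}`, with `inf ∅ = ∞`. -/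
def poincareExponent (b : ℝ) (o : X) (G : Subgroup (X ≃ᵢ X)) : ℝ≥0∞ :=
  ⨅ (s : ℝ≥0) (_ : poincareSeries b o G s < ∞), (s : ℝ≥0∞)

/-- The `σ`-radial limit set: boundary points `η` for which there is a sequence `g_n` in `G` with
`g_n(o) → η` (that is, `⟨g_n(o)|η⟩_o → ∞`) and `⟨o|η⟩_{g_n(o)} ≤ σ` for all `n`. -/
def sigmaRadialLimitSet (o : X) (G : Subgroup (X ≃ᵢ X)) (σ : ℝ) : Set (GromovBoundary X) :=
  {η | ∃ g : ℕ → G, Tendsto (fun n => mixedProd o ((g n).1 o) η) atTop (𝓝 ⊤) ∧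
    ∀ n, mixedProd ((g n).1 o) o η ≤ (σ : EReal)}

/-- The radial limit set. -/
def radialLimitSet (o : X) (G : Subgroup (X ≃ᵢ X)) : Set (GromovBoundary X) :=
  ⋃ (σ : ℝ) (_ : 0 < σ), sigmaRadialLimitSet o G σ

end Space

/-- The extended logarithm to base `b`, with `log_b 0 = -∞` and `log_b ∞ = ∞`. -/
def elogb (b : ℝ) (x : ℝ≥0∞) : EReal := ENNReal.log x / ((Real.log b : ℝ) : EReal)

/-- The `s`-dimensional Hausdorff content of a set: the infimum of `∑ diam(A)^s` over countable
covers. Empty members of a cover contribute `0`, nonempty ones `diam(A)^s` (where `0^0 = 1`). -/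
def hausdorffContent {Z : Type*} [MetricSpace Z] (s : ℝ) (S : Set Z) : ℝ≥0∞ :=
  ⨅ (t : ℕ → Set Z) (_ : S ⊆ ⋃ n, t n), ∑' n, ⨆ _ : (t n).Nonempty, Metric.ediam (t n) ^ s

/-- The infimum of a set of reals, with the convention `inf ∅ = d`. -/
def infOr (d : ℝ) (S : Set ℝ) : ℝ := open Classical in if S.Nonempty then sInf S else d

section Approximation

variable {X : Type*} [MetricSpace X] [GromovHyperbolic X] [MetricSpace (GromovBoundary X)]

/-- The exponent `ω_ξ(η)`: the limsup of `-log_b D(g(ξ), η) / d(o, g(o))` as `g ∈ G` and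
`d(o, g(o)) → ∞`; the quotient is `+∞` when `g(ξ) = η`. -/
def approxExponent (b : ℝ) (o : X) (G : Subgroup (X ≃ᵢ X)) (ξ η : GromovBoundary X) : EReal :=
  limsup (fun g : G => -elogb b (edist (boundaryMap g.1 ξ) η) / ((dist o (g.1 o) : ℝ) : EReal))
    (comap (fun g : G => dist o (g.1 o)) atTop)

/-- The set `W_{c,ξ}` of radial limit points `η` with `ω_ξ(η) ≥ 1 + c`. -/
def wellApproxSet (b : ℝ) (o : X) (G : Subgroup (X ≃ᵢ X)) (ξ : GromovBoundary X) (c : ℝ) :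
    Set (GromovBoundary X) :=
  {η ∈ radialLimitSet o G | ((1 + c : ℝ) : EReal) ≤ approxExponent b o G ξ η}

/-- The set `VWA_ξ` of very well approximable points. -/
def veryWellApproxSet (b : ℝ) (o : X) (G : Subgroup (X ≃ᵢ X)) (ξ : GromovBoundary X) :
    Set (GromovBoundary X) :=
  {η ∈ radialLimitSet o G | 1 < approxExponent b o G ξ η}

/-- The set `Liou_ξ` of Liouville points. -/
def liouvilleSet (b : ℝ) (o : X) (G : Subgroup (X ≃ᵢ X)) (ξ : GromovBoundary X) :
    Set (GromovBoundary X) :=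
  {η ∈ radialLimitSet o G | approxExponent b o G ξ η = ⊤}

/-- `H_{ξ,σ,s}(r)`: the `s`-dimensional Hausdorff content of the part of the `σ`-radial limit set
in the closed ball of radius `r` about `ξ`. -/
def radialContent (o : X) (G : Subgroup (X ≃ᵢ X)) (ξ : GromovBoundary X) (σ s r : ℝ) : ℝ≥0∞ :=
  hausdorffContent s (Metric.closedBall ξ r ∩ sigmaRadialLimitSet o G σ)

/-- `liminf_{r → 0} log_b H_{ξ,σ,s}(r) / log_b r`. -/
def sigmaDecay (b : ℝ) (o : X) (G : Subgroup (X ≃ᵢ X)) (ξ : GromovBoundary X) (s σ : ℝ) : EReal :=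
  liminf (fun r : ℝ => elogb b (radialContent o G ξ σ s r) / ((Real.logb b r : ℝ) : EReal))
    (𝓝[>] 0)

/-- `P_ξ(s) = lim_{σ → ∞} liminf_{r → 0} log_b H_{ξ,σ,s}(r) / log_b r`. The limit exists by
monotonicity in `σ`: see `tendsto_sigmaDecay`. -/
def contentDecay (b : ℝ) (o : X) (G : Subgroup (X ≃ᵢ X)) (ξ : GromovBoundary X) (s : ℝ) : EReal :=
  limUnder atTop (sigmaDecay b o G ξ s)

theorem hausdorffContent_mono {Z : Type*} [MetricSpace Z] (s : ℝ) {S T : Set Z} (h : S ⊆ T) :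
    hausdorffContent s S ≤ hausdorffContent s T :=
  le_iInf₂ fun t ht => iInf₂_le t (h.trans ht)

theorem antitone_sigmaDecay {b : ℝ} (hb : 1 < b) (o : X) (G : Subgroup (X ≃ᵢ X))
    (ξ : GromovBoundary X) (s : ℝ) : Antitone (sigmaDecay b o G ξ s) := by
  intro σ τ h
  refine liminf_le_liminf ?_
  have : ∀ᶠ r : ℝ in 𝓝[>] 0, r ∈ Ioo (0 : ℝ) 1 := Ioo_mem_nhdsGT one_pos
  filter_upwards [this] with r hr
  have h1 : radialContent o G ξ σ s r ≤ radialContent o G ξ τ s r := by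
    refine hausdorffContent_mono s (inter_subset_inter_right _ ?_)
    rintro η ⟨g, hg, hσ⟩
    exact ⟨g, hg, fun n => (hσ n).trans (by exact_mod_cast h)⟩
  have h2 : elogb b (radialContent o G ξ σ s r) ≤ elogb b (radialContent o G ξ τ s r) :=
    EReal.div_le_div_right_of_nonneg (by exact_mod_cast (Real.log_pos hb).le)
      (ENNReal.log_monotone h1)
  have h3 : ((Real.logb b r : ℝ) : EReal) ≤ 0 := by
    exact_mod_cast (Real.logb_neg hb hr.1 hr.2).le
  exact EReal.div_le_div_right_of_nonpos h3 h2

theorem tendsto_sigmaDecay {b : ℝ} (hb : 1 < b) (o : X) (G : Subgroup (X ≃ᵢ X))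
    (ξ : GromovBoundary X) (s : ℝ) :
    Tendsto (sigmaDecay b o G ξ s) atTop (𝓝 (contentDecay b o G ξ s)) :=
  tendsto_nhds_limUnder ⟨_, tendsto_atTop_iInf (antitone_sigmaDecay hb o G ξ s)⟩

end Approximation

end HypDioph

end

open HypDioph

/-! Write |g| for d(o, g(o)). All arguments are coarse: boundary points are handled through
representing sequences, and a visual metric turns "distance at most b^(-R)" into "Gromov product at
least R" up to an additive constant (`IsVisConst`).

Upper bound. If η lies within b^(-(1+c)|g|) of g(ξ), then g⁻¹(η) lies within about b^(-(1+c)|g|+θ)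
of ξ for some θ ≤ |g|, and g scales distances there by at most about b^(-θ). So if the part of the
radial set in B(ξ,r) has s-content O(r^p) with p ≥ s, the corresponding part near g(ξ) has s-content
O(b^(-(s+cp)|g|)), the worst case being θ = |g|. When s + cp > δ the Poincaré series makes these
contents summable, and the dimension of W_{c,ξ} is at most s (`exists_hausdorffContent_ball_le`,
`dimH_wellApproxSet_le`). Since B(ξ,r) always has s-content at most (2r)^s, the choice p = s is
always allowed; it yields δ/(c+1).

Lower bound (`le_dimH_wellApproxSet`). Suppose the content in B(ξ,r) is at least r^p for arbitrarily
small r, and s + cp < s' < δ. A Cantor set in W_{c,ξ} is obtained as the limit set of a tree of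
group elements. Long runs of levels use one separated family in an annulus of radius N, of
cardinality more than a constant times b^(s'N), which exists because the Poincaré series diverges
below δ (`exists_separated_annulus`). Each run ends with a single jump level, whose elements z have
orbit points in the direction of ξ up to depth R and carry a Frostman weight obtained from the
content (`exists_frostman_family`). If u is the product before the jump, the limit point lies within
about b^(-|u|-R) of u(ξ), so R ≈ c|u| produces the exponent 1 + c. The Frostman constant of the
jump, about b^(pR) ≈ b^(cp|u|), is paid for by the surplus s' - s of decay gathered during the run.
Between consecutive factors a connecting element, a power of one of two independent loxodromics,
prevents backtracking (`exists_connectors`). A mass distribution principle for finitely branching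
trees (`le_dimH_of_tree`) bounds the dimension below.

Formulas. P_ξ is nondecreasing in s and (δ-s)/c is strictly decreasing, so the two bounds meet where
they cross. -/

noncomputable section

namespace HypDioph

/-! ### Coarse geometry of the Gromov product -/

section Coarse

variable {X : Type*} [MetricSpace X]

/-- `K` is a nonnegative error constant for which the Gromov inequality holds. -/
def IsHypConst (X : Type*) [MetricSpace X] (K : ℝ) : Prop :=
  0 ≤ K ∧ ∀ x y z w : X, min (gromovProd w x y) (gromovProd w y z) - K ≤ gromovProd w x z

theorem exists_isHypConst (X : Type*) [MetricSpace X] [GromovHyperbolic X] :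
    ∃ K, IsHypConst X K := by
  obtain ⟨K, hK⟩ := GromovHyperbolic.gromov_inequality (X := X)
  exact ⟨max K 0, le_max_right _ _, fun x y z w =>
    (sub_le_sub_left (le_max_left K 0) _).trans (hK x y z w)⟩

theorem IsHypConst.le_trans {K : ℝ} (h : IsHypConst X K) {R : ℝ} {w x y z : X}
    (h1 : R ≤ gromovProd w x y) (h2 : R ≤ gromovProd w y z) : R - K ≤ gromovProd w x z :=
  (sub_le_sub_right (le_min h1 h2) K).trans (h.2 x y z w)

/-- If `⟨x|z⟩` is small then one of `⟨x|y⟩`, `⟨y|z⟩` is. -/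
theorem IsHypConst.le_of_lt {K : ℝ} (h : IsHypConst X K) {R : ℝ} {w x y z : X}
    (h1 : gromovProd w x z ≤ R) (h2 : R + K < gromovProd w y z) : gromovProd w x y ≤ R + K := by
  by_contra! h3
  have h4 := h.2 x y z w
  have h5 := lt_min h3 h2
  linarith

theorem gromovProd_nonneg (z x y : X) : 0 ≤ gromovProd z x y := by
  unfold gromovProd
  have := dist_triangle_right x y z
  linarith

theorem gromovProd_le_left (z x y : X) : gromovProd z x y ≤ dist z x := by
  unfold gromovProd
  have := dist_triangle y x z
  rw [dist_comm y x] at this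
  rw [dist_comm z x]
  linarith

theorem gromovProd_le_right (z x y : X) : gromovProd z x y ≤ dist z y := by
  rw [gromovProd_comm]; exact gromovProd_le_left z y x

theorem gromovProd_self (z x : X) : gromovProd z x x = dist z x := by
  unfold gromovProd; rw [dist_self, dist_comm]; ring

theorem gromovProd_add_swap (o x y : X) : gromovProd o x y + gromovProd y o x = dist o y := by
  unfold gromovProd
  rw [dist_comm y o, dist_comm x o]; ring

theorem gromovProd_base_change (o z x y : X) :
    gromovProd z x y = gromovProd o x y + dist o z - gromovProd o z x - gromovProd o z y := by
  unfold gromovProd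
  rw [dist_comm z o, dist_comm z x, dist_comm z y]; ring

theorem gromovProd_map (g : X ≃ᵢ X) (z x y : X) :
    gromovProd (g z) (g x) (g y) = gromovProd z x y := by
  rw [gromovProd_isometry, g.symm_apply_apply]

theorem inv_apply_eq_symm (g : X ≃ᵢ X) (x : X) : g⁻¹ x = g.symm x := rfl

theorem gromovProd_map_left (g : X ≃ᵢ X) (z x y : X) :
    gromovProd z (g x) (g y) = gromovProd (g⁻¹ z) x y := gromovProd_isometry g z x y

theorem gromovProd_map_mid (g : X ≃ᵢ X) (z x y : X) :
    gromovProd (g z) (g x) y = gromovProd z x (g⁻¹ y) := by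
  rw [← gromovProd_map g z x (g⁻¹ y), inv_apply_eq_symm, g.apply_symm_apply]

theorem dist_inv_apply (g : X ≃ᵢ X) (o : X) : dist o (g⁻¹ o) = dist o (g o) := by
  rw [← g.dist_eq o (g⁻¹ o), inv_apply_eq_symm, g.apply_symm_apply, dist_comm]

theorem dist_mul_le (g h : X ≃ᵢ X) (o : X) :
    dist o ((g * h) o) ≤ dist o (g o) + dist o (h o) := by
  rw [IsometryEquiv.mul_apply]
  exact (dist_triangle o (g o) _).trans_eq (by rw [g.dist_eq])

/-- The length of a product, in terms of backtracking. -/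
theorem dist_mul_eq (g h : X ≃ᵢ X) (o : X) :
    dist o ((g * h) o) = dist o (g o) + dist o (h o) - 2 * gromovProd o (g⁻¹ o) (h o) := by
  have h1 : dist (g⁻¹ o) (h o) = dist o ((g * h) o) := by
    rw [← g.dist_eq (g⁻¹ o), inv_apply_eq_symm, g.apply_symm_apply, IsometryEquiv.mul_apply]
  unfold gromovProd
  rw [h1, dist_comm (g⁻¹ o) o, dist_inv_apply, dist_comm (h o) o]; ring

end Coarse

/-! ### The boundary, by sequences -/

section Boundary

variable {X : Type*} [MetricSpace X] [GromovHyperbolic X]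

/-- A Gromov sequence representing a boundary point. -/
def GromovBoundary.rep (ξ : GromovBoundary X) : GromovSeq X := Quotient.out ξ

@[simp] theorem GromovBoundary.toBoundary_rep (ξ : GromovBoundary X) : ξ.rep.toBoundary = ξ :=
  Quotient.out_eq ξ

theorem boundaryMap_toBoundary (g : X ≃ᵢ X) (x : GromovSeq X) :
    boundaryMap g x.toBoundary = (x.map g).toBoundary := rfl

/-- Equivalence controls only the diagonal; one Gromov inequality through a further term of `x`
frees the two indices. -/
theorem tendsto_gromovProd_of_toBoundary_eq {x y : GromovSeq X}
    (h : x.toBoundary = y.toBoundary) (o : X) :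
    Tendsto (fun p : ℕ × ℕ => gromovProd o (x.1 p.1) (y.1 p.2)) atTop atTop := by
  obtain ⟨K, hK⟩ := exists_isHypConst X
  have he : GromovEquiv x.1 y.1 := Quotient.exact (s := gromovSetoid X) h
  refine tendsto_atTop.2 fun a => ?_
  have h1 := tendsto_atTop.1 (x.2 o) (a + K)
  have h2 := tendsto_atTop.1 (he o) (a + K)
  rw [← prod_atTop_atTop_eq] at h1 ⊢
  have h3 : ∀ᶠ p : ℕ × ℕ in atTop ×ˢ atTop, a + K ≤ gromovProd o (x.1 p.2) (y.1 p.2) :=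
    tendsto_snd.eventually h2
  filter_upwards [h1, h3] with p hp1 hp2
  have := hK.le_trans hp1 hp2
  linarith

/-- A large product may be tested along one pair of representing sequences. -/
theorem eventually_le_gromovProd_of_frequently {K : ℝ} (hK : IsHypConst X K) {o : X} {R : ℝ}
    {x y x' y' : GromovSeq X} (hx : x'.toBoundary = x.toBoundary)
    (hy : y'.toBoundary = y.toBoundary) (h : ∃ᶠ n in atTop, R ≤ gromovProd o (x.1 n) (y.1 n)) :
    ∀ᶠ p : ℕ × ℕ in atTop, R - 2 * K ≤ gromovProd o (x'.1 p.1) (y'.1 p.2) := by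
  obtain ⟨⟨a, a'⟩, ha⟩ := eventually_atTop.1
    (tendsto_atTop.1 (tendsto_gromovProd_of_toBoundary_eq hx o) R)
  obtain ⟨⟨c, c'⟩, hc⟩ := eventually_atTop.1
    (tendsto_atTop.1 (tendsto_gromovProd_of_toBoundary_eq hy o) R)
  obtain ⟨n, hn, hR⟩ := frequently_atTop.1 h (max a' c')
  refine eventually_atTop.2 ⟨(a, c), fun p hp => ?_⟩
  have h1 : R ≤ gromovProd o (x'.1 p.1) (x.1 n) := ha (p.1, n) ⟨hp.1, (le_max_left _ _).trans hn⟩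
  have h2 : R ≤ gromovProd o (y.1 n) (y'.1 p.2) := by
    rw [gromovProd_comm]; exact hc (p.2, n) ⟨hp.2, (le_max_right _ _).trans hn⟩
  have h3 := hK.le_trans h1 hR
  have h4 := hK.le_trans h3 (h2.trans' (by linarith [hK.1]))
  linarith

theorem le_boundaryProd_of_frequently {K : ℝ} (hK : IsHypConst X K) {o : X} {R : ℝ}
    {x y : GromovSeq X} (h : ∃ᶠ n in atTop, R ≤ gromovProd o (x.1 n) (y.1 n)) :
    ((R - 2 * K : ℝ) : EReal) ≤ boundaryProd o x.toBoundary y.toBoundary := by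
  refine le_iInf₂ fun x' hx => le_iInf₂ fun y' hy => le_liminf_of_le (by isBoundedDefault) ?_
  filter_upwards [eventually_le_gromovProd_of_frequently hK hx hy h] with p hp
  exact_mod_cast hp

theorem eventually_le_of_lt_boundaryProd {o : X} {R : ℝ} {x y : GromovSeq X}
    (h : (R : EReal) < boundaryProd o x.toBoundary y.toBoundary) :
    ∀ᶠ n in atTop, R ≤ gromovProd o (x.1 n) (y.1 n) := by
  have h1 : (R : EReal) < liminf (fun p : ℕ × ℕ =>
      ((gromovProd o (x.1 p.1) (y.1 p.2) : ℝ) : EReal)) atTop :=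
    h.trans_le (iInf_le_of_le x (iInf_le_of_le rfl (iInf_le_of_le y (iInf_le _ rfl))))
  have h2 := eventually_lt_of_lt_liminf h1
  have h3 : Tendsto (fun n : ℕ => (n, n)) atTop (atTop : Filter (ℕ × ℕ)) := tendsto_atTop_diagonal
  filter_upwards [h3.eventually h2] with n hn
  exact_mod_cast hn.le

variable [MetricSpace (GromovBoundary X)]

/-- The coarse description of a visual metric by representing sequences, with constant `V`. -/
def IsVisConst (b : ℝ) (o : X) (V : ℝ) : Prop :=
  0 ≤ V ∧
  (∀ (x y : GromovSeq X) (R : ℝ), (∃ᶠ n in atTop, R ≤ gromovProd o (x.1 n) (y.1 n)) →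
    dist x.toBoundary y.toBoundary ≤ b ^ (V - R)) ∧
  (∀ (x y : GromovSeq X) (R : ℝ), dist x.toBoundary y.toBoundary ≤ b ^ (-R) →
    ∀ᶠ n in atTop, R - V ≤ gromovProd o (x.1 n) (y.1 n))

theorem exp_log_mul_coe {b : ℝ} (hb : 1 < b) (R : ℝ) :
    EReal.exp (-((Real.log b : ℝ) : EReal) * ((R : ℝ) : EReal)) = ENNReal.ofReal (b ^ (-R)) := by
  have : -((Real.log b : ℝ) : EReal) * ((R : ℝ) : EReal) = ((Real.log b * (-R) : ℝ) : EReal) := by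
    push_cast; simp [mul_neg]
  rw [this, EReal.exp_coe, Real.rpow_def_of_pos (by linarith)]

/-- The multiplicative constant becomes the additive `L`. The term `2 * K` pays for bounding an
infimum over all representatives by one pair of them; the final `1` provides the strict inequality
in the second clause. -/
theorem IsVisualMetric.exists_isVisConst {b : ℝ} (hb : 1 < b) {o : X} (hD : IsVisualMetric b o) :
    ∃ V, IsVisConst b o V := by
  obtain ⟨K, hK⟩ := exists_isHypConst X
  obtain ⟨C, hC⟩ := hD
  have hb0 : 0 < b := by linarith
  set L : ℝ := Real.logb b (max C 1) with hL
  have hCm : (0 : ℝ) < max (C : ℝ) 1 := lt_max_of_lt_right one_pos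
  have hCL : (C : ℝ) ≤ b ^ L := by
    rw [hL, Real.rpow_logb hb0 hb.ne' hCm]; exact le_max_left _ _
  have hL0 : 0 ≤ L := Real.logb_nonneg hb (le_max_right _ _)
  have hmul : ∀ R : ℝ, (C : ℝ≥0∞) * ENNReal.ofReal (b ^ R) ≤ ENNReal.ofReal (b ^ (L + R)) := by
    intro R
    rw [← ENNReal.ofReal_coe_nnreal, ← ENNReal.ofReal_mul C.coe_nonneg, Real.rpow_add hb0]
    exact ENNReal.ofReal_le_ofReal (by gcongr)
  have hneg : -((Real.log b : ℝ) : EReal) ≤ 0 := by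
    rw [← EReal.coe_neg]; exact_mod_cast neg_nonpos.2 (Real.log_pos hb).le
  refine ⟨L + 2 * K + 1, by linarith [hK.1], fun x y R h => ?_, fun x y R h => ?_⟩
  · have h1 := le_boundaryProd_of_frequently hK h
    have h2 : edist x.toBoundary y.toBoundary ≤ ENNReal.ofReal (b ^ (L + 2 * K - R)) := by
      refine (hC _ _).1.trans ?_
      refine le_trans ?_ ((hmul (2 * K - R)).trans_eq (by ring_nf))
      gcongr
      calc EReal.exp (-((Real.log b : ℝ) : EReal) * boundaryProd o x.toBoundary y.toBoundary)
          ≤ EReal.exp (-((Real.log b : ℝ) : EReal) * ((R - 2 * K : ℝ) : EReal)) :=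
            EReal.exp_monotone (by
              simp only [EReal.neg_mul]
              exact EReal.neg_le_neg_iff.2 (mul_le_mul_of_nonneg_left h1
                (by exact_mod_cast (Real.log_pos hb).le)))
        _ = _ := by rw [exp_log_mul_coe hb]; ring_nf
    rw [edist_dist] at h2
    refine ((ENNReal.ofReal_le_ofReal_iff (by positivity)).1 h2).trans ?_
    exact Real.rpow_le_rpow_of_exponent_le hb.le (by linarith)
  · refine eventually_le_of_lt_boundaryProd ?_
    by_contra! hcon
    have h1 : EReal.exp (-((Real.log b : ℝ) : EReal) * boundaryProd o x.toBoundary y.toBoundary)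
        ≤ ENNReal.ofReal (b ^ (L - R)) := by
      refine (hC _ _).2.trans (le_trans ?_ ((hmul (-R)).trans_eq (by ring_nf)))
      gcongr
      rw [edist_dist]
      exact ENNReal.ofReal_le_ofReal h
    have h2 : ENNReal.ofReal (b ^ (-(R - (L + 2 * K + 1)))) ≤
        EReal.exp (-((Real.log b : ℝ) : EReal) * boundaryProd o x.toBoundary y.toBoundary) := by
      rw [← exp_log_mul_coe hb]
      exact EReal.exp_monotone (by
              simp only [EReal.neg_mul]
              exact EReal.neg_le_neg_iff.2 (mul_le_mul_of_nonneg_left hcon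
                (by exact_mod_cast (Real.log_pos hb).le)))
    have h3 := (ENNReal.ofReal_le_ofReal_iff (by positivity)).1 (h2.trans h1)
    rw [Real.rpow_le_rpow_left_iff hb] at h3
    linarith [hK.1]

end Boundary

/-! ### The radial limit set, by sequences -/

section Radial

variable {X : Type*} [MetricSpace X]

/-- The sequence `x` meets the `σ`-shadows of arbitrarily long elements of `G`. -/
def IsRadialSeq (o : X) (G : Subgroup (X ≃ᵢ X)) (σ : ℝ) (x : ℕ → X) : Prop :=
  ∀ T : ℝ, ∃ g ∈ G, T ≤ dist o (g o) ∧ ∀ᶠ m in atTop, gromovProd (g o) o (x m) ≤ σ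

theorem IsRadialSeq.mono {o : X} {G : Subgroup (X ≃ᵢ X)} {σ τ : ℝ} {x : ℕ → X}
    (h : IsRadialSeq o G σ x) (hστ : σ ≤ τ) : IsRadialSeq o G τ x := fun T => by
  obtain ⟨g, hg, hT, hm⟩ := h T
  exact ⟨g, hg, hT, hm.mono fun m hm => hm.trans hστ⟩

/-- The loss `1` selects a representative nearly realizing the infimum, and `K` transfers its bound
to the given representative. -/
theorem isRadialSeq_of_mem_sigmaRadialLimitSet [GromovHyperbolic X] {K : ℝ} (hK : IsHypConst X K) {o : X}
    {G : Subgroup (X ≃ᵢ X)} {σ : ℝ} (x : GromovSeq X)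
    (h : x.toBoundary ∈ sigmaRadialLimitSet o G σ) : IsRadialSeq o G (σ + 1 + K) x.1 := by
  obtain ⟨g, hg, hσ⟩ := h
  intro T
  obtain ⟨n, hn⟩ := (hg.eventually (lt_mem_nhds (EReal.coe_lt_top T))).exists
  refine ⟨(g n).1, (g n).2, ?_, ?_⟩
  · have h1 : (T : EReal) < liminf (fun m : ℕ =>
        ((gromovProd o (x.1 m) ((g n).1 o) : ℝ) : EReal)) atTop :=
      hn.trans_le (iInf_le_of_le x (iInf_le _ rfl))
    obtain ⟨m, hm⟩ := (eventually_lt_of_lt_liminf h1).exists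
    exact (show T ≤ _ by exact_mod_cast hm.le).trans (gromovProd_le_right _ _ _)
  · have h1 : mixedProd ((g n).1 o) o x.toBoundary < ((σ + 1 : ℝ) : EReal) :=
      (hσ n).trans_lt (by exact_mod_cast lt_add_one σ)
    simp only [mixedProd, iInf_lt_iff] at h1
    obtain ⟨y, hy, hlim⟩ := h1
    have h2 := frequently_lt_of_liminf_lt (by isBoundedDefault) hlim
    obtain ⟨⟨a, a'⟩, ha⟩ := eventually_atTop.1
      (tendsto_atTop.1 (tendsto_gromovProd_of_toBoundary_eq hy ((g n).1 o)) (σ + 1 + K + 1))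
    obtain ⟨k, hk, hkσ⟩ := frequently_atTop.1 h2 a
    have hkσ' : gromovProd ((g n).1 o) (y.1 k) o < σ + 1 := by exact_mod_cast hkσ
    filter_upwards [eventually_ge_atTop a'] with m hm
    have h3 := ha (k, m) ⟨hk, hm⟩
    have := hK.le_of_lt (w := (g n).1 o) (x := o) (y := x.1 m) (z := y.1 k) (R := σ + 1)
      (by rw [gromovProd_comm]; exact hkσ'.le) (by rw [gromovProd_comm]; simp only at h3; linarith)
    exact this

/-- There is no loss, because the sequence itself is a competitor in the infimum. Convergence of the
orbit points is automatic: ⟨x_m|g(o)⟩_o = |g| - ⟨o|x_m⟩_{g(o)} ≥ |g| - σ. -/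
theorem mem_sigmaRadialLimitSet_of_isRadialSeq [GromovHyperbolic X] {o : X}
    {G : Subgroup (X ≃ᵢ X)} {σ : ℝ} (x : GromovSeq X) (h : IsRadialSeq o G σ x.1) :
    x.toBoundary ∈ sigmaRadialLimitSet o G σ := by
  obtain ⟨K, hK⟩ := exists_isHypConst X
  choose g hg hT hm using fun n : ℕ => h n
  refine ⟨fun n => ⟨g n, hg n⟩, ?_, fun n => ?_⟩
  · rw [EReal.tendsto_nhds_top_iff_real]
    intro a
    obtain ⟨N, hN⟩ := exists_nat_gt (a + σ + K)
    filter_upwards [eventually_ge_atTop N] with n hn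
    have hn' : (N : ℝ) ≤ n := by exact_mod_cast hn
    refine lt_of_lt_of_le (b := ((n - σ - K : ℝ) : EReal)) (by exact_mod_cast (by linarith)) ?_
    refine le_iInf₂ fun y hy => le_liminf_of_le (by isBoundedDefault) ?_
    obtain ⟨⟨c, c'⟩, hc⟩ := eventually_atTop.1
      (tendsto_atTop.1 (tendsto_gromovProd_of_toBoundary_eq hy o) (n - σ))
    obtain ⟨k, hkc, hk⟩ := ((eventually_ge_atTop c').and (hm n)).exists
    filter_upwards [eventually_ge_atTop c] with m hmc
    have h1 : (n : ℝ) - σ ≤ gromovProd o (x.1 k) (g n o) := by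
      have := gromovProd_add_swap o (x.1 k) (g n o)
      linarith [hT n]
    have := hK.le_trans (hc (m, k) ⟨hmc, hkc⟩) h1
    exact_mod_cast this
  · refine iInf₂_le_of_le x rfl ?_
    refine liminf_le_of_le (by isBoundedDefault) fun a ha => ?_
    obtain ⟨m, hm1, hm2⟩ := (ha.and (hm n)).exists
    refine hm1.trans ?_
    rw [gromovProd_comm]
    exact_mod_cast hm2

/-- Radial sequences are invariant under the group, up to a uniform loss. -/
theorem IsRadialSeq.map {K : ℝ} (hK : IsHypConst X K) {o : X} {G : Subgroup (X ≃ᵢ X)} {σ : ℝ}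
    {x : ℕ → X} (h : IsRadialSeq o G σ x) {f : X ≃ᵢ X} (hf : f ∈ G) :
    IsRadialSeq o G (σ + K) (fun n => f (x n)) := by
  intro T
  -- The first bound keeps `f * g` longer than `T`. The second makes `f⁻¹ o` and `o` nearly
  -- indistinguishable as seen from `g o`.
  obtain ⟨g, hg, hT, hm⟩ := h (max (T + dist o (f o)) (σ + K + 1 + dist o (f o)))
  refine ⟨f * g, G.mul_mem hf hg, ?_, ?_⟩
  · have h1 : dist o (g o) ≤ dist o (f o) + dist o ((f * g) o) := by
      have := dist_mul_le f⁻¹ (f * g) o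
      rwa [inv_mul_cancel_left, dist_inv_apply] at this
    linarith [le_max_left (T + dist o (f o)) (σ + K + 1 + dist o (f o))]
  · filter_upwards [hm] with m hm
    rw [IsometryEquiv.mul_apply, gromovProd_comm, gromovProd_map_mid f]
    rw [gromovProd_comm]
    have h2 := hK.le_of_lt (w := g o) (x := x m) (y := f⁻¹ o) (z := o) (R := σ)
      (by rw [gromovProd_comm]; exact hm) ?_
    · rw [gromovProd_comm]; exact h2
    · have h3 := gromovProd_add_swap (g o) (f⁻¹ o) o
      have h4 := gromovProd_le_right o (g o) (f⁻¹ o)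
      rw [dist_inv_apply] at h4
      rw [dist_comm] at h3
      linarith [le_max_right (T + dist o (f o)) (σ + K + 1 + dist o (f o))]

end Radial

/-! ### Hausdorff dimension of sets generated by finitely branching trees

Nodes of the tree are words, the most recent letter first. -/

section Tree

variable {α Z : Type*}

/-- The words that can be reached from the empty word. -/
def Reach (kids : List α → Finset α) : List α → Prop
  | [] => True
  | a :: l => Reach kids l ∧ a ∈ kids l

/-- The mass of a word, for transition weights `p`. -/
def wordMass (p : List α → α → ℝ≥0∞) : List α → ℝ≥0∞
  | [] => 1
  | a :: l => wordMass p l * p l a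

/-- The word formed by the first `n` letters of a sequence. -/
def word (ω : ℕ → α) : ℕ → List α
  | 0 => []
  | n + 1 => ω n :: word ω n

/-- The infinite branches of the tree. -/
def IsBranch (kids : List α → Finset α) (ω : ℕ → α) : Prop := ∀ n, ω n ∈ kids (word ω n)

/-- `P` holds at all descendants of a word at relative depth `k`. -/
def AllBelow (kids : List α → Finset α) (P : List α → Prop) : ℕ → List α → Prop
  | 0, l => P l
  | k + 1, l => ∀ a ∈ kids l, AllBelow kids P k (a :: l)

open Classical in
/-- The mass of the descendants at relative depth `k` that satisfy `Q`. -/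
def descMass (kids : List α → Finset α) (p : List α → α → ℝ≥0∞) (Q : List α → Prop) :
    ℕ → List α → ℝ≥0∞
  | 0, l => if Q l then wordMass p l else 0
  | k + 1, l => ∑ a ∈ kids l, descMass kids p Q k (a :: l)

/-- Some branch through the word `l` has its limit in `U`. -/
def Hits (kids : List α → Finset α) (π : (ℕ → α) → Z) (U : Set Z) (l : List α) : Prop :=
  ∃ ω, IsBranch kids ω ∧ word ω l.length = l ∧ π ω ∈ U

variable {kids : List α → Finset α} {p : List α → α → ℝ≥0∞}

@[simp] theorem length_word (ω : ℕ → α) (n : ℕ) : (word ω n).length = n := by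
  induction n with
  | zero => rfl
  | succ n ih => simp [word, ih]

theorem IsBranch.reach {ω : ℕ → α} (h : IsBranch kids ω) (n : ℕ) : Reach kids (word ω n) := by
  induction n with
  | zero => trivial
  | succ n ih => exact ⟨ih, h n⟩

theorem word_eq_of_word_add_eq {ω ω' : ℕ → α} {n : ℕ} (k : ℕ)
    (h : word ω (n + k) = word ω' (n + k)) : word ω n = word ω' n := by
  induction k with
  | zero => exact h
  | succ k ih => exact ih (List.cons.inj h).2

theorem AllBelow.succ {P : List α → Prop}
    (hP : ∀ l a, Reach kids l → a ∈ kids l → P l → P (a :: l)) {k : ℕ} {l : List α}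
    (hl : Reach kids l) (h : AllBelow kids P k l) : AllBelow kids P (k + 1) l := by
  induction k generalizing l with
  | zero => exact fun a ha => hP l a hl ha h
  | succ k ih => exact fun a ha => ih ⟨hl, ha⟩ (h a ha)

theorem AllBelow.mono {P : List α → Prop}
    (hP : ∀ l a, Reach kids l → a ∈ kids l → P l → P (a :: l)) {k m : ℕ} (hkm : k ≤ m)
    {l : List α} (hl : Reach kids l) (h : AllBelow kids P k l) : AllBelow kids P m l := by
  induction m, hkm using Nat.le_induction with
  | base => exact h
  | succ m _ ih => exact ih.succ hP hl

/-- Extension of a word to a branch by a choice function. -/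
theorem exists_branch_of_next {P : List α → Prop} (l₀ : List α) (h₀ : Reach kids l₀) (hP₀ : P l₀)
    (hnext : ∀ l, Reach kids l → P l → ∃ a ∈ kids l, P (a :: l)) :
    ∃ ω, IsBranch kids ω ∧ word ω l₀.length = l₀ ∧ ∀ n, l₀.length ≤ n → P (word ω n) := by
  classical
  have hne : Nonempty α := by
    obtain ⟨a, -, -⟩ := hnext l₀ h₀ hP₀
    exact ⟨a⟩
  choose! next hk hPn using hnext
  set w : ℕ → List α := fun n => Nat.rec l₀ (fun _ l => next l :: l) n with hw
  have hw1 : ∀ n, w (n + 1) = next (w n) :: w n := fun n => rfl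
  have hwP : ∀ n, Reach kids (w n) ∧ P (w n) := by
    intro n
    induction n with
    | zero => exact ⟨h₀, hP₀⟩
    | succ n ih => exact ⟨⟨ih.1, hk _ ih.1 ih.2⟩, hPn _ ih.1 ih.2⟩
  -- Words store the latest letter first, so the initial letters are read from the reversed list.
  set ω : ℕ → α := fun n => if h : n < l₀.length then l₀.reverse[n]'(by simpa using h)
    else next (w (n - l₀.length)) with hω
  have key : ∀ (l : List α) (m : ℕ), m ≤ l.length →
      (∀ n (h : n < l.length), ω n = l.reverse[n]'(by simpa using h)) → word ω l.length = l := by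
    intro l
    induction l with
    | nil => intros; rfl
    | cons a l ih =>
      intro m _ h
      have h1 : ω l.length = a := by
        rw [h l.length (by simp)]; simp
      have h2 : word ω l.length = l := ih 0 (Nat.zero_le _) fun n hn => by
        rw [h n (by simp; omega)]
        simp only [List.reverse_cons]
        rw [List.getElem_append_left (by simpa using hn)]
      simp [word, h1, h2]
  have hbase : word ω l₀.length = l₀ := key l₀ 0 (Nat.zero_le _) fun n hn => by simp [hω, hn]
  have hrec : ∀ k, word ω (l₀.length + k) = w k := by
    intro k
    induction k with
    | zero => exact hbase
    | succ k ih =>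
      rw [← Nat.add_assoc, hw1, word, ih]
      simp [hω]
  refine ⟨ω, fun n => ?_, hbase, fun n hn => ?_⟩
  · rcases lt_or_ge n l₀.length with hn | hn
    · obtain ⟨k, hk'⟩ := Nat.exists_eq_add_of_lt hn
      have : ∀ (l : List α), Reach kids l → word ω l.length = l → ∀ n, n < l.length →
          ω n ∈ kids (word ω n) := by
        intro l
        induction l with
        | nil => intro _ _ n hn; simp at hn
        | cons a l ih =>
          intro hr hwd n hn
          obtain ⟨h1, h2⟩ := List.cons.inj hwd
          rcases Nat.lt_succ_iff_lt_or_eq.1 hn with hn | rfl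
          · exact ih hr.1 h2 n hn
          · rw [h1, h2]; exact hr.2
      exact this l₀ h₀ hbase n hn
    · obtain ⟨k, rfl⟩ := Nat.exists_eq_add_of_le hn
      rw [hrec]
      have : ω (l₀.length + k) = next (w k) := by simp [hω]
      rw [this]
      exact hk _ (hwP k).1 (hwP k).2
  · obtain ⟨k, rfl⟩ := Nat.exists_eq_add_of_le hn
    rw [hrec]; exact (hwP k).2

/-- The fan theorem: a hereditary property met along every branch holds from some depth on. -/
theorem exists_allBelow {P : List α → Prop}
    (hP : ∀ l a, Reach kids l → a ∈ kids l → P l → P (a :: l))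
    (hbr : ∀ ω, IsBranch kids ω → ∃ n, P (word ω n)) : ∃ k, AllBelow kids P k [] := by
  classical
  by_contra! hcon
  obtain ⟨ω, hω, -, hbad⟩ := exists_branch_of_next (kids := kids)
    (P := fun l => ∀ k, ¬ AllBelow kids P k l) [] trivial hcon (by
      intro l hl hbad
      by_contra! h
      choose! k hk using h
      -- Finite branching enters here: one depth serves all children at once.
      refine hbad ((kids l).sup k + 1) fun a ha => ?_
      exact (hk a ha).mono hP (Finset.le_sup ha) ⟨hl, ha⟩)
  obtain ⟨n, hn⟩ := hbr ω hω
  exact hbad n (Nat.zero_le _) 0 hn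

variable (hp : ∀ l, Reach kids l → ∑ a ∈ kids l, p l a = 1)
include hp

theorem wordMass_eq_sum {l : List α} (hl : Reach kids l) :
    wordMass p l = ∑ a ∈ kids l, wordMass p (a :: l) := by
  simp only [wordMass, ← Finset.mul_sum, hp l hl, mul_one]

theorem wordMass_cons_le {l : List α} (hl : Reach kids l) {a : α} (ha : a ∈ kids l) :
    wordMass p (a :: l) ≤ wordMass p l := by
  rw [wordMass_eq_sum hp hl]
  exact Finset.single_le_sum (f := fun a => wordMass p (a :: l)) (fun _ _ => zero_le) ha

theorem kids_nonempty {l : List α} (hl : Reach kids l) : (kids l).Nonempty := by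
  by_contra h
  rw [Finset.not_nonempty_iff_eq_empty] at h
  have := hp l hl
  simp [h] at this

theorem exists_branch_through {l : List α} (hl : Reach kids l) :
    ∃ ω, IsBranch kids ω ∧ word ω l.length = l := by
  obtain ⟨ω, h1, h2, -⟩ := exists_branch_of_next (kids := kids) (P := fun _ => True) l hl trivial
    fun l hl _ => by
      obtain ⟨a, ha⟩ := kids_nonempty hp hl
      exact ⟨a, ha, trivial⟩
  exact ⟨ω, h1, h2⟩

/-- Mass is conserved from a node to its children, and at depth `k` every descendant is counted for
at least one index. This replaces countable subadditivity of a measure on the limit set, so that no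
such measure has to be constructed. -/
theorem wordMass_le_tsum_descMass {Q : ℕ → List α → Prop} {k : ℕ} {l : List α}
    (hl : Reach kids l) (h : AllBelow kids (fun l => ∃ i, Q i l) k l) :
    wordMass p l ≤ ∑' i, descMass kids p (Q i) k l := by
  induction k generalizing l with
  | zero =>
    obtain ⟨i, hi⟩ := h
    refine le_trans ?_ (ENNReal.le_tsum i)
    simp [descMass, hi]
  | succ k ih =>
    rw [wordMass_eq_sum hp hl]
    simp only [descMass]
    rw [Summable.tsum_finsetSum fun _ _ => ENNReal.summable]
    exact Finset.sum_le_sum fun a ha => ih ⟨hl, ha⟩ (h a ha)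

theorem descMass_le (Q : List α → Prop) (k : ℕ) {l : List α} (hl : Reach kids l) :
    descMass kids p Q k l ≤ wordMass p l := by
  induction k generalizing l with
  | zero => simp only [descMass]; split_ifs <;> simp
  | succ k ih =>
    rw [wordMass_eq_sum hp hl]
    exact Finset.sum_le_sum fun a ha => ih ⟨hl, ha⟩

theorem hits_of_descMass_ne_zero {π : (ℕ → α) → Z} {U : Set Z} {Q : List α → Prop}
    (hQ : ∀ l, Q l → ∀ ω, IsBranch kids ω → word ω l.length = l → π ω ∈ U) {k : ℕ} {l : List α}
    (hl : Reach kids l) (h : descMass kids p Q k l ≠ 0) : Hits kids π U l := by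
  induction k generalizing l with
  | zero =>
    simp only [descMass, ne_eq, ite_eq_right_iff, not_forall] at h
    obtain ⟨ω, h1, h2⟩ := exists_branch_through hp hl
    exact ⟨ω, h1, h2, hQ l h.1 ω h1 h2⟩
  | succ k ih =>
    obtain ⟨a, ha, hne⟩ := Finset.exists_ne_zero_of_sum_ne_zero h
    obtain ⟨ω, h1, h2, h3⟩ := ih (l := a :: l) ⟨hl, ha⟩ hne
    exact ⟨ω, h1, (List.cons.inj h2).2, h3⟩

-- Going down from `l`, as long as only one child carries mass that child carries all of it. Either
-- a node with two such children is met, and the splitting bound applies to it, or the descent ends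
-- at a single word, whose mass is bounded by `hB`.
open Classical in
theorem descMass_le_of_split {π : (ℕ → α) → Z} {U : Set Z} {Q : List α → Prop} {B : ℝ≥0∞}
    (hQ : ∀ l, Q l → ∀ ω, IsBranch kids ω → word ω l.length = l → π ω ∈ U)
    (hB : ∀ l, Q l → wordMass p l ≤ B)
    (hsplit : ∀ l, Reach kids l → ∀ a ∈ kids l, ∀ a' ∈ kids l, a ≠ a' →
      Hits kids π U (a :: l) → Hits kids π U (a' :: l) →
      ∑ c ∈ kids l with Hits kids π U (c :: l), wordMass p (c :: l) ≤ B)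
    {k : ℕ} {l : List α} (hl : Reach kids l) : descMass kids p Q k l ≤ B := by
  induction k generalizing l with
  | zero =>
    simp only [descMass]
    split_ifs with h
    · exact hB l h
    · exact zero_le
  | succ k ih =>
    simp only [descMass]
    set S := (kids l).filter fun a => descMass kids p Q k (a :: l) ≠ 0 with hS
    have hsum : ∑ a ∈ kids l, descMass kids p Q k (a :: l) =
        ∑ a ∈ S, descMass kids p Q k (a :: l) := by
      rw [hS, Finset.sum_filter_ne_zero]
    have hSH : ∀ a ∈ S, a ∈ kids l ∧ Hits kids π U (a :: l) := fun a ha => by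
      rw [hS, Finset.mem_filter] at ha
      exact ⟨ha.1, hits_of_descMass_ne_zero hp hQ ⟨hl, ha.1⟩ ha.2⟩
    rw [hsum]
    rcases Nat.lt_or_ge 1 S.card with hc | hc
    · obtain ⟨a, ha, a', ha', hne⟩ := Finset.one_lt_card.1 hc
      refine le_trans ?_ (hsplit l hl a (hSH a ha).1 a' (hSH a' ha').1 hne (hSH a ha).2
        (hSH a' ha').2)
      refine (Finset.sum_le_sum fun c hc => descMass_le hp Q k (l := c :: l) ⟨hl, (hSH c hc).1⟩).trans ?_
      exact Finset.sum_le_sum_of_subset fun c hc => Finset.mem_filter.2 (hSH c hc)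
    · rcases S.eq_empty_or_nonempty with h0 | ⟨a, ha⟩
      · simp [h0]
      · have : S = {a} := Finset.eq_singleton_iff_unique_mem.2
          ⟨ha, fun x hx => Finset.card_le_one.1 hc x hx a ha⟩
        rw [this, Finset.sum_singleton]
        exact ih ⟨hl, (hSH a ha).1⟩

end Tree

/-! ### The mass distribution principle for limit sets of trees -/

section Dimension

variable {α Z : Type*} [MetricSpace Z]

theorem hausdorffContent_le_hausdorffMeasure [MeasurableSpace Z] [BorelSpace Z] (s : ℝ)
    (S : Set Z) : hausdorffContent s S ≤ MeasureTheory.Measure.hausdorffMeasure s S := by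
  rw [MeasureTheory.Measure.hausdorffMeasure_apply]
  refine le_iSup₂_of_le 1 one_pos ?_
  refine le_iInf₂ fun t ht => le_iInf fun _ => ?_
  exact iInf₂_le t ht

open Classical in
/-- The mass distribution principle for the limit set of a finitely branching tree. -/
theorem le_dimH_of_tree {kids : List α → Finset α} {p : List α → α → ℝ≥0∞}
    (hp : ∀ l, Reach kids l → ∑ a ∈ kids l, p l a = 1) {π : (ℕ → α) → Z}
    (hcont : ∀ ω, IsBranch kids ω → ∀ ε > 0, ∃ n, ∀ ω', IsBranch kids ω' →
      word ω' n = word ω n → dist (π ω') (π ω) < ε)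
    (hmass : ∀ ω, IsBranch kids ω → Tendsto (fun n => wordMass p (word ω n)) atTop (𝓝 0))
    {s C : ℝ} (hs : 0 < s) (hC : 0 < C)
    (hsplit : ∀ (U : Set Z) (ρ : ℝ), 0 < ρ → (∀ x ∈ U, ∀ y ∈ U, dist x y ≤ ρ) →
      ∀ l, Reach kids l → ∀ a ∈ kids l, ∀ a' ∈ kids l, a ≠ a' →
      Hits kids π U (a :: l) → Hits kids π U (a' :: l) →
      ∑ c ∈ kids l with Hits kids π U (c :: l), wordMass p (c :: l) ≤ ENNReal.ofReal (C * ρ ^ s)) :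
    ENNReal.ofReal s ≤ dimH (π '' {ω | IsBranch kids ω}) := by
  borelize Z
  by_contra! hdim
  have h0 : hausdorffContent s (π '' {ω | IsBranch kids ω}) = 0 := by
    have := hausdorffMeasure_of_dimH_lt (d := s.toNNReal) hdim
    rw [Real.coe_toNNReal s hs.le] at this
    exact le_antisymm ((hausdorffContent_le_hausdorffMeasure s _).trans this.le) zero_le
  -- The factor 3 comes from thickening each set of the cover by its own size. With ε = 1/(4D) the
  -- masses add up to at most D(ε + ε) = 1/2, although the root has mass 1.
  set D : ℝ := C * 3 ^ s with hDdef
  have hD : 0 < D := by positivity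
  set ε : ℝ≥0∞ := ENNReal.ofReal (1 / (4 * D)) with hε
  have hε0 : ε ≠ 0 := by rw [hε, ne_eq, ENNReal.ofReal_eq_zero, not_le]; positivity
  have h1 : hausdorffContent s (π '' {ω | IsBranch kids ω}) < ε := by
    rw [h0]; exact pos_iff_ne_zero.2 hε0
  simp only [hausdorffContent, iInf_lt_iff] at h1
  obtain ⟨t, ht, hsum⟩ := h1
  -- The summable slack `η` gives a positive radius even to sets of diameter zero.
  obtain ⟨η, hη0, hηsum⟩ := ENNReal.exists_pos_sum_of_countable hε0 ℕ
  set τ : ℕ → ℝ≥0∞ := fun n => ⨆ _ : (t n).Nonempty, Metric.ediam (t n) ^ s with hτ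
  have hτtop : ∀ n, τ n ≠ ⊤ := fun n =>
    ne_top_of_le_ne_top (hsum.trans_le le_top).ne (ENNReal.le_tsum n)
  set r : ℕ → ℝ := fun n => ((τ n).toReal + η n) ^ (1 / s) with hr
  have hbase : ∀ n, 0 < (τ n).toReal + η n := fun n =>
    add_pos_of_nonneg_of_pos ENNReal.toReal_nonneg (by exact_mod_cast hη0 n)
  have hr0 : ∀ n, 0 < r n := fun n => Real.rpow_pos_of_pos (hbase n) _
  have hrs : ∀ n, r n ^ s = (τ n).toReal + η n := fun n => by
    rw [hr]; dsimp only
    rw [← Real.rpow_mul (hbase n).le, one_div_mul_cancel hs.ne', Real.rpow_one]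
  have hdiam : ∀ n, ∀ x ∈ t n, ∀ y ∈ t n, dist x y ≤ r n := by
    intro n x hx y hy
    have h2 : edist x y ^ s ≤ τ n := by
      rw [hτ]; dsimp only
      rw [ciSup_pos ⟨x, hx⟩]
      gcongr
      exact Metric.edist_le_ediam_of_mem hx hy
    have h3 : dist x y ^ s ≤ r n ^ s := by
      rw [hrs]
      have := ENNReal.toReal_mono (hτtop n) h2
      rw [← ENNReal.toReal_rpow, ← dist_edist] at this
      linarith [(η n).coe_nonneg]
    exact (Real.rpow_le_rpow_iff dist_nonneg (hr0 n).le hs).1 h3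
  -- Open thickenings, so that a limit point in `U i` brings with it all branches sharing a long
  -- enough initial word; the fan theorem then plays the role of compactness.
  set U : ℕ → Set Z := fun n => ⋃ x ∈ t n, Metric.ball x (r n) with hU
  have hUo : ∀ n, IsOpen (U n) := fun n => isOpen_biUnion fun _ _ => Metric.isOpen_ball
  have hUd : ∀ n, ∀ x ∈ U n, ∀ y ∈ U n, dist x y ≤ 3 * r n := by
    intro n x hx y hy
    simp only [hU, mem_iUnion, Metric.mem_ball] at hx hy
    obtain ⟨x', hx', hxx⟩ := hx
    obtain ⟨y', hy', hyy⟩ := hy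
    have h2 := dist_triangle4_right x y x' y'
    have h3 := dist_triangle4 x x' y' y
    rw [dist_comm y' y] at h3
    linarith [hdiam n x' hx' y' hy']
  set B : ℕ → ℝ≥0∞ := fun n => ENNReal.ofReal (C * (3 * r n) ^ s) with hB
  have hB0 : ∀ n, 0 < B n := fun n => by
    rw [hB]; exact ENNReal.ofReal_pos.2 (by have := hr0 n; positivity)
  -- The mass condition covers the case where no splitting is met above the word.
  set Q : ℕ → List α → Prop := fun i l =>
    (∀ ω, IsBranch kids ω → word ω l.length = l → π ω ∈ U i) ∧ wordMass p l ≤ B i with hQ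
  obtain ⟨k, hk⟩ := exists_allBelow (kids := kids) (P := fun l => ∃ i, Q i l) (by
      rintro l a hl ha ⟨i, hi1, hi2⟩
      exact ⟨i, fun ω hω hw => hi1 ω hω (List.cons.inj hw).2,
        (wordMass_cons_le hp hl ha).trans hi2⟩) (by
      intro ω hω
      obtain ⟨i, hi⟩ := mem_iUnion.1 (ht ⟨ω, hω, rfl⟩)
      have hmem : π ω ∈ U i := by
        simp only [hU, mem_iUnion]
        exact ⟨_, hi, Metric.mem_ball_self (hr0 i)⟩
      obtain ⟨e, he, hball⟩ := Metric.isOpen_iff.1 (hUo i) _ hmem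
      obtain ⟨n₁, hn₁⟩ := hcont ω hω e he
      obtain ⟨n₂, hn₂⟩ := ((hmass ω hω).eventually (gt_mem_nhds (hB0 i))).exists_forall_of_atTop
      refine ⟨n₁ + n₂, i, fun ω' hω' hw => hball ?_, (hn₂ _ (Nat.le_add_left _ _)).le⟩
      rw [length_word] at hw
      exact hn₁ ω' hω' (word_eq_of_word_add_eq n₂ hw))
  have h2 := wordMass_le_tsum_descMass hp (l := []) trivial hk
  have h3 : ∀ i, descMass kids p (Q i) k [] ≤ B i := fun i =>
    descMass_le_of_split hp (π := π) (U := U i) (fun l hl => hl.1) (fun l hl => hl.2)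
      (hsplit (U i) (3 * r i) (by linarith [hr0 i]) (hUd i)) trivial
  have h4 : (1 : ℝ≥0∞) ≤ ∑' i, B i := h2.trans (ENNReal.tsum_le_tsum h3)
  have h5 : ∀ i, B i = ENNReal.ofReal D * (τ i + η i) := by
    intro i
    rw [hB]; dsimp only
    rw [Real.mul_rpow (by norm_num) (hr0 i).le, hrs, ← mul_assoc, ← hDdef,
      ENNReal.ofReal_mul hD.le, ENNReal.ofReal_add ENNReal.toReal_nonneg (η i).coe_nonneg,
      ENNReal.ofReal_toReal (hτtop i), ENNReal.ofReal_coe_nnreal]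
  simp_rw [h5] at h4
  rw [ENNReal.tsum_mul_left, ENNReal.tsum_add] at h4
  have h6 : ENNReal.ofReal D * (∑' i, τ i + ∑' i, (η i : ℝ≥0∞)) ≤ ENNReal.ofReal D * (ε + ε) := by
    gcongr
  have h7 : ENNReal.ofReal D * (ε + ε) < 1 := by
    rw [hε, ← ENNReal.ofReal_add (by positivity) (by positivity), ← ENNReal.ofReal_mul hD.le,
      ← ENNReal.ofReal_one]
    refine (ENNReal.ofReal_lt_ofReal_iff one_pos).2 ?_
    have : D * (1 / (4 * D) + 1 / (4 * D)) = 1 / 2 := by field_simp; norm_num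
    rw [this]; norm_num
  exact absurd (h4.trans h6) (not_le.2 h7)

end Dimension

/-! ### Hausdorff content -/

section Content

variable {Z Z' : Type*} [MetricSpace Z] [MetricSpace Z']

/-- Identifies the content with an outer measure, which supplies countable subadditivity. -/
theorem hausdorffContent_eq_ofFunction (s : ℝ) (S : Set Z) :
    hausdorffContent s S = MeasureTheory.OuterMeasure.ofFunction
      (fun A : Set Z => ⨆ _ : A.Nonempty, Metric.ediam A ^ s) (by simp) S := by
  rw [MeasureTheory.OuterMeasure.ofFunction_apply]; rfl

theorem hausdorffContent_iUnion_le {ι : Type*} [Countable ι] (s : ℝ) (S : ι → Set Z) :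
    hausdorffContent s (⋃ i, S i) ≤ ∑' i, hausdorffContent s (S i) := by
  simp only [hausdorffContent_eq_ofFunction]
  exact MeasureTheory.measure_iUnion_le S

theorem iSup_ediam_rpow_le {s : ℝ} (hs : 0 ≤ s) {ρ : ℝ} {S : Set Z}
    (h : ∀ x ∈ S, ∀ y ∈ S, dist x y ≤ ρ) :
    (⨆ _ : S.Nonempty, Metric.ediam S ^ s) ≤ ENNReal.ofReal (ρ ^ s) := by
  refine iSup_le fun hne => ?_
  obtain ⟨x, hx⟩ := hne
  have hρ : 0 ≤ ρ := dist_nonneg.trans (h x hx x hx)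
  rw [← ENNReal.ofReal_rpow_of_nonneg hρ hs]
  gcongr
  refine Metric.ediam_le fun x hx y hy => ?_
  rw [edist_dist]
  exact ENNReal.ofReal_le_ofReal (h x hx y hy)

theorem hausdorffContent_le_of_dist_le {s : ℝ} (hs : 0 ≤ s) {ρ : ℝ} {S : Set Z}
    (h : ∀ x ∈ S, ∀ y ∈ S, dist x y ≤ ρ) : hausdorffContent s S ≤ ENNReal.ofReal (ρ ^ s) := by
  rw [hausdorffContent_eq_ofFunction]
  exact (MeasureTheory.OuterMeasure.ofFunction_le S).trans (iSup_ediam_rpow_le hs h)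

theorem hausdorffContent_image_le {s : ℝ} (hs : 0 < s) {f : Z → Z'} {S : Set Z} {c : ℝ}
    (hc : 0 < c) (hf : ∀ x ∈ S, ∀ y ∈ S, dist (f x) (f y) ≤ c * dist x y) :
    hausdorffContent s (f '' S) ≤ ENNReal.ofReal (c ^ s) * hausdorffContent s S := by
  have hc' : ENNReal.ofReal (c ^ s) ≠ 0 := by
    rw [ne_eq, ENNReal.ofReal_eq_zero, not_le]; positivity
  unfold hausdorffContent
  rw [ENNReal.mul_iInf_of_ne hc' ENNReal.ofReal_ne_top]
  refine le_iInf fun t => ?_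
  rw [ENNReal.mul_iInf_of_ne hc' ENNReal.ofReal_ne_top]
  refine le_iInf fun ht => ?_
  refine iInf₂_le_of_le (fun n => f '' (t n ∩ S)) ?_ ?_
  · rintro _ ⟨x, hx, rfl⟩
    obtain ⟨n, hn⟩ := mem_iUnion.1 (ht hx)
    exact mem_iUnion.2 ⟨n, x, ⟨hn, hx⟩, rfl⟩
  · rw [← ENNReal.tsum_mul_left]
    refine ENNReal.tsum_le_tsum fun n => iSup_le fun hne => ?_
    have hne' : (t n).Nonempty := by
      obtain ⟨_, x, hx, -⟩ := hne
      exact ⟨x, hx.1⟩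
    rw [ciSup_pos hne', ← ENNReal.ofReal_rpow_of_pos hc, ← ENNReal.mul_rpow_of_nonneg _ _ hs.le]
    gcongr
    refine Metric.ediam_le ?_
    rintro _ ⟨x, hx, rfl⟩ _ ⟨y, hy, rfl⟩
    rw [edist_dist]
    refine (ENNReal.ofReal_le_ofReal (hf x hx.2 y hy.2)).trans ?_
    rw [ENNReal.ofReal_mul hc.le, ← edist_dist]
    gcongr
    exact Metric.edist_le_ediam_of_mem hx.1 hy.1

theorem hausdorffContent_le_mul_of_dist_le {s t : ℝ} (hs : 0 ≤ s) (hst : s ≤ t) {ρ : ℝ}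
    (hρ : 0 < ρ) {S : Set Z} (h : ∀ x ∈ S, ∀ y ∈ S, dist x y ≤ ρ) :
    hausdorffContent t S ≤ ENNReal.ofReal (ρ ^ (t - s)) * hausdorffContent s S := by
  have hc' : ENNReal.ofReal (ρ ^ (t - s)) ≠ 0 := by
    rw [ne_eq, ENNReal.ofReal_eq_zero, not_le]; positivity
  unfold hausdorffContent
  rw [ENNReal.mul_iInf_of_ne hc' ENNReal.ofReal_ne_top]
  refine le_iInf fun u => ?_
  rw [ENNReal.mul_iInf_of_ne hc' ENNReal.ofReal_ne_top]
  refine le_iInf fun hu => ?_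
  refine iInf₂_le_of_le (fun n => u n ∩ S) ?_ ?_
  · intro x hx
    obtain ⟨n, hn⟩ := mem_iUnion.1 (hu hx)
    exact mem_iUnion.2 ⟨n, hn, hx⟩
  · rw [← ENNReal.tsum_mul_left]
    refine ENNReal.tsum_le_tsum fun n => iSup_le fun hne => ?_
    rw [ciSup_pos (hne.mono inter_subset_left)]
    have h1 : t = (t - s) + s := by ring
    rw [h1, ENNReal.rpow_add_of_nonneg _ _ (by linarith) hs, ← h1]
    refine mul_le_mul' ?_ (ENNReal.rpow_le_rpow (Metric.ediam_mono inter_subset_left) hs)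
    rw [← ENNReal.ofReal_rpow_of_pos hρ]
    refine ENNReal.rpow_le_rpow (Metric.ediam_le fun x hx y hy => ?_) (by linarith)
    rw [edist_dist]
    exact ENNReal.ofReal_le_ofReal (h x hx.2 y hy.2)

/-- For positive `s`, a cover with a small sum has small members, so the mesh condition in the
Hausdorff measure comes for free. -/
theorem dimH_le_of_hausdorffContent_eq_zero {s : ℝ} (hs : 0 < s) {S : Set Z}
    (h : hausdorffContent s S = 0) : dimH S ≤ ENNReal.ofReal s := by
  borelize Z
  have h0 : MeasureTheory.Measure.hausdorffMeasure s S = 0 := by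
    rw [MeasureTheory.Measure.hausdorffMeasure_apply]
    refine le_antisymm (iSup₂_le fun r hr => ?_) zero_le
    refine le_of_forall_gt fun ε hε => ?_
    have hr' : 0 < min ε (r ^ s) := lt_min hε (ENNReal.rpow_pos_of_nonneg hr hs.le)
    rw [← h] at hr'
    simp only [hausdorffContent, iInf_lt_iff] at hr'
    obtain ⟨t, ht, hsum⟩ := hr'
    refine lt_of_le_of_lt (iInf₂_le_of_le t ht (iInf_le_of_le (fun n => ?_) le_rfl))
      (hsum.trans_le (min_le_left _ _))
    rcases (t n).eq_empty_or_nonempty with h0 | hne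
    · simp [h0]
    · have h1 := (ENNReal.le_tsum (f := fun n => ⨆ _ : (t n).Nonempty, Metric.ediam (t n) ^ s)
        n).trans (hsum.le.trans (min_le_right _ _))
      rw [ciSup_pos hne] at h1
      exact (ENNReal.rpow_le_rpow_iff hs).1 h1
  have := dimH_le_of_hausdorffMeasure_ne_top (d := s.toNNReal) (s := S)
    (by rw [Real.coe_toNNReal s hs.le, h0]; simp)
  exact this

theorem elogb_ofReal {b : ℝ} {x : ℝ} (hx : 0 < x) :
    elogb b (ENNReal.ofReal x) = ((Real.logb b x : ℝ) : EReal) := by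
  rw [elogb, ENNReal.log_ofReal_of_pos hx, ← EReal.coe_div]; rfl

end Content

/-! ### Strong discreteness and the Poincaré series -/

section Group

variable {X : Type*} [MetricSpace X]

theorem StronglyDiscrete.finite_dist_le {o : X} {G : Subgroup (X ≃ᵢ X)}
    (h : StronglyDiscrete o G) (r : ℝ) : {g : G | dist o (g.1 o) ≤ r}.Finite := by
  have h1 := (h (max r 1) (by positivity)).preimage
    (f := fun g : G => g.1) Subtype.val_injective.injOn
  refine h1.subset fun g (hg : dist o (g.1 o) ≤ r) => ?_
  refine ⟨g.2, ?_⟩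
  rw [Metric.mem_closedBall, dist_comm]
  exact hg.trans (le_max_left _ _)

theorem StronglyDiscrete.countable {o : X} {G : Subgroup (X ≃ᵢ X)}
    (h : StronglyDiscrete o G) : Countable G := by
  rw [← Set.countable_univ_iff]
  have : (univ : Set G) = ⋃ n : ℕ, {g : G | dist o (g.1 o) ≤ n} := by
    refine (eq_univ_of_forall fun g => mem_iUnion.2 ?_).symm
    obtain ⟨n, hn⟩ := exists_nat_ge (dist o (g.1 o))
    exact ⟨n, hn⟩
  rw [this]
  exact countable_iUnion fun n => (h.finite_dist_le n).countable

theorem poincareSeries_lt_top [GromovHyperbolic X] {b : ℝ} (hb : 1 < b) {o : X}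
    {G : Subgroup (X ≃ᵢ X)} {δ : ℝ≥0} (hδ : poincareExponent b o G = δ) {q : ℝ} (hq : δ < q) :
    poincareSeries b o G q < ⊤ := by
  have h1 : poincareExponent b o G < ENNReal.ofReal q := by
    rw [hδ, ← ENNReal.ofReal_coe_nnreal]
    exact (ENNReal.ofReal_lt_ofReal_iff (δ.coe_nonneg.trans_lt hq)).2 hq
  simp only [poincareExponent, iInf_lt_iff] at h1
  obtain ⟨s, hs, hsq⟩ := h1
  refine lt_of_le_of_lt (ENNReal.tsum_le_tsum fun g => ENNReal.ofReal_le_ofReal ?_) hs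
  have hsq' : (s : ℝ) < q := by
    rw [← ENNReal.ofReal_coe_nnreal] at hsq
    exact (ENNReal.ofReal_lt_ofReal_iff (δ.coe_nonneg.trans_lt hq)).1 hsq
  refine Real.rpow_le_rpow_of_exponent_le hb.le ?_
  have : 0 ≤ dist o (g.1 o) := dist_nonneg
  nlinarith

theorem poincareSeries_eq_top [GromovHyperbolic X] {b : ℝ} {o : X}
    {G : Subgroup (X ≃ᵢ X)} {δ : ℝ≥0} (hδ : poincareExponent b o G = δ) {s : ℝ} (hs : 0 ≤ s)
    (hsδ : s < δ) : poincareSeries b o G s = ⊤ := by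
  by_contra h
  have h1 : poincareExponent b o G ≤ (s.toNNReal : ℝ≥0∞) :=
    iInf₂_le s.toNNReal (by rw [Real.coe_toNNReal s hs]; exact lt_top_iff_ne_top.2 h)
  rw [hδ, ENNReal.coe_le_coe] at h1
  have h2 : (δ : ℝ) ≤ s.toNNReal := by exact_mod_cast h1
  rw [Real.coe_toNNReal s hs] at h2
  linarith

/-- The products of a fixed point with a Gromov sequence are almost constant eventually. -/
theorem GromovSeq.exists_gromovProd_approx {K : ℝ} (hK : IsHypConst X K) (o z : X)
    (x : GromovSeq X) : ∃ t, 0 ≤ t ∧ t ≤ dist o z ∧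
      ∀ᶠ m in atTop, |gromovProd o z (x.1 m) - t| ≤ K := by
  obtain ⟨⟨a, a'⟩, ha⟩ := eventually_atTop.1 (tendsto_atTop.1 (x.2 o) (dist o z))
  refine ⟨gromovProd o z (x.1 a'), gromovProd_nonneg _ _ _, gromovProd_le_left _ _ _, ?_⟩
  filter_upwards [eventually_ge_atTop a] with m hm
  have h1 : dist o z ≤ gromovProd o (x.1 m) (x.1 a') := ha (m, a') ⟨hm, le_rfl⟩
  have h2 := hK.le_trans le_rfl ((gromovProd_le_left o z (x.1 m)).trans h1)
  have h3 := hK.le_trans (le_refl (gromovProd o z (x.1 a'))) (z := x.1 m)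
    ((gromovProd_le_left o z (x.1 a')).trans (h1.trans_eq (gromovProd_comm _ _ _)))
  rw [abs_le]
  constructor <;> linarith

end Group

/-! ### The upper bound for the dimension of well approximable points -/

section Upper

variable {X : Type*} [MetricSpace X] [GromovHyperbolic X]

theorem boundaryMap_mul_apply (g h : X ≃ᵢ X) (η : GromovBoundary X) :
    boundaryMap (g * h) η = boundaryMap g (boundaryMap h η) := by
  rw [← η.toBoundary_rep]; rfl

theorem boundaryMap_one_apply (η : GromovBoundary X) :
    boundaryMap (1 : X ≃ᵢ X) η = η := by
  rw [← η.toBoundary_rep]; rfl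

theorem boundaryMap_apply_inv (g : X ≃ᵢ X) (η : GromovBoundary X) :
    boundaryMap g (boundaryMap g⁻¹ η) = η := by
  rw [← boundaryMap_mul_apply, mul_inv_cancel, boundaryMap_one_apply]

theorem sigmaRadialLimitSet_mono (o : X) (G : Subgroup (X ≃ᵢ X)) {σ τ : ℝ} (h : σ ≤ τ) :
    sigmaRadialLimitSet o G σ ⊆ sigmaRadialLimitSet o G τ := by
  rintro η ⟨g, hg, hσ⟩
  exact ⟨g, hg, fun n => (hσ n).trans (by exact_mod_cast h)⟩

variable [MetricSpace (GromovBoundary X)]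

/-- The content of the part of a small ball about `g(ξ)` in the radial limit set, compared with
the content near `ξ`. -/
theorem exists_hausdorffContent_ball_le {b : ℝ} (hb : 1 < b) {o : X} (hD : IsVisualMetric b o) :
    ∃ M : ℝ, 0 ≤ M ∧ ∀ (G : Subgroup (X ≃ᵢ X)) (ξ : GromovBoundary X) (g : X ≃ᵢ X), g ∈ G →
      ∃ θ ≤ dist o (g o), ∀ c s σ : ℝ, 0 ≤ c → 0 < s →
        hausdorffContent s ({η | dist (boundaryMap g ξ) η ≤ b ^ (-((1 + c) * dist o (g o)))} ∩
          sigmaRadialLimitSet o G σ) ≤ ENNReal.ofReal (b ^ (s * (M - θ))) *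
          radialContent o G ξ (σ + M) s (b ^ (M - (1 + c) * dist o (g o) + θ)) := by
  obtain ⟨K, hK⟩ := exists_isHypConst X
  obtain ⟨V, hV0, hV1, hV2⟩ := hD.exists_isVisConst hb
  have hb0 : 0 < b := by linarith
  have hK0 := hK.1
  refine ⟨4 * V + 4 * K + 1, by linarith, fun G ξ g hg => ?_⟩
  obtain ⟨t, ht0, htn, ht⟩ := ξ.rep.exists_gromovProd_approx hK o (g⁻¹ o)
  set n := dist o (g o) with hn
  have hnz : dist o (g⁻¹ o) = n := dist_inv_apply g o
  have hn0 : 0 ≤ n := dist_nonneg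
  -- Here `t` is ⟨g⁻¹(o)|ξ⟩_o up to `K`. Base change from `o` to `g⁻¹ o` shifts products of points
  -- near ξ by n - 2t, so g scales distances there by about b^(-(n - 2t)).
  refine ⟨n - 2 * t, by linarith, fun c s σ hc hs => ?_⟩
  set S : Set (GromovBoundary X) := {y | dist (boundaryMap g ξ) (boundaryMap g y) ≤
    b ^ (-((1 + c) * n)) ∧ boundaryMap g y ∈ sigmaRadialLimitSet o G σ} with hS
  have himg : {η | dist (boundaryMap g ξ) η ≤ b ^ (-((1 + c) * n))} ∩ sigmaRadialLimitSet o G σ ⊆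
      boundaryMap g '' S := by
    rintro η ⟨h1, h2⟩
    refine ⟨boundaryMap g⁻¹ η, ?_, boundaryMap_apply_inv g η⟩
    simp only [hS, mem_ofPred_eq, boundaryMap_apply_inv]
    exact ⟨h1, h2⟩
  -- Points of `S` have nearly the same product with `g⁻¹ o` as ξ: since ⟨ξ|y⟩ based at `g⁻¹ o` is
  -- at least (1 + c)n - V, base change makes ⟨ξ|y⟩_o exceed both products, up to `V`.
  have hprod : ∀ y : GromovBoundary X, y ∈ S → ∀ᶠ m in atTop,
      |gromovProd o (g⁻¹ o) (y.rep.1 m) - t| ≤ V + 2 * K ∧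
      (1 + c) * n - V ≤ gromovProd (g⁻¹ o) (ξ.rep.1 m) (y.rep.1 m) ∧
      |gromovProd o (g⁻¹ o) (ξ.rep.1 m) - t| ≤ K := by
    intro y hy
    have h1 := hV2 (ξ.rep.map g) (y.rep.map g) ((1 + c) * n) (by
      rw [← boundaryMap_toBoundary, ← boundaryMap_toBoundary]
      simpa using hy.1)
    filter_upwards [h1, ht] with m h1 h2
    have h1' : (1 + c) * n - V ≤ gromovProd (g⁻¹ o) (ξ.rep.1 m) (y.rep.1 m) := by
      rw [← gromovProd_map_left]; exact h1
    refine ⟨?_, h1', h2⟩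
    have h3 := gromovProd_base_change o (g⁻¹ o) (ξ.rep.1 m) (y.rep.1 m)
    rw [hnz] at h3
    have hx0 := gromovProd_nonneg o (g⁻¹ o) (ξ.rep.1 m)
    have hy0 := gromovProd_nonneg o (g⁻¹ o) (y.rep.1 m)
    have hcn : 0 ≤ c * n := mul_nonneg hc hn0
    have h4 := hK.le_trans (R := gromovProd o (g⁻¹ o) (ξ.rep.1 m) - V) (w := o)
      (x := g⁻¹ o) (y := ξ.rep.1 m) (z := y.rep.1 m) (by linarith) (by linarith)
    have h5 := hK.le_trans (R := gromovProd o (g⁻¹ o) (y.rep.1 m) - V) (w := o)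
      (x := g⁻¹ o) (y := y.rep.1 m) (z := ξ.rep.1 m) (by linarith)
      (by rw [gromovProd_comm o (y.rep.1 m)]; linarith)
    rw [abs_le] at h2 ⊢
    constructor <;> linarith
  refine (hausdorffContent_mono s himg).trans ?_
  have hlip : ∀ y ∈ S, ∀ y' ∈ S, dist (boundaryMap g y) (boundaryMap g y') ≤
      b ^ (4 * V + 4 * K + 1 - (n - 2 * t)) * dist y y' := by
    intro y hy y' hy'
    rcases eq_or_ne y y' with rfl | hne
    · simp
    have hd : 0 < dist y y' := dist_pos.2 hne
    have hbd : b ^ Real.logb b (dist y y') = dist y y' := Real.rpow_logb hb0 hb.ne' hd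
    have h1 := hV2 y.rep y'.rep (-Real.logb b (dist y y')) (by simp [hbd])
    have h2 : ∀ᶠ m in atTop, -Real.logb b (dist y y') - 3 * V - 4 * K + n - 2 * t ≤
        gromovProd o ((y.rep.map g).1 m) ((y'.rep.map g).1 m) := by
      filter_upwards [h1, hprod y hy, hprod y' hy'] with m h1 h3 h4
      have h5 := gromovProd_base_change o (g⁻¹ o) (y.rep.1 m) (y'.rep.1 m)
      rw [hnz, ← gromovProd_map_left] at h5
      have h3' := (abs_le.1 h3.1).2
      have h4' := (abs_le.1 h4.1).2
      change _ ≤ gromovProd o (g (y.rep.1 m)) (g (y'.rep.1 m))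
      linarith
    have h3 := hV1 _ _ _ h2.frequently
    rw [← boundaryMap_toBoundary, ← boundaryMap_toBoundary, GromovBoundary.toBoundary_rep,
      GromovBoundary.toBoundary_rep] at h3
    refine h3.trans ?_
    rw [← hbd, ← Real.rpow_add hb0, hbd]
    exact Real.rpow_le_rpow_of_exponent_le hb.le (by linarith)
  refine (hausdorffContent_image_le hs (by positivity) hlip).trans ?_
  rw [← Real.rpow_mul hb0.le, mul_comm _ s]
  gcongr
  refine hausdorffContent_mono s fun y hy => ⟨?_, ?_⟩
  · rw [Metric.mem_closedBall, dist_comm]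
    have h2 : ∀ᶠ m in atTop, (1 + c) * n - (n - 2 * t) - 2 * V - 3 * K ≤
        gromovProd o (ξ.rep.1 m) (y.rep.1 m) := by
      filter_upwards [hprod y hy] with m h3
      have h5 := gromovProd_base_change o (g⁻¹ o) (ξ.rep.1 m) (y.rep.1 m)
      rw [hnz] at h5
      have h3' := (abs_le.1 h3.1).1
      have h4' := (abs_le.1 h3.2.2).1
      linarith [h3.2.1]
    have h3 := hV1 _ _ _ h2.frequently
    rw [GromovBoundary.toBoundary_rep, GromovBoundary.toBoundary_rep] at h3
    exact h3.trans (Real.rpow_le_rpow_of_exponent_le hb.le (by linarith))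
  · have h1 := hy.2
    rw [← y.toBoundary_rep, boundaryMap_toBoundary] at h1
    have h2 := (isRadialSeq_of_mem_sigmaRadialLimitSet hK _ h1).map hK (G.inv_mem hg)
    have h3 : (fun m => g⁻¹ ((y.rep.map g).1 m)) = y.rep.1 := by
      funext m; exact g.symm_apply_apply _
    rw [h3] at h2
    rw [← y.toBoundary_rep]
    exact mem_sigmaRadialLimitSet_of_isRadialSeq _ (h2.mono (by linarith))

theorem exists_dist_le_of_lt_approxExponent {b : ℝ} (hb : 1 < b) {o : X} {G : Subgroup (X ≃ᵢ X)}
    {ξ η : GromovBoundary X} {a : ℝ} (h : (a : EReal) < approxExponent b o G ξ η) (T : ℝ) :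
    ∃ g : G, T ≤ dist o (g.1 o) ∧ dist (boundaryMap g.1 ξ) η ≤ b ^ (-(a * dist o (g.1 o))) := by
  have h1 := frequently_lt_of_lt_limsup (by isBoundedDefault) h
  obtain ⟨g, hg, hT⟩ := (h1.and_eventually
    (tendsto_comap.eventually (eventually_ge_atTop (max T 1)))).exists
  refine ⟨g, (le_max_left _ _).trans hT, ?_⟩
  have hn : 0 < dist o (g.1 o) := lt_of_lt_of_le one_pos ((le_max_right _ _).trans hT)
  rcases eq_or_lt_of_le (dist_nonneg (x := boundaryMap g.1 ξ) (y := η)) with h0 | h0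
  · rw [← h0]; positivity
  · rw [edist_dist, elogb_ofReal h0, ← EReal.coe_neg, ← EReal.coe_div, EReal.coe_lt_coe_iff,
      lt_div_iff₀ hn] at hg
    rw [← Real.logb_le_iff_le_rpow hb h0]
    linarith

/-- A Hausdorff–Cantelli argument. For each fixed σ the well approximable points are covered by the
pieces near g(ξ) with g outside any prescribed finite set, and the s-contents of these pieces are
dominated by the Poincaré series at s + c'p > δ. -/
theorem dimH_wellApproxSet_le {b : ℝ} (hb : 1 < b) {o : X} (hD : IsVisualMetric b o)
    {G : Subgroup (X ≃ᵢ X)} (hGd : StronglyDiscrete o G) {ξ : GromovBoundary X} {δ : ℝ≥0}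
    (hδ : poincareExponent b o G = δ) {s p c : ℝ} (hs : 0 < s) (hsp : s ≤ p) (hc : 0 < c)
    (hq : δ < s + c * p)
    (hcontent : ∀ σ : ℝ, ∃ C > 0, ∃ r₀ > 0, ∀ r, 0 < r → r < r₀ →
      radialContent o G ξ σ s r ≤ ENNReal.ofReal (C * r ^ p)) :
    dimH (wellApproxSet b o G ξ c) ≤ ENNReal.ofReal s := by
  have hb0 : 0 < b := by linarith
  have := hGd.countable
  obtain ⟨M, hM0, hM⟩ := exists_hausdorffContent_ball_le hb hD
  have hp : 0 < p := hs.trans_le hsp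
  -- A slightly smaller `c'` turns ω ≥ 1 + c into a strict inequality, which yields actual
  -- approximations.
  obtain ⟨c', hc'0, hc'c, hc'⟩ : ∃ c', 0 < c' ∧ c' < c ∧ δ < s + c' * p := by
    obtain ⟨c', h1, h2⟩ := exists_between (max_lt hc (show (δ - s) / p < c by
      rw [div_lt_iff₀ hp]; linarith))
    rw [max_lt_iff, div_lt_iff₀ hp] at h1
    exact ⟨c', h1.1, h2, by linarith⟩
  have hcover : wellApproxSet b o G ξ c ⊆
      ⋃ k : ℕ, wellApproxSet b o G ξ c ∩ sigmaRadialLimitSet o G k := by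
    intro η hη
    obtain ⟨σ, hσ⟩ := mem_iUnion.1 hη.1
    obtain ⟨_, hσ⟩ := mem_iUnion.1 hσ
    obtain ⟨k, hk⟩ := exists_nat_ge σ
    exact mem_iUnion.2 ⟨k, hη, sigmaRadialLimitSet_mono o G hk hσ⟩
  refine (dimH_mono hcover).trans ?_
  rw [dimH_iUnion]
  refine iSup_le fun k => dimH_le_of_hausdorffContent_eq_zero hs ?_
  obtain ⟨C, hC0, r₀, hr₀, hC⟩ := hcontent (k + M)
  set q := s + c' * p with hqdef
  set A : G → Set (GromovBoundary X) := fun g =>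
    {η | dist (boundaryMap g.1 ξ) η ≤ b ^ (-((1 + c') * dist o (g.1 o)))} ∩
      sigmaRadialLimitSet o G k with hA
  set D := C * b ^ ((s + p) * M) with hDdef
  have hD0 : 0 < D := by positivity
  -- Beyond this length the pulled-back radius, at most b^(M - c'n), is below `r₀`.
  set T₀ : ℝ := (M - Real.logb b r₀ + 1) / c' with hT₀
  have hAle : ∀ g : G, T₀ ≤ dist o (g.1 o) →
      hausdorffContent s (A g) ≤ ENNReal.ofReal D *
        ENNReal.ofReal (b ^ (-q * dist o (g.1 o))) := by
    intro g hg
    obtain ⟨θ, hθ, hM'⟩ := hM G ξ g.1 g.2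
    set n := dist o (g.1 o) with hn
    refine (hM' c' s k hc'0.le hs).trans ?_
    have hr : b ^ (M - (1 + c') * n + θ) < r₀ := by
      rw [← Real.lt_logb_iff_rpow_lt hb hr₀]
      rw [hT₀, div_le_iff₀ hc'0] at hg
      linarith
    refine (mul_le_mul_right (hC _ (by positivity) hr) _).trans ?_
    rw [← ENNReal.ofReal_mul (by positivity), ← ENNReal.ofReal_mul (by positivity)]
    refine ENNReal.ofReal_le_ofReal ?_
    rw [← Real.rpow_mul hb0.le, hDdef, mul_left_comm, ← Real.rpow_add hb0, mul_assoc C,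
      ← Real.rpow_add hb0]
    refine mul_le_mul_of_nonneg_left (Real.rpow_le_rpow_of_exponent_le hb.le ?_) hC0.le
    rw [hqdef]
    -- θ enters with the coefficient p - s ≥ 0, so θ = n is the worst case.
    linarith [mul_le_mul_of_nonneg_left hθ (sub_nonneg.2 hsp)]
  refine le_antisymm ?_ zero_le
  have hfin : ∑' g : G, ENNReal.ofReal (b ^ (-q * dist o (g.1 o))) ≠ ⊤ :=
    (poincareSeries_lt_top hb hδ hc').ne
  have htail := ENNReal.Tendsto.const_mul (a := ENNReal.ofReal D)
    (ENNReal.tendsto_tsum_compl_atTop_zero hfin) (Or.inr ENNReal.ofReal_ne_top)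
  rw [mul_zero] at htail
  refine ge_of_tendsto htail ?_
  filter_upwards [eventually_ge_atTop (hGd.finite_dist_le T₀).toFinset] with F hF
  rw [← ENNReal.tsum_mul_left]
  have hsub : wellApproxSet b o G ξ c ∩ sigmaRadialLimitSet o G k ⊆
      ⋃ g : {g : G // g ∉ F}, A g.1 := by
    rintro η ⟨hη, hηk⟩
    obtain ⟨T, hT⟩ := (F.finite_toSet.image fun g : G => dist o (g.1 o)).bddAbove
    obtain ⟨g, hgT, hg⟩ := exists_dist_le_of_lt_approxExponent hb (a := 1 + c')
      (lt_of_lt_of_le (by exact_mod_cast (by linarith)) hη.2) (T + 1)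
    refine mem_iUnion.2 ⟨⟨g, fun hgF => ?_⟩, hg, hηk⟩
    have := hT ⟨g, hgF, rfl⟩
    simp only at this
    linarith
  refine (hausdorffContent_mono s hsub).trans ((hausdorffContent_iUnion_le s _).trans ?_)
  refine ENNReal.tsum_le_tsum fun g => hAle g.1 ?_
  by_contra! h
  exact g.2 (hF (by simpa using h.le))

end Upper

/-! ### Connecting elements -/

section Connectors

variable {X : Type*} [MetricSpace X]

/-- Transfers transversality from two boundary points to orbit points lying far out in their
directions. -/
theorem IsHypConst.gromovProd_le_of_eventually {K : ℝ} (hK : IsHypConst X K) {o u v : X}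
    {x y : ℕ → X} {c R : ℝ} (hxy : ∀ᶠ m in atTop, gromovProd o (x m) (y m) ≤ c)
    (hu : ∀ᶠ m in atTop, R ≤ gromovProd o u (x m)) (hv : ∀ᶠ m in atTop, R ≤ gromovProd o v (y m))
    (hR : c + 2 * K < R) : gromovProd o u v ≤ c + 2 * K := by
  obtain ⟨m, h1, h2, h3⟩ := (hxy.and (hu.and hv)).exists
  have h4 := hK.le_of_lt (y := v) h1 (by linarith [hK.1])
  rw [gromovProd_comm] at h4
  have h5 := hK.le_of_lt (y := u) h4 (by linarith)
  rw [gromovProd_comm] at h5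
  linarith

/-- Among three elements with pairwise transversal endpoints, one connects without much
backtracking. -/
theorem IsHypConst.exists_connector {K : ℝ} (hK : IsHypConst X K) {o : X} {c : ℝ}
    {a : Fin 3 → (X ≃ᵢ X)} (h1 : ∀ i j, i ≠ j → gromovProd o (a i o) (a j o) ≤ c)
    (h2 : ∀ i j, i ≠ j → gromovProd o ((a i)⁻¹ o) ((a j)⁻¹ o) ≤ c)
    (h3 : ∀ i, 2 * c + 3 * K < dist o (a i o)) (x y : X) :
    ∃ i, gromovProd o x (a i y) ≤ c + 2 * K := by
  have key : ∃ i, gromovProd o x (a i o) ≤ c + K ∧ gromovProd o y ((a i)⁻¹ o) ≤ c + K := by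
    by_contra! hcon
    have hx : ∀ i j, i ≠ j → c + K < gromovProd o x (a i o) → gromovProd o x (a j o) ≤ c + K := by
      intro i j hij hi
      have := hK.le_of_lt (h1 j i hij.symm) hi
      rwa [gromovProd_comm]
    have hy : ∀ i j, i ≠ j → c + K < gromovProd o y ((a i)⁻¹ o) →
        gromovProd o y ((a j)⁻¹ o) ≤ c + K := by
      intro i j hij hi
      have := hK.le_of_lt (h2 j i hij.symm) hi
      rwa [gromovProd_comm]
    have hor : ∀ i, c + K < gromovProd o x (a i o) ∨ c + K < gromovProd o y ((a i)⁻¹ o) := by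
      intro i
      by_cases h : gromovProd o x (a i o) ≤ c + K
      · exact Or.inr (hcon i h)
      · exact Or.inl (not_le.1 h)
    have n01 : (0 : Fin 3) ≠ 1 := by decide
    have n02 : (0 : Fin 3) ≠ 2 := by decide
    have n12 : (1 : Fin 3) ≠ 2 := by decide
    rcases hor 0 with h | h <;> rcases hor 1 with h' | h' <;> rcases hor 2 with h'' | h''
    · linarith [hx 0 1 n01 h]
    · linarith [hx 0 1 n01 h]
    · linarith [hx 0 2 n02 h]
    · linarith [hy 1 2 n12 h']
    · linarith [hx 1 2 n12 h']
    · linarith [hy 0 2 n02 h]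
    · linarith [hy 0 1 n01 h]
    · linarith [hy 0 1 n01 h]
  obtain ⟨i, hi1, hi2⟩ := key
  refine ⟨i, ?_⟩
  -- This product is large, so `a i y` leaves `o` in the direction of `a i o`, which `x` does not.
  have h4 : gromovProd o (a i y) (a i o) = dist o (a i o) - gromovProd o y ((a i)⁻¹ o) := by
    have := gromovProd_add_swap o y ((a i)⁻¹ o)
    rw [dist_inv_apply] at this
    rw [gromovProd_map_left, gromovProd_comm _ y o]
    linarith
  have := hK.le_of_lt hi1 (y := a i y) (by rw [h4]; linarith [h3 i])
  linarith

variable [GromovHyperbolic X]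

theorem boundaryMap_pow_apply_eq {g : X ≃ᵢ X} {p : GromovBoundary X} (h : boundaryMap g p = p)
    (n : ℕ) : boundaryMap (g ^ n) p = p := by
  induction n with
  | zero => rw [pow_zero, boundaryMap_one_apply]
  | succ n ih => rw [pow_succ, boundaryMap_mul_apply, h, ih]

variable [MetricSpace (GromovBoundary X)]

/-- The bound depends only on the two boundary points, so it also applies to the images of
representatives under maps fixing both points. -/
theorem IsVisConst.exists_gromovProd_le {b : ℝ} (hb : 1 < b) {o : X} {V : ℝ}
    (hV : IsVisConst b o V) {ξ η : GromovBoundary X} (h : ξ ≠ η) :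
    ∃ c, 0 ≤ c ∧ ∀ x y : GromovSeq X, x.toBoundary = ξ → y.toBoundary = η →
      ∀ᶠ m in atTop, gromovProd o (x.1 m) (y.1 m) ≤ c := by
  have hd := dist_pos.2 h
  refine ⟨max (V - Real.logb b (dist ξ η) + 1) 0, le_max_right _ _, fun x y hx hy => ?_⟩
  by_contra hcon
  rw [not_eventually] at hcon
  have h1 := hV.2.1 x y (V - Real.logb b (dist ξ η) + 1)
    (hcon.mono fun m hm => ((le_max_left _ _).trans (not_le.1 hm).le))
  rw [hx, hy] at h1
  have h2 : b ^ (V - (V - Real.logb b (dist ξ η) + 1)) < b ^ Real.logb b (dist ξ η) :=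
    Real.rpow_lt_rpow_of_exponent_lt hb (by linarith)
  rw [Real.rpow_logb (by linarith) hb.ne' hd] at h2
  linarith

/-- If `g ^ n` pushes a third boundary point to the fixed point `p`, then the backward orbit of
the base point converges to the other fixed point `q`. -/
theorem IsVisConst.eventually_le_gromovProd_inv_pow {b : ℝ} (hb : 1 < b) {o : X} {V : ℝ}
    (hV : IsVisConst b o V) {g : X ≃ᵢ X} {p q e : GromovBoundary X} (hpq : p ≠ q)
    (hp : boundaryMap g p = p) (hq : boundaryMap g q = q) (hep : e ≠ p)
    (he : Tendsto (fun n : ℕ => boundaryMap (g ^ n) e) atTop (𝓝 p)) (R : ℝ) :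
    ∀ᶠ n : ℕ in atTop, ∀ᶠ m in atTop, R ≤ gromovProd o ((g⁻¹ ^ n) o) (q.rep.1 m) := by
  obtain ⟨c₀, hc₀, h₀⟩ := hV.exists_gromovProd_le hb hpq
  obtain ⟨c₁, hc₁, h₁⟩ := hV.exists_gromovProd_le hb hep
  -- With z = g^(-n)(o), subtracting the base change formulas for (e,p) and (p,q) gives ⟨z|q⟩_o ≥
  -- ⟨e|p⟩_z - ⟨e|p⟩_o - ⟨p|q⟩_z. The last two terms cost `c₁` and `c₀`, and passing from the metric
  -- to products costs `V`.
  have hr : 0 < b ^ (-(R + c₀ + c₁ + V)) := by positivity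
  filter_upwards [he.eventually (Metric.closedBall_mem_nhds p hr)] with n hn
  have h2 := hV.2.2 (e.rep.map (g ^ n)) (p.rep.map (g ^ n)) (R + c₀ + c₁ + V) (by
    rw [← boundaryMap_toBoundary, ← boundaryMap_toBoundary, GromovBoundary.toBoundary_rep,
      GromovBoundary.toBoundary_rep, boundaryMap_pow_apply_eq hp]
    exact hn)
  have h3 := h₀ (p.rep.map (g ^ n)) (q.rep.map (g ^ n))
    (by rw [← boundaryMap_toBoundary, GromovBoundary.toBoundary_rep, boundaryMap_pow_apply_eq hp])
    (by rw [← boundaryMap_toBoundary, GromovBoundary.toBoundary_rep, boundaryMap_pow_apply_eq hq])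
  filter_upwards [h2, h3, h₁ e.rep p.rep e.toBoundary_rep p.toBoundary_rep] with m h2 h3 h4
  change _ ≤ gromovProd o ((g ^ n) (e.rep.1 m)) ((g ^ n) (p.rep.1 m)) at h2
  change gromovProd o ((g ^ n) (p.rep.1 m)) ((g ^ n) (q.rep.1 m)) ≤ _ at h3
  rw [gromovProd_map_left, ← inv_pow] at h2 h3
  have h5 := gromovProd_base_change o ((g⁻¹ ^ n) o) (e.rep.1 m) (p.rep.1 m)
  have h6 := gromovProd_base_change o ((g⁻¹ ^ n) o) (p.rep.1 m) (q.rep.1 m)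
  have h7 := gromovProd_nonneg o (p.rep.1 m) (q.rep.1 m)
  have h8 := gromovProd_nonneg o ((g⁻¹ ^ n) o) (e.rep.1 m)
  linarith

/-- Contraction is used only at the third point `e`, by taking the neighbourhood `{e}ᶜ` of a fixed
point. It is applied to g for the backward orbit and to g⁻¹ for the forward orbit. -/
theorem IsVisConst.eventually_le_gromovProd_pow {b : ℝ} (hb : 1 < b) {o : X} {V : ℝ}
    (hV : IsVisConst b o V) {g : X ≃ᵢ X} {p q : GromovBoundary X}
    (h : p ≠ q ∧ boundaryMap g p = p ∧ boundaryMap g q = q ∧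
    (∀ U ∈ 𝓝 q, TendstoUniformlyOn (fun n : ℕ => boundaryMap (g ^ n)) (fun _ => p) atTop Uᶜ) ∧
    (∀ U ∈ 𝓝 p, TendstoUniformlyOn (fun n : ℕ => boundaryMap (g⁻¹ ^ n)) (fun _ => q) atTop Uᶜ))
    {e : GromovBoundary X} (he : boundaryMap g e ≠ e) (R : ℝ) :
    (∀ᶠ n : ℕ in atTop, ∀ᶠ m in atTop, R ≤ gromovProd o ((g ^ n) o) (p.rep.1 m)) ∧
    (∀ᶠ n : ℕ in atTop, ∀ᶠ m in atTop, R ≤ gromovProd o ((g⁻¹ ^ n) o) (q.rep.1 m)) := by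
  obtain ⟨hpq, hp, hq, h1, h2⟩ := h
  have hep : e ≠ p := fun h => he (h ▸ hp)
  have heq : e ≠ q := fun h => he (h ▸ hq)
  have hinv : ∀ r, boundaryMap g r = r → boundaryMap g⁻¹ r = r := fun r hr => by
    conv_lhs => rw [← hr]
    rw [← boundaryMap_mul_apply, inv_mul_cancel, boundaryMap_one_apply]
  constructor
  · have := hV.eventually_le_gromovProd_inv_pow hb (g := g⁻¹) (e := e) hpq.symm (hinv q hq)
      (hinv p hp) heq ((h2 {e}ᶜ (isOpen_compl_singleton.mem_nhds hep.symm)).tendsto_at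
        (by simp)) R
    simpa only [inv_inv] using this
  · exact hV.eventually_le_gromovProd_inv_pow hb hpq hp hq hep
      ((h1 {e}ᶜ (isOpen_compl_singleton.mem_nhds heq.symm)).tendsto_at (by simp)) R

/-- The connectors are g^n, g^(-n) and f^n for a large n: their attracting points p, q, p' are
pairwise distinct, and so are their repelling points q, p, q'. A fixed point of either loxodromic
serves as the third point for the other. -/
theorem exists_connectors {b : ℝ} (hb : 1 < b) {o : X} (hD : IsVisualMetric b o)
    {G : Subgroup (X ≃ᵢ X)} (hGt : IsGeneralType G) :
    ∃ a : Fin 3 → G, ∃ C, 0 ≤ C ∧ ∀ x y : X, ∃ i, gromovProd o x ((a i).1 y) ≤ C := by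
  obtain ⟨K, hK⟩ := exists_isHypConst X
  obtain ⟨V, hV⟩ := hD.exists_isVisConst hb
  obtain ⟨g, hgG, f, hfG, hg, hf, hdisj⟩ := hGt
  obtain ⟨p, q, hg⟩ := hg
  obtain ⟨p', q', hf⟩ := hf
  have hnot : ∀ r, boundaryMap g r = r → boundaryMap f r = r → False := fun r h1 h2 =>
    Set.disjoint_left.1 hdisj h1 h2
  have G1 := hV.eventually_le_gromovProd_pow hb hg (e := p') fun h => hnot _ h hf.2.1
  have F1 := hV.eventually_le_gromovProd_pow hb hf (e := p) fun h => hnot _ hg.2.1 h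
  have hbd : ∀ ξ η : GromovBoundary X, ∃ c, 0 ≤ c ∧ (ξ ≠ η →
      ∀ᶠ m in atTop, gromovProd o (ξ.rep.1 m) (η.rep.1 m) ≤ c) := by
    intro ξ η
    by_cases h : ξ = η
    · exact ⟨0, le_rfl, fun h' => absurd h h'⟩
    · obtain ⟨c, hc, h⟩ := hV.exists_gromovProd_le hb h
      exact ⟨c, hc, fun _ => h _ _ ξ.toBoundary_rep η.toBoundary_rep⟩
  choose c hc0 hc using hbd
  set P : Fin 3 → GromovBoundary X := ![p, q, p'] with hP
  set Q : Fin 3 → GromovBoundary X := ![q, p, q'] with hQ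
  have hPne : ∀ i j, i ≠ j → P i ≠ P j := by
    have h1 : p ≠ p' := fun h => hnot p hg.2.1 (h ▸ hf.2.1)
    have h2 : q ≠ p' := fun h => hnot q hg.2.2.1 (h ▸ hf.2.1)
    intro i j hij
    fin_cases i <;> fin_cases j <;> simp_all [hg.1, hg.1.symm, h1.symm, h2.symm]
  have hQne : ∀ i j, i ≠ j → Q i ≠ Q j := by
    have h1 : p ≠ q' := fun h => hnot p hg.2.1 (h ▸ hf.2.2.1)
    have h2 : q ≠ q' := fun h => hnot q hg.2.2.1 (h ▸ hf.2.2.1)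
    intro i j hij
    fin_cases i <;> fin_cases j <;> simp_all [hg.1, hg.1.symm, h1.symm, h2.symm]
  set c₂ := (∑ i, ∑ j, c (P i) (P j)) + ∑ i, ∑ j, c (Q i) (Q j) with hc₂
  have hle : ∀ (S : Fin 3 → GromovBoundary X) (i j : Fin 3),
      c (S i) (S j) ≤ ∑ i, ∑ j, c (S i) (S j) := fun S i j =>
    (Finset.single_le_sum (f := fun j => c (S i) (S j)) (fun _ _ => hc0 _ _)
      (Finset.mem_univ j)).trans
    (Finset.single_le_sum (f := fun i => ∑ j, c (S i) (S j))
      (fun _ _ => Finset.sum_nonneg fun _ _ => hc0 _ _) (Finset.mem_univ i))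
  have hnn : ∀ S : Fin 3 → GromovBoundary X, 0 ≤ ∑ i, ∑ j, c (S i) (S j) := fun S =>
    Finset.sum_nonneg fun _ _ => Finset.sum_nonneg fun _ _ => hc0 _ _
  have hcP : ∀ i j, c (P i) (P j) ≤ c₂ := fun i j => by linarith [hle P i j, hnn Q]
  have hcQ : ∀ i j, c (Q i) (Q j) ≤ c₂ := fun i j => by linarith [hle Q i j, hnn P]
  have hc₂0 : 0 ≤ c₂ := add_nonneg (hnn P) (hnn Q)
  have hK0 := hK.1
  -- Large enough both to transfer transversality to the orbit points and for the length condition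
  -- of `exists_connector`.
  set R := 2 * (c₂ + 2 * K) + 3 * K + 1 with hR
  obtain ⟨n, ⟨hn1, hn2⟩, hn3, hn4⟩ := (((G1 R).1.and (G1 R).2).and
    ((F1 R).1.and (F1 R).2)).exists
  set a : Fin 3 → G := ![⟨g ^ n, G.pow_mem hgG n⟩, ⟨g⁻¹ ^ n, G.pow_mem (G.inv_mem hgG) n⟩,
    ⟨f ^ n, G.pow_mem hfG n⟩] with ha
  have haP : ∀ i, ∀ᶠ m in atTop, R ≤ gromovProd o ((a i).1 o) ((P i).rep.1 m) := by
    intro i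
    fin_cases i
    · exact hn1
    · exact hn2
    · exact hn3
  have haQ : ∀ i, ∀ᶠ m in atTop, R ≤ gromovProd o ((a i).1⁻¹ o) ((Q i).rep.1 m) := by
    intro i
    fin_cases i
    · change ∀ᶠ m in atTop, R ≤ gromovProd o ((g ^ n)⁻¹ o) (q.rep.1 m)
      simpa only [inv_pow] using hn2
    · change ∀ᶠ m in atTop, R ≤ gromovProd o ((g⁻¹ ^ n)⁻¹ o) (p.rep.1 m)
      simpa only [inv_pow, inv_inv] using hn1
    · change ∀ᶠ m in atTop, R ≤ gromovProd o ((f ^ n)⁻¹ o) (q'.rep.1 m)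
      simpa only [inv_pow] using hn4
  refine ⟨a, c₂ + 2 * K + 2 * K, by linarith, fun x y => ?_⟩
  refine hK.exists_connector (a := fun i => (a i).1) (c := c₂ + 2 * K) (fun i j hij => ?_)
    (fun i j hij => ?_) (fun i => ?_) x y
  · refine hK.gromovProd_le_of_eventually (R := R)
      ((hc _ _ (hPne i j hij)).mono fun m hm => hm.trans (hcP i j)) (haP i) (haP j) (by linarith)
  · refine hK.gromovProd_le_of_eventually (R := R)
      ((hc _ _ (hQne i j hij)).mono fun m hm => hm.trans (hcQ i j)) (haQ i) (haQ j) (by linarith)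
  · obtain ⟨m, hm⟩ := (haP i).exists
    have := gromovProd_le_left o ((a i).1 o) ((P i).rep.1 m)
    linarith

end Connectors

/-! ### Separated families of group elements -/

section Families

variable {X : Type*} [MetricSpace X]

/-- The orbit points of the members of `Z` have pairwise transversal shadows. -/
def IsSeparated {G : Subgroup (X ≃ᵢ X)} (o : X) (C : ℝ) (Z : Set G) : Prop :=
  ∀ f ∈ Z, ∀ g ∈ Z, f ≠ g → gromovProd o (f.1 o) (g.1 o) ≤ dist o (f.1 o) - C

theorem tsum_ne_top_of_eventually_le {u : ℕ → ℝ≥0∞} {v : ℕ → ℝ} (hu : ∀ n, u n ≠ ⊤)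
    (hv : Summable v) {n₀ : ℕ} (h : ∀ n, n₀ ≤ n → u n ≤ ENNReal.ofReal (v n)) :
    ∑' n, u n ≠ ⊤ := by
  rw [← (ENNReal.summable (f := fun n => u (n + n₀))).sum_add_tsum_nat_add']
  refine ENNReal.add_ne_top.2 ⟨ENNReal.sum_ne_top.2 fun n _ => hu n, ?_⟩
  have h5 := (summable_nat_add_iff n₀).2 hv
  exact ne_top_of_le_ne_top h5.tsum_ofReal_ne_top
    (ENNReal.tsum_le_tsum fun n => h (n + n₀) (Nat.le_add_left _ _))

/-- The Poincaré series, summed over annuli of width one. -/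
theorem poincareSeries_le_tsum [GromovHyperbolic X] {b : ℝ} (hb : 1 < b) {o : X}
    {G : Subgroup (X ≃ᵢ X)} {t : ℝ} (ht : 0 ≤ t) (F : ℕ → Finset G)
    (hmem : ∀ g : G, g ∈ F ⌊dist o (g.1 o)⌋₊) :
    poincareSeries b o G t ≤ ∑' n : ℕ, (F n).card * ENNReal.ofReal (b ^ (-t * n)) := by
  classical
  have h2 : poincareSeries b o G t ≤ ∑' g : G, ∑' n : ℕ,
      if g ∈ F n then ENNReal.ofReal (b ^ (-t * n)) else 0 := by
    refine ENNReal.tsum_le_tsum fun g => ?_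
    refine le_trans ?_ (ENNReal.le_tsum ⌊dist o (g.1 o)⌋₊)
    rw [if_pos (hmem g)]
    refine ENNReal.ofReal_le_ofReal (Real.rpow_le_rpow_of_exponent_le hb.le ?_)
    have := Nat.floor_le (dist_nonneg (x := o) (y := g.1 o))
    nlinarith
  refine h2.trans ?_
  rw [ENNReal.tsum_comm]
  refine ENNReal.tsum_le_tsum fun n => ?_
  rw [tsum_eq_sum (s := F n) (fun g hg => if_neg hg)]
  rw [Finset.sum_congr rfl (fun g hg => if_pos hg), Finset.sum_const, nsmul_eq_mul]

/-- If all annuli of integral width one contain few elements, the Poincaré series converges. -/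
theorem poincareSeries_ne_top_of_card_le [GromovHyperbolic X] {b : ℝ} (hb : 1 < b) {o : X}
    {G : Subgroup (X ≃ᵢ X)} (hGd : StronglyDiscrete o G) {s t Q : ℝ} (ht : 0 ≤ t) (hst : s < t)
    {n₀ : ℕ}
    (h : ∀ n : ℕ, n₀ ≤ n → ∀ F : Finset G, (∀ g ∈ F, ⌊dist o (g.1 o)⌋₊ = n) →
      (F.card : ℝ) ≤ Q * b ^ (s * n)) : poincareSeries b o G t ≠ ⊤ := by
  classical
  have hb0 : 0 < b := by linarith
  obtain ⟨F, hF, hF'⟩ : ∃ F : ℕ → Finset G, (∀ n, ∀ g ∈ F n, ⌊dist o (g.1 o)⌋₊ = n) ∧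
      ∀ g : G, g ∈ F ⌊dist o (g.1 o)⌋₊ := by
    refine ⟨fun n => (hGd.finite_dist_le (n + 1)).toFinset.filter
      fun g => ⌊dist o (g.1 o)⌋₊ = n, fun n g hg => (Finset.mem_filter.1 hg).2, fun g => ?_⟩
    simp only [Finset.mem_filter, and_true, Set.Finite.mem_toFinset]
    exact (Nat.lt_floor_add_one (dist o (g.1 o))).le
  refine ne_top_of_le_ne_top ?_ (poincareSeries_le_tsum hb ht F hF')
  have h3 : ∀ n, n₀ ≤ n → (F n).card * ENNReal.ofReal (b ^ (-t * n)) ≤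
      ENNReal.ofReal (Q * (b ^ (s - t)) ^ n) := by
    intro n hn
    have h4 := h n hn (F n) (hF n)
    rw [← ENNReal.ofReal_natCast, ← ENNReal.ofReal_mul (by positivity)]
    refine ENNReal.ofReal_le_ofReal ?_
    rw [← Real.rpow_natCast (b ^ (s - t)), ← Real.rpow_mul hb0.le]
    calc ((F n).card : ℝ) * b ^ (-t * n) ≤ Q * b ^ (s * n) * b ^ (-t * n) := by gcongr
      _ = Q * b ^ ((s - t) * n) := by
        rw [mul_assoc, ← Real.rpow_add hb0]; ring_nf
  have hsum : Summable fun n : ℕ => Q * (b ^ (s - t)) ^ n :=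
    (summable_geometric_of_lt_one (by positivity)
      (Real.rpow_lt_one_of_one_lt_of_neg hb (by linarith))).mul_left Q
  exact tsum_ne_top_of_eventually_le
    (fun n => ENNReal.mul_ne_top (ENNReal.natCast_ne_top _) ENNReal.ofReal_ne_top) hsum h3

/-- A finite set of group elements contains a proportional subset with distant orbit points. -/
theorem exists_subset_dist_le {o : X} {G : Subgroup (X ≃ᵢ X)} (hGd : StronglyDiscrete o G)
    {r : ℝ} (hr : 0 ≤ r) (F : Finset G) : ∃ S ⊆ F, F.card ≤ S.card * (hGd.finite_dist_le r).toFinset.card ∧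
      ∀ f ∈ S, ∀ g ∈ S, f ≠ g → r < dist (f.1 o) (g.1 o) := by
  classical
  obtain ⟨S, hS, hmax⟩ := (F.powerset.filter fun S =>
    ∀ f ∈ S, ∀ g ∈ S, f ≠ g → r < dist (f.1 o) (g.1 o)).exists_maximal ⟨∅, by simp⟩
  rw [Finset.mem_filter, Finset.mem_powerset] at hS
  refine ⟨S, hS.1, ?_, hS.2⟩
  -- By maximality every member of `F` is a member of `S` times an element of length at most `r`,
  -- and there are finitely many of the latter.
  have hcov : F ⊆ (S.product (hGd.finite_dist_le r).toFinset).image fun q => q.1 * q.2 := by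
    intro g hg
    have hex : ∃ f ∈ S, dist (f.1 o) (g.1 o) ≤ r ∨ f = g := by
      by_contra! hcon
      have hgS : g ∉ S := fun h => (hcon g h).2 rfl
      have hins : insert g S ∈ F.powerset.filter fun S =>
          ∀ f ∈ S, ∀ g ∈ S, f ≠ g → r < dist (f.1 o) (g.1 o) := by
        rw [Finset.mem_filter, Finset.mem_powerset]
        refine ⟨Finset.insert_subset hg hS.1, fun f hf f' hf' hne => ?_⟩
        rcases Finset.mem_insert.1 hf with h1 | h1 <;>
          rcases Finset.mem_insert.1 hf' with h2 | h2
        · exact absurd (h1.trans h2.symm) hne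
        · rw [dist_comm, h1]; exact (hcon f' h2).1
        · rw [h2]; exact (hcon f h1).1
        · exact hS.2 f h1 f' h2 hne
      exact hgS (hmax hins (Finset.subset_insert g S) (Finset.mem_insert_self g S))
    obtain ⟨f, hf, hfg⟩ := hex
    refine Finset.mem_image.2 ⟨(f, f⁻¹ * g), Finset.mem_product.2 ⟨hf, ?_⟩, by simp⟩
    rw [Set.Finite.mem_toFinset]
    change dist o (f.1⁻¹ (g.1 o)) ≤ r
    rw [← f.1.dist_eq, inv_apply_eq_symm, f.1.apply_symm_apply]
    rcases hfg with h | rfl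
    · exact h
    · simpa using hr
  calc F.card ≤ _ := Finset.card_le_card hcov
    _ ≤ _ := Finset.card_image_le
    _ = _ := Finset.card_product _ _

/-- Arbitrarily long separated annular families of nearly maximal cardinality. -/
theorem exists_separated_annulus [GromovHyperbolic X] {b : ℝ} (hb : 1 < b) {o : X}
    {G : Subgroup (X ≃ᵢ X)} (hGd : StronglyDiscrete o G) {δ : ℝ≥0}
    (hδ : poincareExponent b o G = δ) {s : ℝ} (hs : 0 ≤ s) (hsδ : s < δ) (C Q : ℝ) :
    ∃ N : ℕ, Q ≤ N ∧ ∃ S : Finset G, Q * b ^ (s * N) ≤ S.card ∧ IsSeparated o C (S : Set G) ∧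
      ∀ g ∈ S, N ≤ dist o (g.1 o) ∧ dist o (g.1 o) ≤ N + 1 := by
  have hb0 : 0 < b := by linarith
  obtain ⟨t, hst, htδ⟩ := exists_between hsδ
  -- In an annulus of width one, distance more than 2C + 2 makes the Gromov product at most the
  -- length minus C.
  set r := 2 * max C 0 + 2 with hr
  set m := (hGd.finite_dist_le r).toFinset.card with hm
  by_contra! hcon
  obtain ⟨n₀, hn₀⟩ := exists_nat_ge Q
  -- If separated families had at most Q b^(sn) members in all large annuli, the annuli themselves
  -- would have at most a constant multiple of that, and the series would converge at some t in (s,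
  -- δ).
  refine poincareSeries_ne_top_of_card_le hb hGd (hs.trans hst.le) hst
    (Q := max Q 0 * m) (n₀ := n₀) (fun n hn F hF => ?_)
    (poincareSeries_eq_top hδ (hs.trans hst.le) htδ)
  have hann : ∀ g ∈ F, (n : ℝ) ≤ dist o (g.1 o) ∧ dist o (g.1 o) ≤ n + 1 := fun g hg => by
    rw [← hF g hg]
    exact ⟨Nat.floor_le dist_nonneg, (Nat.lt_floor_add_one (dist o (g.1 o))).le⟩
  obtain ⟨S, hSF, hcard, hsep⟩ := exists_subset_dist_le hGd (r := r) (by positivity) F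
  have h1 : (S.card : ℝ) ≤ Q * b ^ (s * n) := by
    by_contra! h2
    obtain ⟨g, hg, h⟩ := hcon n (hn₀.trans (by exact_mod_cast hn)) S h2.le (by
      intro f hf g hg hne
      have h3 := hsep f hf g hg hne
      have h4 := hann g (hSF hg)
      have h5 := hann f (hSF hf)
      unfold gromovProd
      rw [dist_comm (f.1 o) o, dist_comm (g.1 o) o]
      linarith [le_max_left C 0])
    exact absurd (hann g (hSF hg)).2 (not_le.2 (h (hann g (hSF hg)).1))
  have h2 : (F.card : ℝ) ≤ S.card * m := by exact_mod_cast hcard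
  refine h2.trans ?_
  calc (S.card : ℝ) * m ≤ (max Q 0 * b ^ (s * n)) * m := by
        gcongr
        exact h1.trans (by gcongr; exact le_max_left _ _)
    _ = _ := by ring

end Families

/-! ### Discrete Frostman families from Hausdorff content -/

section Frostman

/-- A maximal family of points whose total weight in every ball is at most twice the size of the
ball: every point lies in a ball that is saturated by the family. -/
theorem exists_saturated_subset {ι β : Type*} {w : ι → ℝ} {B : β → Set ι}
    {c : β → ℝ} (hc : ∀ x, 0 ≤ c x) (h1 : ∀ k x, k ∈ B x → w k ≤ c x) (h2 : ∀ k, ∃ x, k ∈ B x ∧ c x ≤ w k)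
    (S₀ : Set ι) :
    ∃ S ⊆ S₀, (∀ x, ∀ F : Finset ι, (F : Set ι) ⊆ S ∩ B x → ∑ k ∈ F, w k ≤ 2 * c x) ∧
      ∀ k ∈ S₀, ∃ x, k ∈ B x ∧ ∃ F : Finset ι, (F : Set ι) ⊆ S ∩ B x ∧ c x ≤ ∑ k ∈ F, w k := by
  classical
  set P : Set (Set ι) := {S | S ⊆ S₀ ∧ ∀ x, ∀ F : Finset ι, (F : Set ι) ⊆ S ∩ B x →
    ∑ k ∈ F, w k ≤ 2 * c x} with hP
  obtain ⟨S, hS⟩ := zorn_subset P (by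
    intro C hC hchain
    refine ⟨⋃₀ C, ⟨sUnion_subset fun S hS => (hC hS).1, fun x F hF => ?_⟩,
      fun s hs => subset_sUnion_of_mem hs⟩
    rcases C.eq_empty_or_nonempty with rfl | hCne
    · have hF0 : F = ∅ := Finset.eq_empty_of_forall_notMem fun k hk => by simpa using (hF hk).1
      simpa [hF0] using hc x
    obtain ⟨S, hS, hFS⟩ := DirectedOn.exists_mem_subset_of_finite_of_subset_sUnion hCne
      hchain.directedOn F.finite_toSet (fun k hk => (hF hk).1)
    exact (hC hS).2 x F (fun k hk => ⟨hFS hk, (hF hk).2⟩))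
  have hSP := hS.1
  refine ⟨S, hSP.1, hSP.2, fun k hk => ?_⟩
  by_cases hkS : k ∈ S
  · obtain ⟨x, hx1, hx2⟩ := h2 k
    exact ⟨x, hx1, {k}, by simp [hkS, hx1], by simpa using hx2⟩
  -- If `k` cannot be added, it would push some ball above 2c. As `w k ≤ c`, that ball already
  -- contains weight at least c without `k`.
  · have hins : insert k S ∉ P := fun h => hkS (hS.2 h (subset_insert k S) (mem_insert k S))
    have : ∃ x, ∃ F : Finset ι, (F : Set ι) ⊆ insert k S ∩ B x ∧ 2 * c x < ∑ k ∈ F, w k := by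
      by_contra! hcon
      exact hins ⟨insert_subset hk hSP.1, fun x F hF => hcon x F hF⟩
    obtain ⟨x, F, hF, hlt⟩ := this
    have hkF : k ∈ F := by
      by_contra hkF
      refine absurd hlt (not_lt.2 (hSP.2 x F (fun j hj => ⟨?_, (hF hj).2⟩)))
      rcases (hF hj).1 with rfl | h
      · exact absurd hj hkF
      · exact h
    refine ⟨x, (hF hkF).2, F.erase k, fun j hj => ?_, ?_⟩
    · have hj' := Finset.mem_erase.1 (Finset.mem_coe.1 hj)
      refine ⟨?_, (hF hj'.2).2⟩
      rcases (hF hj'.2).1 with h | h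
      · exact absurd h hj'.1
      · exact h
    · rw [← Finset.add_sum_erase F w hkF] at hlt
      linarith [h1 k x (hF hkF).2]

variable {X : Type*} [MetricSpace X]

/-- The existence of a separated subfamily such that every member is shadowed by it. -/
theorem exists_separated_subset {K : ℝ} (hK : IsHypConst X K) {b : ℝ} (hb : 1 < b) {o : X}
    {G : Subgroup (X ≃ᵢ X)} {C : ℝ} (hC : 0 ≤ C) (Z : Set G) :
    ∃ S ⊆ Z, IsSeparated o C S ∧ ∀ k ∈ Z, ∃ f ∈ S, dist o (f.1 o) ≤ dist o (k.1 o) + 1 ∧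
      dist o (f.1 o) - C - 1 - K ≤ gromovProd o (k.1 o) (f.1 o) := by
  have hb0 : 0 < b := by linarith
  set B : G → Set X := fun k => {x | dist o (k.1 o) - C ≤ gromovProd o x (k.1 o)} with hB
  have hself : ∀ k : G, k.1 o ∈ B k := fun k => by
    change _ ≤ gromovProd o (k.1 o) (k.1 o)
    rw [gromovProd_self]; linarith
  -- Vitali's covering lemma for shadows of size b^(-|k|). The enlargement factor `b` costs one unit
  -- of length, and disjoint shadows give separation.
  obtain ⟨S, hS, hdisj, hcov⟩ := Vitali.exists_disjoint_subfamily_covering_enlargement B Z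
    (fun k => b ^ (-dist o (k.1 o))) b hb (fun _ _ => by positivity) 1
    (fun k _ => Real.rpow_le_one_of_one_le_of_nonpos hb.le (neg_nonpos.2 dist_nonneg))
    (fun k _ => ⟨_, hself k⟩)
  refine ⟨S, hS, fun f hf g hg hne => ?_, fun k hk => ?_⟩
  · by_contra! hcon
    refine Set.disjoint_iff.1 (hdisj hf hg hne) (⟨?_, hself g⟩ : g.1 o ∈ B f ∩ B g)
    change _ ≤ gromovProd o (g.1 o) (f.1 o)
    rw [gromovProd_comm]; exact hcon.le
  · obtain ⟨f, hf, ⟨x, hxk, hxf⟩, hsize⟩ := hcov k hk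
    have h1 : dist o (f.1 o) ≤ dist o (k.1 o) + 1 := by
      have h2 : b * b ^ (-dist o (f.1 o)) = b ^ (1 + -dist o (f.1 o)) := by
        rw [Real.rpow_add hb0, Real.rpow_one]
      rw [h2, Real.rpow_le_rpow_left_iff hb] at hsize
      linarith
    refine ⟨f, hf, h1, ?_⟩
    have hxk' : dist o (k.1 o) - C ≤ gromovProd o (k.1 o) x := by
      rw [gromovProd_comm]; exact hxk
    have hxf' : dist o (f.1 o) - C ≤ gromovProd o x (f.1 o) := hxf
    have := hK.le_trans (R := dist o (f.1 o) - C - 1) (hxk'.trans' (by linarith))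
      (hxf'.trans' (by linarith))
    linarith

variable [GromovHyperbolic X] [MetricSpace (GromovBoundary X)]

/-- The content of a set of boundary points is bounded by the weight of a saturated family. -/
theorem exists_hausdorffContent_le_of_saturated {b : ℝ} (hb : 1 < b) {o : X}
    (hD : IsVisualMetric b o) {G : Subgroup (X ≃ᵢ X)} (hGd : StronglyDiscrete o G) {s : ℝ}
    (hs : 0 < s) (τ : ℝ) :
    ∃ C > 0, ∀ (E : Set (GromovBoundary X)) (S₀ S : Set G) (a : ℝ),
      (∀ η ∈ E, ∃ k ∈ S₀, ∀ᶠ m in atTop,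
        dist o (k.1 o) - τ ≤ gromovProd o (k.1 o) (η.rep.1 m)) →
      (∀ k ∈ S₀, ∃ x : X × ℝ, x.2 ≤ gromovProd o (k.1 o) x.1 ∧ ∃ F : Finset G,
        (F : Set G) ⊆ S ∩ {k | x.2 ≤ gromovProd o (k.1 o) x.1} ∧
        b ^ (-s * x.2) ≤ ∑ k ∈ F, b ^ (-s * dist o (k.1 o))) →
      (∀ F : Finset G, (F : Set G) ⊆ S → ∑ k ∈ F, b ^ (-s * dist o (k.1 o)) ≤ a) →
      hausdorffContent s E ≤ ENNReal.ofReal (C * a) := by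
  classical
  obtain ⟨K, hK⟩ := exists_isHypConst X
  obtain ⟨V, hV0, hV1, hV2⟩ := hD.exists_isVisConst hb
  have hb0 : 0 < b := by linarith
  have hK0 := hK.1
  have := hGd.countable
  set C' := |τ| + 1 + 3 * K with hC'
  set M := b ^ (s * (V + C' + K)) with hM
  refine ⟨M, by positivity, fun E S₀ S a hE hsat ha => ?_⟩
  have ha0 : 0 ≤ a := by simpa using ha ∅ (by simp)
  have : Nonempty (X × ℝ) := ⟨(o, 0)⟩
  choose! x hx F hFS hF using hsat
  set B : G → Set X := fun k => {y | (x k).2 ≤ gromovProd o y (x k).1} with hB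
  have hsize : ∀ k ∈ S₀, b ^ (-(x k).2) ≤ a ^ (1 / s) := fun k hk => by
    have h1 := (hF k hk).trans (ha (F k) fun j hj => (hFS k hk hj).1)
    have h2 : b ^ (-(x k).2) = (b ^ (-s * (x k).2)) ^ (1 / s) := by
      rw [← Real.rpow_mul hb0.le]; congr 1; field_simp
    rw [h2]
    exact Real.rpow_le_rpow (by positivity) h1 (by positivity)
  -- Vitali is now applied to the saturated balls: enlargements of the selected balls cover `E`,
  -- while their disjointness lets the weights inside them add up to at most `a`. The sizes are
  -- bounded because a saturated ball cannot exceed the total weight.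
  obtain ⟨u, hu, hdisj, hcov⟩ := Vitali.exists_disjoint_subfamily_covering_enlargement B S₀
    (fun k => b ^ (-(x k).2)) b hb (fun _ _ => by positivity) (a ^ (1 / s)) hsize
    (fun k hk => ⟨k.1 o, hx k hk⟩)
  set U : G → Set (GromovBoundary X) := fun j =>
    {η | ∀ᶠ m in atTop, (x j).2 - C' ≤ gromovProd o (η.rep.1 m) (x j).1} with hU
  have hEU : E ⊆ ⋃ j : u, U j := by
    intro η hη
    obtain ⟨k, hk, hkη⟩ := hE η hη
    obtain ⟨j, hj, ⟨y, hyk, hyj⟩, hsz⟩ := hcov k hk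
    refine mem_iUnion.2 ⟨⟨j, hj⟩, ?_⟩
    have hjk : (x j).2 ≤ (x k).2 + 1 := by
      have h2 : b * b ^ (-(x j).2) = b ^ (1 + -(x j).2) := by
        rw [Real.rpow_add hb0, Real.rpow_one]
      rw [h2, Real.rpow_le_rpow_left_iff hb] at hsz
      linarith
    filter_upwards [hkη] with m hm
    have h1 : (x k).2 ≤ gromovProd o (k.1 o) (x k).1 := hx k hk
    have h2 : (x k).2 ≤ gromovProd o (x k).1 y := by rw [gromovProd_comm]; exact hyk
    have h3 : (x j).2 ≤ gromovProd o y (x j).1 := hyj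
    have h4 := gromovProd_le_left o (k.1 o) (x k).1
    have h5 : (x j).2 - 1 - |τ| ≤ gromovProd o (η.rep.1 m) (k.1 o) := by
      rw [gromovProd_comm]; linarith [le_abs_self τ]
    have habs := abs_nonneg τ
    have h6 := hK.le_trans h5 (h1.trans' (by linarith))
    have h7 := hK.le_trans h6 (h2.trans' (by linarith))
    have h8 := hK.le_trans h7 (h3.trans' (by linarith))
    linarith
  refine (hausdorffContent_mono s hEU).trans ((hausdorffContent_iUnion_le s _).trans ?_)
  have hUle : ∀ j : u, hausdorffContent s (U j) ≤ ENNReal.ofReal (M * b ^ (-s * (x j).2)) := by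
    intro j
    refine (hausdorffContent_le_of_dist_le hs.le (ρ := b ^ (V + C' + K - (x j).2)) ?_).trans_eq ?_
    · intro η hη η' hη'
      have h1 : ∀ᶠ m in atTop, (x j).2 - C' - K ≤ gromovProd o (η.rep.1 m) (η'.rep.1 m) := by
        filter_upwards [hη, hη'] with m h1 h2
        exact hK.le_trans h1 (by rw [gromovProd_comm]; exact h2)
      have h2 := hV1 _ _ _ h1.frequently
      rw [GromovBoundary.toBoundary_rep, GromovBoundary.toBoundary_rep] at h2
      exact h2.trans_eq (by ring_nf)
    · rw [← Real.rpow_mul hb0.le, hM, ← Real.rpow_add hb0]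
      ring_nf
  refine (ENNReal.tsum_le_tsum hUle).trans ?_
  refine ENNReal.summable.tsum_le_of_sum_le fun P => ?_
  rw [← ENNReal.ofReal_sum_of_nonneg fun _ _ => by positivity, ← Finset.mul_sum]
  refine ENNReal.ofReal_le_ofReal (mul_le_mul_of_nonneg_left ?_ (by positivity))
  refine (Finset.sum_le_sum fun j _ => hF j.1 (hu j.2)).trans ?_
  rw [← Finset.sum_biUnion]
  · refine ha _ fun k hk => ?_
    obtain ⟨j, -, hj⟩ := Finset.mem_biUnion.1 (Finset.mem_coe.1 hk)
    exact (hFS j.1 (hu j.2) hj).1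
  · intro i _ j _ hij
    refine Finset.disjoint_left.2 fun k hki hkj => ?_
    exact Set.disjoint_iff.1 (hdisj i.2 j.2 (fun h => hij (Subtype.ext h)))
      (⟨(hFS i.1 (hu i.2) hki).2, (hFS j.1 (hu j.2) hkj).2⟩ : k.1 o ∈ B i ∩ B j)

/-- A finite separated family of group elements with a Frostman weight, near a point `ξ` where
the radial limit set has large content. -/
theorem exists_frostman_family {b : ℝ} (hb : 1 < b) {o : X} (hD : IsVisualMetric b o)
    {G : Subgroup (X ≃ᵢ X)} (hGd : StronglyDiscrete o G) {s : ℝ} (hs : 0 < s) (σ C₁ : ℝ) :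
    ∃ C > 0, ∀ (ξ : GromovBoundary X) (R T h : ℝ), 0 < h →
      ENNReal.ofReal h ≤ radialContent o G ξ σ s (b ^ (-R)) →
      ∃ (Z : Finset G) (w : G → ℝ), (∀ k, 0 ≤ w k) ∧ ∑ k ∈ Z, w k = 1 ∧
        IsSeparated o C₁ (Z : Set G) ∧
        (∀ k ∈ Z, T ≤ dist o (k.1 o) ∧
          ∀ᶠ m in atTop, R - C ≤ gromovProd o (k.1 o) (ξ.rep.1 m)) ∧
        ∀ (x : X) (t : ℝ), ∑ k ∈ Z with t ≤ gromovProd o (k.1 o) x, w k ≤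
          C / h * b ^ (-s * t) := by
  obtain ⟨K, hK⟩ := exists_isHypConst X
  obtain ⟨V, hV0, hV1, hV2⟩ := hD.exists_isVisConst hb
  have hb0 : 0 < b := by linarith
  have hK0 := hK.1
  set σ' := |σ| + 1 + K with hσ'
  have hσ'0 : 0 ≤ σ' := by positivity
  set C₂ := max C₁ 0 with hC₂
  have hC₂0 : 0 ≤ C₂ := le_max_right _ _
  obtain ⟨M, hM0, hM⟩ := exists_hausdorffContent_le_of_saturated hb hD hGd hs (C₂ + σ' + 1 + 2 * K)
  refine ⟨max (4 * M) (V + σ' + K), lt_max_of_lt_left (by positivity), fun ξ R T h hh hcont => ?_⟩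
  set E := Metric.closedBall ξ (b ^ (-R)) ∩ sigmaRadialLimitSet o G σ with hE
  -- Elements at least as long as `R` whose shadows meet `E`: the length ensures that their orbit
  -- points share the direction of ξ up to depth about `R`.
  set Z₀ : Set G := {k | max T R ≤ dist o (k.1 o) ∧ ∃ η ∈ E, ∀ᶠ m in atTop,
    dist o (k.1 o) - σ' ≤ gromovProd o (k.1 o) (η.rep.1 m)} with hZ₀
  have hEZ : ∀ η ∈ E, ∃ k ∈ Z₀, ∀ᶠ m in atTop,
      dist o (k.1 o) - σ' ≤ gromovProd o (k.1 o) (η.rep.1 m) := by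
    intro η hη
    have h1 := hη.2
    rw [← η.toBoundary_rep] at h1
    obtain ⟨k, hkG, hkT, hk⟩ := isRadialSeq_of_mem_sigmaRadialLimitSet hK _ h1 (max T R)
    have h2 : ∀ᶠ m in atTop, dist o (k o) - σ' ≤ gromovProd o (k o) (η.rep.1 m) := by
      filter_upwards [hk] with m hm
      have h3 := gromovProd_add_swap o (η.rep.1 m) (k o)
      rw [gromovProd_comm o (k o)]
      linarith [le_abs_self σ]
    exact ⟨⟨k, hkG⟩, ⟨hkT, η, hη, h2⟩, h2⟩
  obtain ⟨S₀, hS₀Z, hsep, hS₀⟩ := exists_separated_subset hK hb (o := o) hC₂0 Z₀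
  obtain ⟨S, hSS₀, hS1, hS2⟩ := exists_saturated_subset
    (w := fun k : G => b ^ (-s * dist o (k.1 o)))
    (B := fun x : X × ℝ => {k : G | x.2 ≤ gromovProd o (k.1 o) x.1})
    (c := fun x => b ^ (-s * x.2)) (fun _ => by positivity)
    (fun k x hk => Real.rpow_le_rpow_of_exponent_le hb.le (by
      have h1 : x.2 ≤ gromovProd o (k.1 o) x.1 := hk
      have h2 := h1.trans (gromovProd_le_left _ _ _)
      nlinarith))
    (fun k => ⟨(k.1 o, dist o (k.1 o)), by
      change _ ≤ gromovProd o (k.1 o) (k.1 o)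
      rw [gromovProd_self], le_rfl⟩) S₀
  have hES₀ : ∀ η ∈ E, ∃ k ∈ S₀, ∀ᶠ m in atTop,
      dist o (k.1 o) - (C₂ + σ' + 1 + 2 * K) ≤ gromovProd o (k.1 o) (η.rep.1 m) := by
    intro η hη
    obtain ⟨k, hk, hkη⟩ := hEZ η hη
    obtain ⟨f, hf, hfk, hkf⟩ := hS₀ k hk
    refine ⟨f, hf, ?_⟩
    filter_upwards [hkη] with m hm
    have h1 := hK.le_trans (R := dist o (f.1 o) - C₂ - 1 - K - σ') (w := o) (x := f.1 o)
      (y := k.1 o) (z := η.rep.1 m) (by rw [gromovProd_comm o (f.1 o)]; linarith) (by linarith)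
    linarith
  -- Otherwise the saturated family would bound the content of `E` by h/2. The weight h/(2M),
  -- divided into the bound 2b^(-st), gives the Frostman constant 4M/h after normalization.
  have hex : ∃ F : Finset G, (F : Set G) ⊆ S ∧
      h / (2 * M) < ∑ k ∈ F, b ^ (-s * dist o (k.1 o)) := by
    by_contra! hcon
    have h1 := hcont.trans (hM E S₀ S (h / (2 * M)) hES₀ hS2 hcon)
    rw [ENNReal.ofReal_le_ofReal_iff (by positivity)] at h1
    have h2 : M * (h / (2 * M)) = h / 2 := by field_simp
    linarith
  obtain ⟨F, hFS, hF⟩ := hex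
  set W := ∑ k ∈ F, b ^ (-s * dist o (k.1 o)) with hW
  have hW0 : 0 < W := (by positivity : 0 < h / (2 * M)).trans hF
  refine ⟨F, fun k => b ^ (-s * dist o (k.1 o)) / W, fun k => by positivity, ?_, ?_, ?_, ?_⟩
  · rw [← Finset.sum_div, div_self hW0.ne']
  · intro f hf g hg hne
    have := hsep f (hSS₀ (hFS hf)) g (hSS₀ (hFS hg)) hne
    linarith [le_max_left C₁ 0]
  · intro k hk
    obtain ⟨hkT, η, hη, hkη⟩ := hS₀Z (hSS₀ (hFS hk))
    refine ⟨(le_max_left _ _).trans hkT, ?_⟩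
    have h1 := hV2 η.rep ξ.rep R (by
      rw [GromovBoundary.toBoundary_rep, GromovBoundary.toBoundary_rep]; exact hη.1)
    filter_upwards [hkη, h1] with m h2 h3
    have h4 := hK.le_trans (R := R - V - σ') (h2.trans' (by linarith [le_max_right T R]))
      (h3.trans' (by linarith))
    linarith [le_max_right (4 * M) (V + σ' + K)]
  · intro x t
    rw [← Finset.sum_div]
    have h1 := hS1 (x, t) (F.filter fun k => t ≤ gromovProd o (k.1 o) x) fun k hk => by
      have := Finset.mem_filter.1 (Finset.mem_coe.1 hk)
      exact ⟨hFS this.1, this.2⟩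
    rw [div_le_iff₀ hW0]
    refine h1.trans ?_
    have h2 : 2 ≤ max (4 * M) (V + σ' + K) / h * W := by
      calc (2 : ℝ) = 4 * M / h * (h / (2 * M)) := by field_simp; norm_num
        _ ≤ max (4 * M) (V + σ' + K) / h * W := by
          gcongr
          exact le_max_left _ _
    calc 2 * b ^ (-s * t) ≤ max (4 * M) (V + σ' + K) / h * W * b ^ (-s * t) := by gcongr
      _ = _ := by ring

end Frostman

/-! ### Trees of group elements -/

section TreeSystems

variable {X : Type*} [MetricSpace X]

/-- A sequence of finite weighted families of group elements, together with connecting elements: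
at level `n`, an element `u` is followed by the elements `u * conn n u * z` with `z ∈ Z n`. -/
structure TreeSystem (o : X) (G : Subgroup (X ≃ᵢ X)) (K C : ℝ) where
  Z : ℕ → Finset G
  w : ℕ → G → ℝ
  conn : ℕ → G → G
  C_nonneg : 0 ≤ C
  w_nonneg : ∀ n z, 0 ≤ w n z
  dist_conn : ∀ n u, dist o ((conn n u).1 o) ≤ C
  third_le : ∀ n (u : G), 1 / 3 ≤
    ∑ z ∈ Z n with gromovProd o (u.1⁻¹ o) ((conn n u).1 (z.1 o)) ≤ C, w n z
  le_dist : ∀ n, ∀ z ∈ Z n, 3 * C + K + 1 ≤ dist o (z.1 o)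
  separated : ∀ n, IsSeparated o (5 * C + 3 * K + 1) (Z n : Set G)

namespace TreeSystem

variable {o : X} {G : Subgroup (X ≃ᵢ X)} {K C : ℝ} (T : TreeSystem o G K C)

/-- The group element of a node. -/
def ev : List G → G
  | [] => 1
  | z :: l => ev l * T.conn l.length (ev l) * z

/-- The admissible successors of a node. -/
def kids (l : List G) : Finset G :=
  (T.Z l.length).filter fun z =>
    gromovProd o ((T.ev l).1⁻¹ o) ((T.conn l.length (T.ev l)).1 (z.1 o)) ≤ C

/-- The total weight of the admissible successors of a node. -/
def kidsWeight (l : List G) : ℝ := ∑ z ∈ T.kids l, T.w l.length z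

/-- The transition weights. -/
def p (l : List G) (z : G) : ℝ≥0∞ := ENNReal.ofReal (T.w l.length z / T.kidsWeight l)

/-- The norm of the group element of a node. -/
def norm (l : List G) : ℝ := dist o ((T.ev l).1 o)

theorem third_le_kidsWeight (l : List G) : 1 / 3 ≤ T.kidsWeight l := T.third_le _ _

theorem sum_p (l : List G) : ∑ z ∈ T.kids l, T.p l z = 1 := by
  have h := T.third_le_kidsWeight l
  unfold p
  rw [← ENNReal.ofReal_sum_of_nonneg fun z _ => div_nonneg (T.w_nonneg _ _) (by linarith),
    ← Finset.sum_div]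
  change ENNReal.ofReal (T.kidsWeight l / T.kidsWeight l) = 1
  rw [div_self (by linarith), ENNReal.ofReal_one]

theorem p_le (l : List G) (z : G) : T.p l z ≤ ENNReal.ofReal (3 * T.w l.length z) := by
  have h := T.third_le_kidsWeight l
  refine ENNReal.ofReal_le_ofReal ?_
  rw [div_le_iff₀ (by linarith)]
  nlinarith [T.w_nonneg l.length z]

theorem gromovProd_le_of_mem_kids {l : List G} {z : G} (hz : z ∈ T.kids l) :
    gromovProd o ((T.ev l).1⁻¹ o) ((T.conn l.length (T.ev l) * z).1 o) ≤ C :=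
  (Finset.mem_filter.1 hz).2

theorem norm_cons {l : List G} (z : G) : T.norm (z :: l) = T.norm l +
    dist o ((T.conn l.length (T.ev l) * z).1 o) -
    2 * gromovProd o ((T.ev l).1⁻¹ o) ((T.conn l.length (T.ev l) * z).1 o) := by
  rw [norm, ev, mul_assoc]
  exact dist_mul_eq _ _ _

theorem dist_conn_mul (l : List G) (z : G) :
    |dist o ((T.conn l.length (T.ev l) * z).1 o) - dist o (z.1 o)| ≤ C := by
  have h1 := T.dist_conn l.length (T.ev l)
  have h2 := dist_mul_le (T.conn l.length (T.ev l)).1 z.1 o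
  have h3 := dist_mul_le (T.conn l.length (T.ev l)).1⁻¹ ((T.conn l.length (T.ev l)).1 * z.1) o
  rw [inv_mul_cancel_left, dist_inv_apply] at h3
  rw [abs_le]
  constructor
  · change _ ≤ dist o (((T.conn l.length (T.ev l)).1 * z.1) o) - _
    linarith
  · change dist o (((T.conn l.length (T.ev l)).1 * z.1) o) - _ ≤ _
    linarith

theorem norm_cons_le (l : List G) (z : G) :
    T.norm (z :: l) ≤ T.norm l + C + dist o (z.1 o) := by
  rw [norm_cons]
  have h1 := (abs_le.1 (T.dist_conn_mul l z)).2
  have h2 := gromovProd_nonneg o ((T.ev l).1⁻¹ o) ((T.conn l.length (T.ev l) * z).1 o)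
  linarith

theorem le_norm_cons {l : List G} {z : G} (hz : z ∈ T.kids l) :
    T.norm l + dist o (z.1 o) - 3 * C ≤ T.norm (z :: l) := by
  rw [norm_cons]
  have h1 := (abs_le.1 (T.dist_conn_mul l z)).1
  have h2 := T.gromovProd_le_of_mem_kids hz
  linarith

/-- The length condition beats the possible loss 3C (C for the connector, 2C for backtracking) by K
+ 1. The K is what keeps errors from accumulating along a branch. -/
theorem norm_add_le_norm_cons {l : List G} {z : G} (hz : z ∈ T.kids l) :
    T.norm l + K + 1 ≤ T.norm (z :: l) := by
  have := T.le_norm_cons hz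
  have := T.le_dist _ z (Finset.mem_filter.1 hz).1
  linarith

/-- Translating by the parent element turns the backtracking at the new step, at most C, into the
product of `o` and the child based at the parent. -/
theorem gromovProd_cons {l : List G} {z : G} (hz : z ∈ T.kids l) :
    T.norm l - C ≤ gromovProd o ((T.ev (z :: l)).1 o) ((T.ev l).1 o) := by
  have h1 := gromovProd_add_swap o ((T.ev (z :: l)).1 o) ((T.ev l).1 o)
  have h2 : gromovProd ((T.ev l).1 o) o ((T.ev (z :: l)).1 o) =
      gromovProd o ((T.ev l).1⁻¹ o) ((T.conn l.length (T.ev l) * z).1 o) := by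
    rw [gromovProd_comm, gromovProd_comm o, ev, mul_assoc]
    exact gromovProd_map_mid (T.ev l).1 o _ o
  have h3 := T.gromovProd_le_of_mem_kids hz
  change T.norm l - C ≤ _
  unfold norm
  linarith

section Branch

variable (hK : IsHypConst X K) {ω : ℕ → G} (hω : IsBranch T.kids ω)
include hK hω

theorem le_norm_word (n : ℕ) : (n : ℝ) ≤ T.norm (word ω n) := by
  induction n with
  | zero => rw [Nat.cast_zero]; exact dist_nonneg
  | succ n ih =>
    have := T.norm_add_le_norm_cons (hω n)
    rw [word]; push_cast
    linarith [hK.1]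

/-- A branch does not backtrack. -/
theorem le_gromovProd_word (n k : ℕ) : T.norm (word ω n) - C - K ≤
    gromovProd o ((T.ev (word ω (n + k))).1 o) ((T.ev (word ω n)).1 o) := by
  have hC := T.C_nonneg
  have hK0 := hK.1
  induction k generalizing n with
  | zero =>
    rw [Nat.add_zero, gromovProd_self]
    change _ ≤ T.norm (word ω n)
    linarith
  | succ k ih =>
    -- The induction hypothesis is used at the next node, whose norm is larger by K + 1. This
    -- absorbs its loss, so the total error stays C + K.
    have h1 := ih (n + 1)
    rw [show n + 1 + k = n + (k + 1) by ring] at h1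
    have h2 : T.norm (word ω n) - C ≤
        gromovProd o ((T.ev (word ω (n + 1))).1 o) ((T.ev (word ω n)).1 o) :=
      T.gromovProd_cons (hω n)
    have h3 : T.norm (word ω n) - C ≤ gromovProd o ((T.ev (word ω (n + (k + 1)))).1 o)
        ((T.ev (word ω (n + 1))).1 o) := by
      refine h1.trans' ?_
      have := T.norm_add_le_norm_cons (hω n)
      change _ ≤ T.norm (ω n :: word ω n) - C - K
      linarith
    exact hK.le_trans h3 h2

theorem le_gromovProd_word_of_le {n m : ℕ} (h : n ≤ m) : T.norm (word ω n) - C - K ≤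
    gromovProd o ((T.ev (word ω m)).1 o) ((T.ev (word ω n)).1 o) := by
  obtain ⟨k, rfl⟩ := Nat.exists_eq_add_of_le h
  exact T.le_gromovProd_word hK hω n k

theorem isGromovSeq_word : IsGromovSeq fun n => (T.ev (word ω n)).1 o := by
  rw [isGromovSeq_iff o]
  refine tendsto_atTop.2 fun a => ?_
  obtain ⟨N, hN⟩ := exists_nat_ge (a + C + K)
  refine eventually_atTop.2 ⟨(N, N), fun q hq => ?_⟩
  have h1 : (N : ℝ) ≤ q.1 := by exact_mod_cast hq.1
  have h2 : (N : ℝ) ≤ q.2 := by exact_mod_cast hq.2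
  have h3 := T.le_norm_word hK hω q.1
  have h4 := T.le_norm_word hK hω q.2
  rcases le_total q.1 q.2 with h | h
  · have := T.le_gromovProd_word_of_le hK hω h
    rw [gromovProd_comm]
    linarith
  · have := T.le_gromovProd_word_of_le hK hω h
    linarith

/-- The Gromov sequence of a branch. -/
def seq : GromovSeq X := ⟨fun n => (T.ev (word ω n)).1 o, T.isGromovSeq_word hK hω⟩

theorem isRadialSeq_seq : IsRadialSeq o G (C + K) (T.seq hK hω).1 := by
  intro r
  obtain ⟨N, hN⟩ := exists_nat_ge r
  refine ⟨(T.ev (word ω N)).1, (T.ev (word ω N)).2, hN.trans (T.le_norm_word hK hω N), ?_⟩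
  filter_upwards [eventually_ge_atTop N] with m hm
  have h1 := T.le_gromovProd_word_of_le hK hω hm
  have h2 := gromovProd_add_swap o ((T.ev (word ω m)).1 o) ((T.ev (word ω N)).1 o)
  change gromovProd ((T.ev (word ω N)).1 o) o ((T.ev (word ω m)).1 o) ≤ C + K
  unfold norm at h1
  linarith

end Branch

open Classical in
/-- The limit point of a branch. -/
def limit [GromovHyperbolic X] (hK : IsHypConst X K) (ξ : GromovBoundary X) (ω : ℕ → G) :
    GromovBoundary X :=
  -- The value off the branches is arbitrary.
  if hω : IsBranch T.kids ω then (T.seq hK hω).toBoundary else ξ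

section Limit

variable [GromovHyperbolic X] (hK : IsHypConst X K) (ξ : GromovBoundary X)

theorem limit_eq {ω : ℕ → G} (hω : IsBranch T.kids ω) :
    T.limit hK ξ ω = (T.seq hK hω).toBoundary := dif_pos hω

theorem limit_mem_sigmaRadialLimitSet {ω : ℕ → G} (hω : IsBranch T.kids ω) :
    T.limit hK ξ ω ∈ sigmaRadialLimitSet o G (C + K) := by
  rw [T.limit_eq hK ξ hω]
  exact mem_sigmaRadialLimitSet_of_isRadialSeq _ (T.isRadialSeq_seq hK hω)

variable [MetricSpace (GromovBoundary X)] {b V : ℝ} (hb : 1 < b) (hV : IsVisConst b o V)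
include hV

/-- Branches that separate at a node have limit points that are not too close. -/
theorem le_norm_of_split {l : List G} {z z' : G} (hz : z ∈ T.kids l) (hz' : z' ∈ T.kids l)
    (hne : z ≠ z') {ω ω' : ℕ → G} (hω : IsBranch T.kids ω) (hω' : IsBranch T.kids ω')
    (h : word ω (l.length + 1) = z :: l) (h' : word ω' (l.length + 1) = z' :: l) {t : ℝ}
    (ht : dist (T.limit hK ξ ω) (T.limit hK ξ ω') ≤ b ^ (-t)) :
    t ≤ T.norm (z :: l) - C - K + V := by
  have hC := T.C_nonneg
  have hK0 := hK.1
  by_contra! hcon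
  rw [T.limit_eq hK ξ hω, T.limit_eq hK ξ hω'] at ht
  obtain ⟨m, h1, hm⟩ := ((hV.2.2 _ _ _ ht).and (eventually_ge_atTop (l.length + 1))).exists
  change _ ≤ gromovProd o ((T.ev (word ω m)).1 o) ((T.ev (word ω' m)).1 o) at h1
  have h2 := T.le_gromovProd_word_of_le hK hω hm
  have h3 := T.le_gromovProd_word_of_le hK hω' hm
  rw [h, gromovProd_comm] at h2
  rw [h'] at h3
  set a := T.conn l.length (T.ev l) with ha
  have hsep := T.separated l.length z (Finset.mem_filter.1 hz).1 z' (Finset.mem_filter.1 hz').1 hne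
  have hsep' := T.separated l.length z' (Finset.mem_filter.1 hz').1 z (Finset.mem_filter.1 hz).1
    hne.symm
  rw [gromovProd_comm] at hsep'
  have h4 : gromovProd o ((T.ev (z :: l)).1 o) ((T.ev (z' :: l)).1 o) ≤
      T.norm l + C + gromovProd o (z.1 o) (z'.1 o) := by
    have h5 : gromovProd o ((T.ev (z :: l)).1 o) ((T.ev (z' :: l)).1 o) =
        gromovProd ((T.ev l * a).1⁻¹ o) (z.1 o) (z'.1 o) := by
      simp only [ev, ← ha]
      exact gromovProd_map_left (T.ev l * a).1 o (z.1 o) (z'.1 o)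
    rw [h5, gromovProd_base_change o, dist_inv_apply]
    have h6 := dist_mul_le (T.ev l).1 a.1 o
    have h7 := T.dist_conn l.length (T.ev l)
    have h8 := gromovProd_nonneg o ((T.ev l * a).1⁻¹ o) (z.1 o)
    have h9 := gromovProd_nonneg o ((T.ev l * a).1⁻¹ o) (z'.1 o)
    change dist o ((T.ev l * a).1 o) ≤ _ at h6
    unfold norm
    linarith
  have h5 := T.le_norm_cons hz
  have h6 := T.le_norm_cons hz'
  set μ := min (T.norm (z :: l)) (T.norm (z' :: l)) with hμ
  have hμ1 := min_le_left (T.norm (z :: l)) (T.norm (z' :: l))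
  have hμ2 := min_le_right (T.norm (z :: l)) (T.norm (z' :: l))
  have h7 := hK.le_trans (R := μ - C - K) (h2.trans' (by linarith)) (h1.trans' (by linarith))
  have h8 := hK.le_trans h7 (h3.trans' (by linarith))
  -- The separation constant 5C + 3K + 1 is chosen to make this false: the left side is forced by
  -- closeness of the limits, the right side by separation of the siblings.
  have h9 : μ - C - K - K - K ≤ μ + 4 * C - (5 * C + 3 * K + 1) := by
    rcases min_choice (T.norm (z :: l)) (T.norm (z' :: l)) with h0 | h0
    · rw [hμ, h0]
      rw [hμ, h0] at h8
      linarith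
    · rw [hμ, h0]
      rw [hμ, h0] at h8
      linarith
  linarith

open Classical in
/-- The Frostman condition at a node where branches separate. -/
theorem sum_w_le_of_split {s : ℝ} {l : List G} {A : ℝ}
    (hA : ∀ x t, ∑ z ∈ T.Z l.length with t ≤ gromovProd o (z.1 o) x, T.w l.length z ≤
      A * b ^ (-s * t))
    {U : Set (GromovBoundary X)} {t : ℝ} (hU : ∀ x ∈ U, ∀ y ∈ U, dist x y ≤ b ^ (-t))
    {z z' : G} (hz : z ∈ T.kids l) (hz' : z' ∈ T.kids l) (hne : z ≠ z')
    (hzU : Hits T.kids (T.limit hK ξ) U (z :: l)) (hzU' : Hits T.kids (T.limit hK ξ) U (z' :: l)) :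
    ∑ c ∈ T.kids l with Hits T.kids (T.limit hK ξ) U (c :: l), T.w l.length c ≤
      A * b ^ (-s * (t - T.norm l - V - 2 * C - 2 * K)) := by
  have hK0 := hK.1
  set H := (T.kids l).filter fun c => Hits T.kids (T.limit hK ξ) U (c :: l) with hH
  -- Two children hit `U`, so each child that hits `U` has a rival and the previous lemma applies to
  -- it.
  have hlong : ∀ c ∈ H, t ≤ T.norm (c :: l) - C - K + V := by
    intro c hc
    obtain ⟨hc, ω, hω, hwω, hUω⟩ := Finset.mem_filter.1 hc
    have : ∃ d ∈ T.kids l, c ≠ d ∧ Hits T.kids (T.limit hK ξ) U (d :: l) := by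
      by_cases h : c = z
      · exact ⟨z', hz', h ▸ hne, hzU'⟩
      · exact ⟨z, hz, h, hzU⟩
    obtain ⟨d, hd, hcd, ω', hω', hwω', hUω'⟩ := this
    exact T.le_norm_of_split hK ξ hV hc hd hcd hω hω' hwω hwω' (hU _ hUω _ hUω')
  obtain ⟨ω₁, hω₁, hw₁, hU₁⟩ := hzU
  have hev : ∀ c ∈ H, ∀ᶠ m in atTop, t - V - C - 2 * K ≤
      gromovProd o ((T.ev (c :: l)).1 o) ((T.ev (word ω₁ m)).1 o) := by
    intro c hc
    have hcl := hlong c hc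
    obtain ⟨hc, ω, hω, hwω, hUω⟩ := Finset.mem_filter.1 hc
    have h1 := hU _ hUω _ hU₁
    rw [T.limit_eq hK ξ hω, T.limit_eq hK ξ hω₁] at h1
    filter_upwards [hV.2.2 _ _ _ h1, eventually_ge_atTop (l.length + 1)] with m h2 hm
    change _ ≤ gromovProd o ((T.ev (word ω m)).1 o) ((T.ev (word ω₁ m)).1 o) at h2
    have h3 := T.le_gromovProd_word_of_le hK hω hm
    rw [show word ω (l.length + 1) = c :: l from hwω, gromovProd_comm] at h3
    have h4 := hK.le_trans (R := t - V - C - K) (h3.trans' (by linarith [hV.1, T.C_nonneg]))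
      (h2.trans' (by linarith [T.C_nonneg]))
    linarith
  -- There are finitely many children, so a single orbit point on the branch `ω₁` can replace its
  -- limit. Translated back to the node it becomes the centre of a ball containing all of `H`, to
  -- which the Frostman condition applies.
  obtain ⟨m, hm⟩ := ((Finset.eventually_all H).2 hev).exists
  set h := T.ev l * T.conn l.length (T.ev l) with hh
  refine le_trans ?_ (hA (h.1⁻¹ ((T.ev (word ω₁ m)).1 o)) _)
  refine Finset.sum_le_sum_of_subset_of_nonneg (fun c hc => ?_) fun _ _ _ => T.w_nonneg _ _
  have hcZ := (Finset.mem_filter.1 (Finset.mem_filter.1 hc).1).1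
  refine Finset.mem_filter.2 ⟨hcZ, ?_⟩
  have h1 := hm c hc
  have h2 : gromovProd o ((T.ev (c :: l)).1 o) ((T.ev (word ω₁ m)).1 o) =
      gromovProd (h.1⁻¹ o) (c.1 o) (h.1⁻¹ ((T.ev (word ω₁ m)).1 o)) := by
    rw [← gromovProd_map_left]
    congr 1
    exact (h.1.apply_symm_apply _).symm
  rw [h2, gromovProd_base_change o, dist_inv_apply] at h1
  have h6 := dist_mul_le (T.ev l).1 (T.conn l.length (T.ev l)).1 o
  change dist o (h.1 o) ≤ _ at h6
  have h7 := T.dist_conn l.length (T.ev l)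
  have h8 := gromovProd_nonneg o (h.1⁻¹ o) (c.1 o)
  have h9 := gromovProd_nonneg o (h.1⁻¹ o) (h.1⁻¹ ((T.ev (word ω₁ m)).1 o))
  unfold norm
  linarith

include hb

theorem dist_limit_le {ω ω' : ℕ → G} (hω : IsBranch T.kids ω) (hω' : IsBranch T.kids ω') {n : ℕ}
    (h : word ω' n = word ω n) :
    dist (T.limit hK ξ ω') (T.limit hK ξ ω) ≤ b ^ (V + C + 2 * K - n) := by
  rw [T.limit_eq hK ξ hω, T.limit_eq hK ξ hω']
  have h1 : ∀ᶠ m in atTop, (n : ℝ) - C - 2 * K ≤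
      gromovProd o ((T.seq hK hω').1 m) ((T.seq hK hω).1 m) := by
    filter_upwards [eventually_ge_atTop n] with m hm
    have h2 := T.le_gromovProd_word_of_le hK hω hm
    have h3 := T.le_gromovProd_word_of_le hK hω' hm
    rw [h] at h3
    rw [gromovProd_comm] at h2
    have h4 := hK.le_trans h3 h2
    have h5 := T.le_norm_word hK hω n
    change _ ≤ gromovProd o ((T.ev (word ω' m)).1 o) ((T.ev (word ω m)).1 o)
    linarith
  refine (hV.2.1 _ _ _ h1.frequently).trans (Real.rpow_le_rpow_of_exponent_le hb.le ?_)
  linarith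

/-- A lower bound for the dimension of the limit set of a tree system. -/
theorem le_dimH_limit {s : ℝ} (hs : 0 < s) {A : ℕ → ℝ} {B : ℝ} (hB : 0 < B)
    (hA1 : ∀ n, 1 ≤ A n)
    (hA : ∀ n x t, ∑ z ∈ T.Z n with t ≤ gromovProd o (z.1 o) x, T.w n z ≤ A n * b ^ (-s * t))
    (hmass : ∀ l, Reach T.kids l → wordMass T.p l * ENNReal.ofReal (A l.length) ≤
      ENNReal.ofReal (B * b ^ (-s * T.norm l))) :
    ENNReal.ofReal s ≤ dimH (T.limit hK ξ '' {ω | IsBranch T.kids ω}) := by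
  classical
  have hb0 : 0 < b := by linarith
  have hle : ∀ l, Reach T.kids l → wordMass T.p l ≤ ENNReal.ofReal (B * b ^ (-s * T.norm l)) := by
    intro l hl
    refine le_trans ?_ (hmass l hl)
    refine le_mul_of_one_le_right' ?_
    rw [← ENNReal.ofReal_one]
    exact ENNReal.ofReal_le_ofReal (hA1 _)
  refine le_dimH_of_tree (fun l _ => T.sum_p l) (fun ω hω ε hε => ?_) (fun ω hω => ?_) hs
    (C := 3 * B * b ^ (s * (V + 2 * C + 2 * K))) (by positivity) ?_
  · have h1 : Tendsto (fun n : ℕ => b ^ (V + C + 2 * K) * (b⁻¹) ^ n) atTop (𝓝 (b ^ (V + C + 2 * K)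
        * 0)) := (tendsto_pow_atTop_nhds_zero_of_lt_one (by positivity)
          (inv_lt_one_of_one_lt₀ hb)).const_mul _
    rw [mul_zero] at h1
    obtain ⟨n, hn⟩ := (h1.eventually (gt_mem_nhds hε)).exists
    refine ⟨n, fun ω' hω' h => (T.dist_limit_le hK ξ hb hV hω hω' h).trans_lt ?_⟩
    rwa [Real.rpow_sub hb0, Real.rpow_natCast, div_eq_mul_inv, ← inv_pow]
  · have h1 : Tendsto (fun n : ℕ => ENNReal.ofReal (B * (b ^ (-s)) ^ n)) atTop
        (𝓝 (ENNReal.ofReal (B * 0))) := ENNReal.tendsto_ofReal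
      ((tendsto_pow_atTop_nhds_zero_of_lt_one (by positivity)
          (Real.rpow_lt_one_of_one_lt_of_neg hb (by linarith))).const_mul _)
    rw [mul_zero, ENNReal.ofReal_zero] at h1
    refine tendsto_of_tendsto_of_tendsto_of_le_of_le tendsto_const_nhds h1
      (fun _ => zero_le) fun n => (hle _ (hω.reach n)).trans (ENNReal.ofReal_le_ofReal ?_)
    rw [← Real.rpow_natCast, ← Real.rpow_mul hb0.le]
    refine mul_le_mul_of_nonneg_left (Real.rpow_le_rpow_of_exponent_le hb.le ?_) hB.le
    have := T.le_norm_word hK hω n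
    nlinarith
  · intro U ρ hρ hU l hl z hz z' hz' hne hzU hzU'
    have hbρ : b ^ (-(-Real.logb b ρ)) = ρ := by
      rw [neg_neg, Real.rpow_logb hb0 hb.ne' hρ]
    have hsum := T.sum_w_le_of_split hK ξ hV (hA l.length) (t := -Real.logb b ρ)
      (by rw [hbρ]; exact hU) hz hz' hne hzU hzU'
    simp only [wordMass]
    rw [← Finset.mul_sum]
    have h1 : ∑ c ∈ T.kids l with Hits T.kids (T.limit hK ξ) U (c :: l), T.p l c ≤
        ENNReal.ofReal (3 * (A l.length *
          b ^ (-s * (-Real.logb b ρ - T.norm l - V - 2 * C - 2 * K)))) := by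
      refine (Finset.sum_le_sum fun c _ => T.p_le l c).trans ?_
      rw [← ENNReal.ofReal_sum_of_nonneg fun c _ => mul_nonneg (by norm_num) (T.w_nonneg _ _),
        ← Finset.mul_sum]
      exact ENNReal.ofReal_le_ofReal (mul_le_mul_of_nonneg_left hsum (by norm_num))
    -- The Frostman constant `A` of the level may be huge; the mass of the node, through `hmass`,
    -- compensates for it.
    refine (mul_le_mul_right h1 _).trans ?_
    have h2 : ENNReal.ofReal (3 * (A l.length *
          b ^ (-s * (-Real.logb b ρ - T.norm l - V - 2 * C - 2 * K)))) =
        ENNReal.ofReal (A l.length) * ENNReal.ofReal (3 *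
          b ^ (-s * (-Real.logb b ρ - T.norm l - V - 2 * C - 2 * K))) := by
      rw [← ENNReal.ofReal_mul (by linarith [hA1 l.length])]
      ring_nf
    rw [h2, ← mul_assoc]
    refine (mul_le_mul_left (hmass l hl) _).trans ?_
    rw [← ENNReal.ofReal_mul (by positivity)]
    refine ENNReal.ofReal_le_ofReal (le_of_eq ?_)
    have h3 : ρ ^ s = b ^ (-s * -Real.logb b ρ) := by
      conv_lhs => rw [← hbρ]
      rw [← Real.rpow_mul hb0.le]; ring_nf
    rw [h3]
    calc B * b ^ (-s * T.norm l) *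
        (3 * b ^ (-s * (-Real.logb b ρ - T.norm l - V - 2 * C - 2 * K)))
        = 3 * B * (b ^ (-s * T.norm l) *
          b ^ (-s * (-Real.logb b ρ - T.norm l - V - 2 * C - 2 * K))) := by ring
      _ = 3 * B * (b ^ (s * (V + 2 * C + 2 * K)) * b ^ (-s * -Real.logb b ρ)) := by
        rw [← Real.rpow_add hb0, ← Real.rpow_add hb0]; ring_nf
      _ = _ := by ring

end Limit

end TreeSystem

end TreeSystems

/-! ### Points approximated infinitely often -/

section LowerBound

variable {X : Type*} [MetricSpace X]

namespace TreeSystem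

variable {o : X} {G : Subgroup (X ≃ᵢ X)} {K C : ℝ} (T : TreeSystem o G K C)

/-- If the successor of a node of a branch points in the direction of `ξ`, then the limit of the
branch is close to the corresponding translate of `ξ`. -/
theorem dist_boundaryMap_limit_le [GromovHyperbolic X] (hK : IsHypConst X K)
    [MetricSpace (GromovBoundary X)] {b V : ℝ} (hb : 1 < b) (hV : IsVisConst b o V)
    (ξ : GromovBoundary X) {ω : ℕ → G} (hω : IsBranch T.kids ω) {n : ℕ} {R : ℝ}
    (hR : 2 * C + K < R) (h : ∀ᶠ m in atTop, R ≤ gromovProd o ((ω n).1 o) (ξ.rep.1 m)) :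
    dist (boundaryMap (T.ev (word ω n) * T.conn n (T.ev (word ω n))).1 ξ) (T.limit hK ξ ω) ≤
      b ^ (V + 5 * C + 2 * K -
        dist o ((T.ev (word ω n) * T.conn n (T.ev (word ω n))).1 o) - R) := by
  have hC := T.C_nonneg
  have hK0 := hK.1
  set u := T.ev (word ω n) with hu
  set a := T.conn n u with ha
  set g : G := u * a with hg
  have hev : T.ev (word ω (n + 1)) = g * ω n := by
    rw [word, ev, length_word]
  have hz := hω n
  have hz' := T.gromovProd_le_of_mem_kids hz
  rw [length_word] at hz'
  -- Moving the base point and the connector to the other side costs C beyond the admissible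
  -- backtracking.
  have h1 : gromovProd o (g.1⁻¹ o) ((ω n).1 o) ≤ 2 * C := by
    have h2 : gromovProd o (u.1⁻¹ o) ((a * ω n).1 o) =
        gromovProd (a.1⁻¹ o) (g.1⁻¹ o) ((ω n).1 o) := by
      rw [← gromovProd_map_left]
      congr 1
      rw [hg, Subgroup.coe_mul, mul_inv_rev]
      change _ = (a.1 * (a.1⁻¹ * u.1⁻¹)) o
      rw [mul_inv_cancel_left]
    have h3 := gromovProd_le_add (a.1⁻¹ o) o (g.1⁻¹ o) ((ω n).1 o)
    rw [dist_comm, dist_inv_apply] at h3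
    have h4 : dist o (a.1 o) ≤ C := T.dist_conn n u
    rw [← hu, ← ha, h2] at hz'
    linarith
  have h5 : dist o ((g * ω n).1 o) = dist o (g.1 o) + dist o ((ω n).1 o) -
      2 * gromovProd o (g.1⁻¹ o) ((ω n).1 o) := dist_mul_eq _ _ _
  have hR' : R ≤ dist o ((ω n).1 o) := by
    obtain ⟨m, hm⟩ := h.exists
    exact hm.trans (gromovProd_le_left _ _ _)
  have key : ∀ᶠ m in atTop, R + dist o (g.1 o) - 5 * C - 2 * K ≤
      gromovProd o (((ξ.rep).map g.1).1 m) ((T.seq hK hω).1 m) := by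
    filter_upwards [h, eventually_ge_atTop (n + 1)] with m hm hnm
    -- Since ξ and ω n agree up to depth R > 2C + K, ξ does not backtrack against g either. Hence
    -- g(ξ) and the next node agree up to depth about |g| + R.
    have h6 : gromovProd o (g.1⁻¹ o) (ξ.rep.1 m) ≤ 2 * C + K :=
      hK.le_of_lt h1 (by rw [gromovProd_comm]; linarith)
    have h7 : gromovProd o (g.1 (ξ.rep.1 m)) (g.1 ((ω n).1 o)) =
        gromovProd o (ξ.rep.1 m) ((ω n).1 o) + dist o (g.1 o) -
          gromovProd o (g.1⁻¹ o) (ξ.rep.1 m) - gromovProd o (g.1⁻¹ o) ((ω n).1 o) := by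
      rw [gromovProd_map_left, gromovProd_base_change o, dist_inv_apply]
    have h8 := T.le_gromovProd_word_of_le hK hω hnm
    rw [norm, hev, h5, gromovProd_comm o ((T.ev (word ω m)).1 o)] at h8
    rw [gromovProd_comm o (ξ.rep.1 m)] at h7
    change gromovProd o (g.1 (ξ.rep.1 m)) ((g * ω n).1 o) = _ at h7
    have h9 := hK.le_trans (R := R + dist o (g.1 o) - 5 * C - K) (h7.ge.trans' (by linarith))
      (h8.trans' (by linarith))
    change _ ≤ gromovProd o (g.1 (ξ.rep.1 m)) ((T.ev (word ω m)).1 o)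
    linarith
  have h7 := hV.2.1 _ _ _ key.frequently
  rw [← boundaryMap_toBoundary, GromovBoundary.toBoundary_rep, ← T.limit_eq hK ξ hω] at h7
  refine h7.trans (Real.rpow_le_rpow_of_exponent_le hb.le ?_)
  linarith

/-- The mass of a node of a tree system which consists of runs of generic levels, separated by
single levels at which the weights decay. The state of a level is a bound for the norms at the
beginning of its run and its position in the run. -/
theorem mass_invariant {b s s' L : ℝ} (hb : 1 < b) (hs : 0 ≤ s) (hs' : s ≤ s') {st : ℕ → ℝ × ℕ}
    {len : ℝ → ℕ} (hst : st 0 = (0, 0))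
    (hgen : ∀ n, (st n).2 < len (st n).1 → st (n + 1) = ((st n).1, (st n).2 + 1) ∧
      ∀ z ∈ T.Z n, C + dist o (z.1 o) ≤ L ∧ 3 * T.w n z ≤ b ^ (-s' * L))
    (hjump : ∀ n, (st n).2 = len (st n).1 → ∃ D,
      st (n + 1) = ((st n).1 + len (st n).1 * L + (C + D), 0) ∧
      ∀ z ∈ T.Z n, dist o (z.1 o) ≤ D ∧ 3 * T.w n z ≤
        b ^ (s' * (len (st n).1 * L) - s * ((st n).1 + len (st n).1 * L) -
          s * (C + dist o (z.1 o)))) {l : List G} (hl : Reach T.kids l) :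
    (st l.length).2 ≤ len (st l.length).1 ∧
    T.norm l ≤ (st l.length).1 + (st l.length).2 * L ∧
    wordMass T.p l ≤ ENNReal.ofReal (b ^ (-s * T.norm l)) ∧
    wordMass T.p l ≤ ENNReal.ofReal (b ^ (-s' * ((st l.length).2 * L))) := by
  have hb0 : 0 < b := by linarith
  induction l with
  | nil =>
    have h0 : T.norm [] = 0 := by
      change dist o ((1 : X ≃ᵢ X) o) = 0
      exact dist_self o
    simp [hst, h0, wordMass]
  | cons z l ih =>
    obtain ⟨h1, h2, h3, h4⟩ := ih hl.1
    have hz : z ∈ T.Z l.length := (Finset.mem_filter.1 hl.2).1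
    have hn := T.norm_cons_le l z
    have hp := T.p_le l z
    have hmul : ∀ {x y w : ℝ}, wordMass T.p l ≤ ENNReal.ofReal (b ^ x) →
        3 * T.w l.length z ≤ b ^ y → x + y ≤ w →
        wordMass T.p (z :: l) ≤ ENNReal.ofReal (b ^ w) := by
      intro x y w hx hy hw
      refine (mul_le_mul' hx (hp.trans (ENNReal.ofReal_le_ofReal hy))).trans ?_
      rw [← ENNReal.ofReal_mul (by positivity), ← Real.rpow_add hb0]
      exact ENNReal.ofReal_le_ofReal (Real.rpow_le_rpow_of_exponent_le hb.le hw)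
    rw [List.length_cons]
    -- Two mass bounds are carried along: decay of rate `s` in the full norm, and decay of the
    -- better rate `s'` over the current run alone. The second is spent at the jump to restore the
    -- first, after which the new run starts with the trivial bound 1.
    rcases h1.lt_or_eq with hlt | heq
    · obtain ⟨h5, h6⟩ := hgen _ hlt
      obtain ⟨h7, h8⟩ := h6 z hz
      rw [h5]
      have hL : 0 ≤ L := by linarith [T.C_nonneg, dist_nonneg (x := o) (y := z.1 o)]
      refine ⟨hlt, ?_, hmul h3 h8 ?_, hmul h4 h8 (le_of_eq ?_)⟩
      · push_cast
        linarith
      · nlinarith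
      · push_cast
        ring
    · obtain ⟨D, h5, h6⟩ := hjump _ heq
      obtain ⟨h7, h8⟩ := h6 z hz
      rw [h5]
      rw [heq] at h2 h4
      have h9 : wordMass T.p (z :: l) ≤ ENNReal.ofReal (b ^ (-s * T.norm (z :: l))) :=
        hmul h4 h8 (by nlinarith)
      refine ⟨Nat.zero_le _, ?_, h9, h9.trans (ENNReal.ofReal_le_ofReal
        (Real.rpow_le_rpow_of_exponent_le hb.le ?_))⟩
      · push_cast
        linarith
      · have : 0 ≤ T.norm (z :: l) := dist_nonneg
        push_cast
        nlinarith

end TreeSystem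

open Classical in
/-- One of the connecting elements is good for a third of the weight of a family. -/
theorem exists_third_le {o : X} {G : Subgroup (X ≃ᵢ X)} {a : Fin 3 → G} {C : ℝ}
    (ha : ∀ x y : X, ∃ i, gromovProd o x ((a i).1 y) ≤ C) {Z : Finset G} {w : G → ℝ}
    (hw : ∀ z, 0 ≤ w z) (hsum : ∑ z ∈ Z, w z = 1) (x : X) :
    ∃ i, 1 / 3 ≤ ∑ z ∈ Z with gromovProd o x ((a i).1 (z.1 o)) ≤ C, w z := by
  by_contra! h
  have h1 : ∑ z ∈ Z, w z ≤
      ∑ i, ∑ z ∈ Z with gromovProd o x ((a i).1 (z.1 o)) ≤ C, w z := by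
    simp only [Finset.sum_filter]
    rw [Finset.sum_comm]
    refine Finset.sum_le_sum fun z _ => ?_
    obtain ⟨i, hi⟩ := ha x (z.1 o)
    refine le_trans ?_ (Finset.single_le_sum (fun j _ => ?_) (Finset.mem_univ i))
    · rw [if_pos hi]
    · split_ifs
      exacts [hw z, le_rfl]
  have h2 := h 0
  have h3 := h 1
  have h4 := h 2
  rw [Fin.sum_univ_three, hsum] at h1
  linarith

/-- Points with infinitely many good approximations are well approximable. -/
theorem le_approxExponent [GromovHyperbolic X] [MetricSpace (GromovBoundary X)] {b : ℝ}
    (hb : 1 < b) {o : X} {G : Subgroup (X ≃ᵢ X)} {ξ η : GromovBoundary X} {q M : ℝ}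
    (h : ∀ T : ℝ, ∃ g : G, T ≤ dist o (g.1 o) ∧
      dist (boundaryMap g.1 ξ) η ≤ b ^ (M - q * dist o (g.1 o))) :
    (q : EReal) ≤ approxExponent b o G ξ η := by
  have hb0 : 0 < b := by linarith
  refine le_of_forall_lt_imp_le_of_dense fun a ha => ?_
  induction a with
  | bot => exact bot_le
  | top => exact absurd ha (by simp)
  | coe a =>
  rw [EReal.coe_lt_coe_iff] at ha
  refine le_limsup_of_frequently_le ?_
  rw [(atTop_basis.comap _).frequently_iff]
  intro T _
  -- Beyond length M/(q - a) the gap between q and a absorbs the constant `M`.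
  obtain ⟨g, hgT, hg⟩ := h (max (max T 1) (M / (q - a)))
  have h1 : 1 ≤ dist o (g.1 o) := ((le_max_right _ _).trans (le_max_left _ _)).trans hgT
  have h2 : M / (q - a) ≤ dist o (g.1 o) := (le_max_right _ _).trans hgT
  rw [div_le_iff₀ (by linarith)] at h2
  refine ⟨g, ((le_max_left _ _).trans (le_max_left _ _)).trans hgT, ?_⟩
  rw [EReal.le_div_iff_mul_le (by exact_mod_cast (by linarith)) (EReal.coe_ne_top _), EReal.le_neg,
    ← EReal.coe_mul, ← EReal.coe_neg]
  have h3 : elogb b (ENNReal.ofReal (b ^ (-(a * dist o (g.1 o))))) =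
      ((-(a * dist o (g.1 o)) : ℝ) : EReal) := by
    rw [elogb_ofReal (by positivity), Real.logb_rpow hb0 hb.ne']
  rw [← h3]
  refine EReal.div_le_div_right_of_nonneg (by exact_mod_cast (Real.log_pos hb).le)
      (ENNReal.log_monotone ?_)
  rw [edist_dist]
  refine ENNReal.ofReal_le_ofReal (hg.trans (Real.rpow_le_rpow_of_exponent_le hb.le ?_))
  nlinarith

/-- The constant of a probability measure satisfying a Frostman condition is at least one. -/
theorem one_le_of_frostman {o : X} {G : Subgroup (X ≃ᵢ X)} {Z : Finset G} {w : G → ℝ}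
    (hsum : ∑ z ∈ Z, w z = 1) {A b s : ℝ}
    (h : ∀ x t, ∑ z ∈ Z with t ≤ gromovProd o (z.1 o) x, w z ≤ A * b ^ (-s * t)) : 1 ≤ A := by
  have h1 := h o 0
  rw [Finset.filter_true_of_mem fun z _ => gromovProd_nonneg _ _ _, hsum] at h1
  simpa using h1

theorem le_of_frostman {o : X} {G : Subgroup (X ≃ᵢ X)} {Z : Finset G} {w : G → ℝ}
    (hw : ∀ z, 0 ≤ w z) {A b s : ℝ}
    (h : ∀ x t, ∑ z ∈ Z with t ≤ gromovProd o (z.1 o) x, w z ≤ A * b ^ (-s * t)) {z : G}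
    (hz : z ∈ Z) : w z ≤ A * b ^ (-s * dist o (z.1 o)) := by
  refine le_trans ?_ (h (z.1 o) (dist o (z.1 o)))
  refine Finset.single_le_sum (f := w) (fun y _ => hw y) (Finset.mem_filter.2 ⟨hz, ?_⟩)
  rw [gromovProd_self]

end LowerBound

/-! ### Generic and approximating families, and the Cantor set of well approximable points -/

section WellApproximable

variable {X : Type*} [MetricSpace X]

open Classical in
/-- A finite weighted family of separated group elements satisfying a Frostman condition. -/
structure IsFrostmanFamily (o : X) {G : Subgroup (X ≃ᵢ X)} (b s C T A : ℝ) (Z : Finset G)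
    (w : G → ℝ) : Prop where
  nonneg : ∀ z, 0 ≤ w z
  sum_eq : ∑ z ∈ Z, w z = 1
  separated : IsSeparated o C (Z : Set G)
  le_dist : ∀ z ∈ Z, T ≤ dist o (z.1 o)
  sum_le : ∀ x t, ∑ z ∈ Z with t ≤ gromovProd o (z.1 o) x, w z ≤ A * b ^ (-s * t)

/-- Uniform weights on a separated annular family, with L = N + 1 + C. Asking for 3b^(s'(1+C)) times
b^(s'N) elements absorbs the factor 3 and the difference L - N. The Frostman constant is the trivial
one of a bounded family; one family serves all generic levels, so its size is harmless. -/
theorem exists_annulus_family [GromovHyperbolic X] {b : ℝ} (hb : 1 < b) {o : X}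
    {G : Subgroup (X ≃ᵢ X)} (hGd : StronglyDiscrete o G) {δ : ℝ≥0}
    (hδ : poincareExponent b o G = δ) {s s' : ℝ} (hs : 0 ≤ s) (hs' : 0 ≤ s') (hsδ : s' < δ)
    {C : ℝ} (hC : 0 ≤ C) (C₁ T : ℝ) :
    ∃ (L A : ℝ) (Z : Finset G) (w : G → ℝ), 0 < L ∧ IsFrostmanFamily o b s C₁ T A Z w ∧
      ∀ z ∈ Z, C + dist o (z.1 o) ≤ L ∧ 3 * w z ≤ b ^ (-s' * L) := by
  have hb0 : 0 < b := by linarith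
  obtain ⟨N, hN, S, hS, hsep, hann⟩ := exists_separated_annulus hb hGd hδ hs' hsδ C₁
    (max T (3 * b ^ (s' * (1 + C))))
  have hQ := (mul_le_mul_of_nonneg_right (le_max_right T (3 * b ^ (s' * (1 + C))))
    (by positivity : 0 ≤ b ^ (s' * N))).trans hS
  rw [mul_assoc, ← Real.rpow_add hb0] at hQ
  have hpos : (0 : ℝ) < S.card := hQ.trans_lt' (by positivity)
  refine ⟨N + 1 + C, b ^ (s * (N + 1)), S, fun _ => 1 / S.card, by positivity,
    ⟨fun _ => by positivity, ?_, hsep, fun z hz => ?_, fun x t => ?_⟩, fun z hz => ⟨?_, ?_⟩⟩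
  · rw [Finset.sum_const, nsmul_eq_mul]
    field_simp
  · exact ((le_max_left _ _).trans hN).trans (hann z hz).1
  · rw [← Real.rpow_add hb0]
    rcases le_or_gt t (N + 1) with ht | ht
    · calc _ ≤ ∑ z ∈ S, 1 / (S.card : ℝ) := Finset.sum_le_sum_of_subset_of_nonneg
            (Finset.filter_subset _ _) fun _ _ _ => by positivity
        _ = 1 := by rw [Finset.sum_const, nsmul_eq_mul]; field_simp
        _ ≤ _ := Real.one_le_rpow hb.le (by nlinarith)
    · rw [Finset.filter_false_of_mem, Finset.sum_empty]
      · positivity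
      · intro z hz
        have := gromovProd_le_left o (z.1 o) x
        linarith [(hann z hz).2]
  · linarith [(hann z hz).2]
  · rw [mul_one_div, div_le_iff₀ hpos]
    refine le_trans (le_of_eq ?_) (mul_le_mul_of_nonneg_left hQ (by positivity))
    rw [mul_left_comm, ← Real.rpow_add hb0]
    ring_nf
    simp

/-- The depth `R` is chosen first, then a run length `n` with c(M + nL + C) just below it. The
Frostman constant is about b^(pR), where R is about cnL, and the surplus b^((s'-s)nL) of the run
beats it because s' - s > cp. -/
theorem exists_approximating_family [GromovHyperbolic X] [MetricSpace (GromovBoundary X)]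
    {b : ℝ} (hb : 1 < b) {o : X} (hD : IsVisualMetric b o)
    {G : Subgroup (X ≃ᵢ X)} (hGd : StronglyDiscrete o G) {s s' c p : ℝ} (hs : 0 < s) (hc : 0 < c)
    (hss' : s + c * p < s') {ξ : GromovBoundary X} {σ : ℝ} (hp : 0 ≤ p)
    (hgood : ∀ T : ℝ, ∃ R ≥ T, ENNReal.ofReal (b ^ (-p * R)) ≤ radialContent o G ξ σ s (b ^ (-R)))
    {L : ℝ} (hL : 0 < L) (C C₁ T : ℝ) :
    ∃ C₂ : ℝ, ∀ M : ℝ, ∃ (n : ℕ) (R A : ℝ) (Z : Finset G) (w : G → ℝ),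
      IsFrostmanFamily o b s C₁ T A Z w ∧ c * (M + n * L + C) ≤ R + C₂ ∧ T < R ∧
      (∀ z ∈ Z, ∀ᶠ m in atTop, R ≤ gromovProd o (z.1 o) (ξ.rep.1 m)) ∧
      3 * A ≤ b ^ (s' * (n * L) - s * (M + n * L) - s * C) := by
  have hb0 : 0 < b := by linarith
  obtain ⟨C₂, hC₂, hF⟩ := exists_frostman_family hb hD hGd hs σ C₁
  refine ⟨C₂, fun M => ?_⟩
  set γ := Real.logb b (3 * C₂) with hγ
  set q := (s' - s) / c - p with hq
  have hcp : 0 ≤ c * p := by positivity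
  have hq0 : 0 < q := by
    rw [hq, sub_pos, lt_div_iff₀ hc]
    linarith
  -- The bounds ensure, in turn: depth above `T` after losing `C₂`, a nonnegative run length, and R
  -- q large enough to absorb every term independent of R, including the rounding error L.
  obtain ⟨R, hR, hRc⟩ := hgood (max (max (T + C₂ + 1) (c * (M + C)))
    ((γ + s * C + s * M + (s' - s) * (M + C + L)) / q))
  have hR1 : T + C₂ + 1 ≤ R := ((le_max_left _ _).trans (le_max_left _ _)).trans hR
  have hR2 : c * (M + C) ≤ R := ((le_max_right _ _).trans (le_max_left _ _)).trans hR
  have hR3 := (le_max_right _ _).trans hR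
  rw [div_le_iff₀ hq0] at hR3
  obtain ⟨Z, w, hw, hsum, hsep, hZ, hfr⟩ := hF ξ R T _ (by positivity) hRc
  have hnn : 0 ≤ (R / c - M - C) / L := by
    refine div_nonneg ?_ hL.le
    rw [sub_sub, sub_nonneg, le_div_iff₀ hc]
    linarith
  set n := ⌊(R / c - M - C) / L⌋₊ with hn
  have hn1 : n * L ≤ R / c - M - C := by
    have := Nat.floor_le hnn
    rwa [← hn, le_div_iff₀ hL] at this
  have hn2 : R / c - M - C - L ≤ n * L := by
    have := Nat.lt_floor_add_one ((R / c - M - C) / L)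
    rw [← hn, div_lt_iff₀ hL] at this
    linarith
  refine ⟨n, R - C₂, C₂ / b ^ (-p * R), Z, w, ⟨hw, hsum, hsep, fun z hz => (hZ z hz).1, hfr⟩,
    ?_, by linarith, fun z hz => (hZ z hz).2, ?_⟩
  · have : M + n * L + C ≤ R / c := by linarith
    rw [le_div_iff₀ hc] at this
    linarith
  · have h1 : 3 * (C₂ / b ^ (-p * R)) = b ^ (γ + p * R) := by
      rw [Real.rpow_add hb0, hγ, Real.rpow_logb hb0 hb.ne' (by positivity), neg_mul,
        Real.rpow_neg hb0.le]
      field_simp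
    rw [h1]
    refine Real.rpow_le_rpow_of_exponent_le hb.le ?_
    have h2 := mul_le_mul_of_nonneg_left hn2 (by linarith : 0 ≤ s' - s)
    have h3 : R * q = (s' - s) * (R / c) - p * R := by
      rw [hq]; ring
    rw [h3] at hR3
    linarith

/-- The lower bound for the dimension of the set of well approximable points. -/
theorem le_dimH_wellApproxSet [GromovHyperbolic X] [MetricSpace (GromovBoundary X)]
    {b : ℝ} (hb : 1 < b) {o : X} (hD : IsVisualMetric b o)
    {G : Subgroup (X ≃ᵢ X)} (hGd : StronglyDiscrete o G) (hGt : IsGeneralType G)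
    {δ : ℝ≥0} (hδ : poincareExponent b o G = δ) {ξ : GromovBoundary X} {s c p σ : ℝ}
    (hs : 0 < s) (hc : 0 < c) (hp : 0 ≤ p) (hsδ : s + c * p < δ)
    (hgood : ∀ T : ℝ, ∃ R ≥ T, ENNReal.ofReal (b ^ (-p * R)) ≤
      radialContent o G ξ σ s (b ^ (-R))) :
    ENNReal.ofReal s ≤ dimH (wellApproxSet b o G ξ c) := by
  classical
  have hb0 : 0 < b := by linarith
  obtain ⟨K, hK⟩ := exists_isHypConst X
  have hK0 := hK.1
  obtain ⟨V, hV⟩ := hD.exists_isVisConst hb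
  obtain ⟨a, C₀, hC₀, ha₀⟩ := exists_connectors hb hD hGt
  obtain ⟨C, hC, hCa, ha⟩ : ∃ C, 0 ≤ C ∧ (∀ i, dist o ((a i).1 o) ≤ C) ∧
      ∀ x y : X, ∃ i, gromovProd o x ((a i).1 y) ≤ C := by
    obtain ⟨C', hC'⟩ := (Finset.univ.image fun i => dist o ((a i).1 o)).exists_le
    refine ⟨max C₀ C', hC₀.trans (le_max_left _ _), fun i => (hC' _ ?_).trans (le_max_right _ _),
      fun x y => (ha₀ x y).imp fun i hi => hi.trans (le_max_left _ _)⟩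
    exact Finset.mem_image_of_mem _ (Finset.mem_univ i)
  obtain ⟨s', hss', hs'δ⟩ := exists_between hsδ
  have hcp : 0 ≤ c * p := by positivity
  set C₁ := 5 * C + 3 * K + 1 with hC₁
  set T₁ := 3 * C + K + 1 with hT₁
  obtain ⟨L, Ag, Zg, wg, hL, hg, hgL⟩ := exists_annulus_family hb hGd hδ hs.le
    (by linarith : 0 ≤ s') hs'δ hC C₁ T₁
  obtain ⟨C₂, hJ⟩ := exists_approximating_family hb hD hGd hs hc hss' hp hgood hL C C₁ T₁
  choose len R AJ ZJ wJ hJ hJc hJR hJξ hJA using hJ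
  have hDe : ∀ M, ∃ D, ∀ z ∈ ZJ M, dist o (z.1 o) ≤ D := fun M => by
    obtain ⟨D, hD⟩ := ((ZJ M).image fun z => dist o (z.1 o)).exists_le
    exact ⟨D, fun z hz => hD _ (Finset.mem_image_of_mem _ hz)⟩
  choose D hDJ using hDe
  -- The state holds a norm bound at the start of the run and the position in it. The run length
  -- depends on that bound, so the levels are scheduled recursively.
  set next : ℝ × ℕ → ℝ × ℕ := fun q =>
    if q.2 < len q.1 then (q.1, q.2 + 1) else (q.1 + len q.1 * L + (C + D q.1), 0) with hnext
  set st : ℕ → ℝ × ℕ := fun n => next^[n] (0, 0) with hst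
  have hst1 : ∀ n, st (n + 1) = next (st n) := fun n => Function.iterate_succ_apply' _ _ _
  set Z : ℕ → Finset G := fun n => if (st n).2 < len (st n).1 then Zg else ZJ (st n).1 with hZ
  set w : ℕ → G → ℝ := fun n => if (st n).2 < len (st n).1 then wg else wJ (st n).1 with hw
  set A : ℕ → ℝ := fun n => if (st n).2 < len (st n).1 then Ag else AJ (st n).1 with hA
  have hfam : ∀ n, IsFrostmanFamily o b s C₁ T₁ (A n) (Z n) (w n) := by
    intro n
    simp only [hA, hZ, hw]
    split_ifs
    exacts [hg, hJ _]
  have hthird : ∀ n (u : G), ∃ i, 1 / 3 ≤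
      ∑ z ∈ Z n with gromovProd o (u.1⁻¹ o) ((a i).1 (z.1 o)) ≤ C, w n z := fun n u =>
    exists_third_le ha (hfam n).nonneg (hfam n).sum_eq _
  choose conn hconn using hthird
  let T : TreeSystem o G K C :=
    { Z := Z
      w := w
      conn := fun n u => a (conn n u)
      C_nonneg := hC
      w_nonneg := fun n => (hfam n).nonneg
      dist_conn := fun n u => hCa _
      third_le := hconn
      le_dist := fun n => (hfam n).le_dist
      separated := fun n => (hfam n).separated }
  have hgen : ∀ n, (st n).2 < len (st n).1 → st (n + 1) = ((st n).1, (st n).2 + 1) ∧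
      ∀ z ∈ T.Z n, C + dist o (z.1 o) ≤ L ∧ 3 * T.w n z ≤ b ^ (-s' * L) := by
    intro n hn
    refine ⟨by rw [hst1]; exact if_pos hn, fun z hz => ?_⟩
    have h1 : T.Z n = Zg := if_pos hn
    have h2 : T.w n = wg := if_pos hn
    rw [h2]
    rw [h1] at hz
    exact hgL z hz
  have hjump : ∀ n, (st n).2 = len (st n).1 → ∃ D,
      st (n + 1) = ((st n).1 + len (st n).1 * L + (C + D), 0) ∧
      ∀ z ∈ T.Z n, dist o (z.1 o) ≤ D ∧ 3 * T.w n z ≤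
        b ^ (s' * (len (st n).1 * L) - s * ((st n).1 + len (st n).1 * L) -
          s * (C + dist o (z.1 o))) := by
    intro n hn
    refine ⟨D (st n).1, by rw [hst1]; exact if_neg hn.not_lt, fun z hz => ?_⟩
    have h1 : T.Z n = ZJ (st n).1 := if_neg hn.not_lt
    have h2 : T.w n = wJ (st n).1 := if_neg hn.not_lt
    rw [h2]
    rw [h1] at hz
    refine ⟨hDJ _ z hz, ?_⟩
    have h3 := le_of_frostman (hJ (st n).1).nonneg (hJ (st n).1).sum_le hz
    have h4 := mul_le_mul_of_nonneg_right (hJA (st n).1)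
      (by positivity : 0 ≤ b ^ (-s * dist o (z.1 o)))
    rw [← Real.rpow_add hb0, mul_assoc] at h4
    refine (mul_le_mul_of_nonneg_left h3 (by norm_num)).trans (h4.trans (le_of_eq ?_))
    ring_nf
  have hinv := fun {l : List G} (hl : Reach T.kids l) =>
    T.mass_invariant hb hs.le (by linarith : s ≤ s') (st := st) (len := len) rfl hgen hjump hl
  have hle : ∀ n, (st n).2 ≤ len (st n).1 := by
    intro n
    induction n with
    | zero => exact Nat.zero_le _
    | succ n ih =>
      rcases ih.lt_or_eq with h | h
      · rw [(hgen n h).1]; exact h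
      · obtain ⟨D, h1, -⟩ := hjump n h
        rw [h1]; exact Nat.zero_le _
  -- Every run is finite, so jumps recur forever; each jump supplies one approximation.
  have hio : ∀ n, ∃ m ≥ n, (st m).2 = len (st m).1 := by
    intro n
    by_contra! h
    have h1 : ∀ k, st (n + k) = ((st n).1, (st n).2 + k) := by
      intro k
      induction k with
      | zero => rfl
      | succ k ih =>
        rw [← add_assoc, (hgen (n + k) ((hle _).lt_of_ne (h _ (Nat.le_add_right n k)))).1, ih]
        rfl
    have h2 := hle (n + (len (st n).1 + 1))
    rw [h1] at h2
    simp only at h2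
    omega
  have hdim := T.le_dimH_limit hK ξ hb hV hs (A := A) (B := max 1 Ag) (by positivity)
    (fun n => one_le_of_frostman (hfam n).sum_eq (hfam n).sum_le) (fun n => (hfam n).sum_le) ?_
  · refine hdim.trans (dimH_mono ?_)
    rintro _ ⟨ω, hω, rfl⟩
    refine ⟨mem_iUnion₂.2 ⟨C + K + 1, by positivity, sigmaRadialLimitSet_mono o G (by linarith)
      (T.limit_mem_sigmaRadialLimitSet hK ξ hω)⟩, ?_⟩
    refine le_approxExponent hb (M := V + 5 * C + 2 * K + C₂) fun t => ?_
    obtain ⟨n, hn⟩ := exists_nat_ge (t + C)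
    obtain ⟨m, hm, hstm⟩ := hio n
    set u := T.ev (word ω m) with hu
    set g := u * T.conn m u with hg
    have h1 : T.Z m = ZJ (st m).1 := if_neg hstm.not_lt
    have hz : ω m ∈ ZJ (st m).1 := by
      rw [← h1]
      have := (Finset.mem_filter.1 (hω m)).1
      rwa [length_word] at this
    have hgu : dist o (g.1 o) ≤ T.norm (word ω m) + C :=
      (dist_mul_le u.1 (T.conn m u).1 o).trans (add_le_add le_rfl (T.dist_conn m u))
    have hug : T.norm (word ω m) ≤ dist o (g.1 o) + C := by
      have h2 := dist_mul_le g.1 (T.conn m u).1⁻¹ o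
      rw [dist_inv_apply] at h2
      have h3 : g.1 * (T.conn m u).1⁻¹ = u.1 := by
        rw [hg, Subgroup.coe_mul, mul_inv_cancel_right]
      rw [h3] at h2
      exact h2.trans (add_le_add le_rfl (T.dist_conn m u))
    have hinvm := (hinv (hω.reach m)).2.1
    rw [length_word, hstm] at hinvm
    refine ⟨g, ?_, ?_⟩
    · have h2 := T.le_norm_word hK hω m
      have h3 : (n : ℝ) ≤ m := by exact_mod_cast hm
      linarith
    · have h2 := T.dist_boundaryMap_limit_le hK hb hV ξ hω (n := m) (R := R (st m).1)
        (by linarith [hJR (st m).1]) (hJξ _ _ hz)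
      -- The norm before the jump is at most M + nL, so R is at least c|g| up to a constant, and the
      -- distance to g(ξ) is at most a constant times b^(-(1+c)|g|).
      refine h2.trans (Real.rpow_le_rpow_of_exponent_le hb.le ?_)
      have h3 := hJc (st m).1
      have h4 := mul_le_mul_of_nonneg_left (hgu.trans (add_le_add_left hinvm C)) hc.le
      change V + 5 * C + 2 * K - dist o (g.1 o) - R (st m).1 ≤ _
      linarith
  · intro l hl
    obtain ⟨h1, h2, h3, h4⟩ := hinv hl
    have hn0 : 0 ≤ T.norm l := dist_nonneg
    -- At generic levels the fixed constant `Ag` is absorbed in `B`. At a jump the unbounded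
    -- constant is paid for by the faster decay over the completed run.
    rcases h1.lt_or_eq with h | h
    · have h5 : A l.length = Ag := if_pos h
      rw [h5]
      refine (mul_le_mul_left h3 _).trans ?_
      rw [← ENNReal.ofReal_mul (by positivity), mul_comm]
      exact ENNReal.ofReal_le_ofReal (mul_le_mul_of_nonneg_right (le_max_right _ _) (by positivity))
    · have h5 : A l.length = AJ (st l.length).1 := if_neg h.not_lt
      rw [h5]
      refine (mul_le_mul_left h4 _).trans ?_
      rw [← ENNReal.ofReal_mul (by positivity)]
      refine ENNReal.ofReal_le_ofReal ?_
      rw [h] at h2 ⊢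
      have hAJ : 1 ≤ AJ (st l.length).1 := one_le_of_frostman (hJ _).sum_eq (hJ _).sum_le
      have h6 := hJA (st l.length).1
      calc _ ≤ b ^ (-s' * (len (st l.length).1 * L)) * b ^ (s' * (len (st l.length).1 * L) -
            s * ((st l.length).1 + len (st l.length).1 * L) - s * C) :=
            mul_le_mul_of_nonneg_left (by linarith) (by positivity)
        _ ≤ b ^ (-s * T.norm l) := by
          rw [← Real.rpow_add hb0]
          refine Real.rpow_le_rpow_of_exponent_le hb.le ?_
          nlinarith
        _ ≤ _ := le_mul_of_one_le_left (by positivity) (le_max_left _ _)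

end WellApproximable

/-! ### The decay of the Hausdorff content and the dimension formulas -/

section Formulas

theorem le_ofReal_of_forall_gt {d : ℝ≥0∞} {a : ℝ} (h : ∀ s, a < s → d ≤ ENNReal.ofReal s) :
    d ≤ ENNReal.ofReal a := by
  have h1 : Tendsto ENNReal.ofReal (𝓝[>] a) (𝓝 (ENNReal.ofReal a)) :=
    (ENNReal.continuous_ofReal.tendsto a).mono_left nhdsWithin_le_nhds
  exact ge_of_tendsto h1 (eventually_nhdsWithin_of_forall h)

theorem ofReal_le_of_forall_lt {d : ℝ≥0∞} {a : ℝ}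
    (h : ∀ s, 0 < s → s < a → ENNReal.ofReal s ≤ d) : ENNReal.ofReal a ≤ d := by
  have h1 : Tendsto ENNReal.ofReal (𝓝[<] a) (𝓝 (ENNReal.ofReal a)) :=
    (ENNReal.continuous_ofReal.tendsto a).mono_left nhdsWithin_le_nhds
  refine le_of_tendsto h1 (eventually_nhdsWithin_of_forall fun s hs => ?_)
  rcases le_or_gt s 0 with h0 | h0
  · rw [ENNReal.ofReal_of_nonpos h0]; exact zero_le
  · exact h s h0 hs

/-- A threshold argument: members of `S` bound `d` from below only after an arbitrarily small
decrease, which is the form available when `S` is given by a weak inequality. An empty `S` agrees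
with supremum 0. -/
theorem eq_ofReal_sSup {δ : ℝ} {S : Set ℝ} {d : ℝ≥0∞} (hS : S ⊆ Ioo 0 δ)
    (hd : d ≤ ENNReal.ofReal δ) (hU : ∀ s ∈ Ioo 0 δ, s ∉ S → d ≤ ENNReal.ofReal s)
    (hL : ∀ s ∈ S, ∀ t, 0 < t → t < s → ENNReal.ofReal t ≤ d) : d = ENNReal.ofReal (sSup S) := by
  have h0 : 0 ≤ sSup S := Real.sSup_nonneg fun s hs => (hS hs).1.le
  have hbdd : BddAbove S := ⟨δ, fun s hs => (hS hs).2.le⟩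
  refine le_antisymm (le_ofReal_of_forall_gt fun s hs => ?_)
    (ofReal_le_of_forall_lt fun t ht hta => ?_)
  · rcases lt_or_ge s δ with h | h
    · exact hU s ⟨h0.trans_lt hs, h⟩ fun hsS => (le_csSup hbdd hsS).not_gt hs
    · exact hd.trans (ENNReal.ofReal_le_ofReal h)
  · have hne : S.Nonempty := by
      by_contra! h
      rw [h, Real.sSup_empty] at hta
      linarith
    obtain ⟨s, hs, hts⟩ := exists_lt_of_lt_csSup hne hta
    exact hL s hs t ht hts

theorem eq_ofReal_infOr {δ : ℝ} {S : Set ℝ} {d : ℝ≥0∞} (hS : S ⊆ Ioo 0 δ)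
    (hd : d ≤ ENNReal.ofReal δ) (hL : ∀ s ∈ Ioo 0 δ, s ∉ S → ENNReal.ofReal s ≤ d)
    (hU : ∀ s ∈ S, ∀ t, s < t → t < δ → d ≤ ENNReal.ofReal t) :
    d = ENNReal.ofReal (infOr δ S) := by
  have hbdd : BddBelow S := ⟨0, fun s hs => (hS hs).1.le⟩
  rcases S.eq_empty_or_nonempty with rfl | hne
  · rw [infOr, if_neg Set.not_nonempty_empty]
    exact hd.antisymm (ofReal_le_of_forall_lt fun s h0 hs => hL s ⟨h0, hs⟩ (notMem_empty s))
  · rw [infOr, if_pos hne]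
    refine le_antisymm (le_ofReal_of_forall_gt fun s hs => ?_)
      (ofReal_le_of_forall_lt fun t ht hta => ?_)
    · rcases lt_or_ge s δ with h | h
      · obtain ⟨t, ht, hts⟩ := exists_lt_of_csInf_lt hne hs
        exact hU t ht s hts h
      · exact hd.trans (ENNReal.ofReal_le_ofReal h)
    · obtain ⟨s, hs⟩ := hne
      exact hL t ⟨ht, hta.trans_le ((csInf_le hbdd hs).trans (hS hs).2.le)⟩
        fun h => (csInf_le hbdd h).not_gt hta

theorem elogb_div_logb_le {b : ℝ} (hb : 1 < b) {r p : ℝ} (hr : 0 < r) (hr1 : r < 1) {x : ℝ≥0∞}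
    (h : ENNReal.ofReal (r ^ p) ≤ x) : elogb b x / ((Real.logb b r : ℝ) : EReal) ≤ p := by
  have h1 : elogb b (ENNReal.ofReal (r ^ p)) ≤ elogb b x :=
    EReal.div_le_div_right_of_nonneg (by exact_mod_cast (Real.log_pos hb).le)
      (ENNReal.log_monotone h)
  have h2 := Real.logb_neg hb hr hr1
  refine (EReal.div_le_div_right_of_nonpos (by exact_mod_cast h2.le) h1).trans (le_of_eq ?_)
  rw [elogb_ofReal (by positivity), Real.logb_rpow_eq_mul_logb_of_pos hr, ← EReal.coe_div,
    mul_div_cancel_right₀ _ h2.ne]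

theorem le_elogb_div_logb {b : ℝ} (hb : 1 < b) {r p : ℝ} (hr : 0 < r) (hr1 : r < 1) {x : ℝ≥0∞}
    (h : x ≤ ENNReal.ofReal (r ^ p)) : p ≤ elogb b x / ((Real.logb b r : ℝ) : EReal) := by
  have h1 : elogb b x ≤ elogb b (ENNReal.ofReal (r ^ p)) :=
    EReal.div_le_div_right_of_nonneg (by exact_mod_cast (Real.log_pos hb).le)
      (ENNReal.log_monotone h)
  have h2 := Real.logb_neg hb hr hr1
  refine le_trans (le_of_eq ?_) (EReal.div_le_div_right_of_nonpos (by exact_mod_cast h2.le) h1)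
  rw [elogb_ofReal (by positivity), Real.logb_rpow_eq_mul_logb_of_pos hr, ← EReal.coe_div,
    mul_div_cancel_right₀ _ h2.ne]

variable {X : Type*} [MetricSpace X] [GromovHyperbolic X] [MetricSpace (GromovBoundary X)]
  {b : ℝ} (hb : 1 < b) {o : X} {G : Subgroup (X ≃ᵢ X)} {ξ : GromovBoundary X}

theorem dist_le_of_mem_closedBall_inter {r : ℝ} {S : Set (GromovBoundary X)} :
    ∀ x ∈ Metric.closedBall ξ r ∩ S, ∀ y ∈ Metric.closedBall ξ r ∩ S, dist x y ≤ 2 * r := by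
  intro x hx y hy
  have h1 := dist_triangle_right x y ξ
  have h2 : dist x ξ ≤ r := hx.1
  have h3 : dist y ξ ≤ r := hy.1
  linarith

theorem radialContent_le {σ s r : ℝ} (hs : 0 ≤ s) (hr : 0 < r) :
    radialContent o G ξ σ s r ≤ ENNReal.ofReal (2 ^ s * r ^ s) := by
  rw [← Real.mul_rpow (by norm_num) hr.le]
  exact hausdorffContent_le_of_dist_le hs dist_le_of_mem_closedBall_inter

section
include hb

theorem contentDecay_le_sigmaDecay (s σ : ℝ) :
    contentDecay b o G ξ s ≤ sigmaDecay b o G ξ s σ :=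
  (antitone_sigmaDecay hb o G ξ s).le_of_tendsto (tendsto_sigmaDecay hb o G ξ s) σ

/-- For sets of diameter at most 1, raising the exponent lowers the content; division by the
negative log_b r reverses the order. -/
theorem contentDecay_mono {s t : ℝ} (hs : 0 ≤ s) (hst : s ≤ t) :
    contentDecay b o G ξ s ≤ contentDecay b o G ξ t := by
  refine le_of_tendsto_of_tendsto' (tendsto_sigmaDecay hb o G ξ s) (tendsto_sigmaDecay hb o G ξ t)
    fun σ => liminf_le_liminf ?_
  have : ∀ᶠ r : ℝ in 𝓝[>] 0, r ∈ Ioo (0 : ℝ) (1 / 2) := Ioo_mem_nhdsGT (by norm_num)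
  filter_upwards [this] with r hr
  have h1 : radialContent o G ξ σ t r ≤ radialContent o G ξ σ s r := by
    refine (hausdorffContent_le_mul_of_dist_le hs hst (ρ := 2 * r) (by linarith [hr.1])
      dist_le_of_mem_closedBall_inter).trans (mul_le_of_le_one_left zero_le ?_)
    rw [← ENNReal.ofReal_one]
    exact ENNReal.ofReal_le_ofReal
      (Real.rpow_le_one (by linarith [hr.1]) (by linarith [hr.2]) (by linarith))
  exact EReal.div_le_div_right_of_nonpos
    (by exact_mod_cast (Real.logb_neg hb hr.1 (by linarith [hr.2])).le)
    (EReal.div_le_div_right_of_nonneg (by exact_mod_cast (Real.log_pos hb).le)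
      (ENNReal.log_monotone h1))

theorem exists_radialContent_le {s p : ℝ} (h : (p : EReal) < contentDecay b o G ξ s) (σ : ℝ) :
    ∃ r₀ > 0, ∀ r, 0 < r → r < r₀ → radialContent o G ξ σ s r ≤ ENNReal.ofReal (r ^ p) := by
  have h1 := eventually_lt_of_lt_liminf (h.trans_le (contentDecay_le_sigmaDecay hb s σ))
  have h2 : ∀ᶠ r : ℝ in 𝓝[>] 0, r ∈ Ioo (0 : ℝ) 1 := Ioo_mem_nhdsGT one_pos
  obtain ⟨r₀, hr₀, h3⟩ := mem_nhdsGT_iff_exists_Ioo_subset.1 (h1.and h2)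
  refine ⟨r₀, hr₀, fun r hr hr' => ?_⟩
  obtain ⟨h4, h5⟩ := h3 ⟨hr, hr'⟩
  by_contra! h6
  exact (elogb_div_logb_le hb h5.1 h5.2 h6.le).not_gt h4

theorem exists_le_radialContent {s p : ℝ} (h : contentDecay b o G ξ s < (p : EReal)) :
    ∃ σ : ℝ, ∀ T : ℝ, ∃ R ≥ T,
      ENNReal.ofReal (b ^ (-p * R)) ≤ radialContent o G ξ σ s (b ^ (-R)) := by
  have hb0 : 0 < b := by linarith
  obtain ⟨σ, hσ⟩ := ((tendsto_sigmaDecay hb o G ξ s).eventually (gt_mem_nhds h)).exists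
  refine ⟨σ, fun T => ?_⟩
  have h1 := frequently_lt_of_liminf_lt (by isBoundedDefault) hσ
  have h2 : ∀ᶠ r : ℝ in 𝓝[>] 0, r ∈ Ioo (0 : ℝ) (min 1 (b ^ (-T))) :=
    Ioo_mem_nhdsGT (by positivity)
  obtain ⟨r, h3, hr, hr'⟩ := (h1.and_eventually h2).exists
  rw [lt_min_iff] at hr'
  refine ⟨-Real.logb b r, ?_, ?_⟩
  · have := (Real.logb_le_logb_of_le hb hr hr'.2.le)
    rw [Real.logb_rpow hb0 hb.ne'] at this
    linarith
  · have h4 : b ^ (-p * -Real.logb b r) = r ^ p := by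
      rw [neg_mul_neg, mul_comm, Real.rpow_mul hb0.le, Real.rpow_logb hb0 hb.ne' hr]
    rw [h4, neg_neg, Real.rpow_logb hb0 hb.ne' hr]
    by_contra! h5
    exact (le_elogb_div_logb hb hr hr'.1 h5.le).not_gt h3

end

variable (hD : IsVisualMetric b o) (hGd : StronglyDiscrete o G) {δ : ℝ≥0}
  (hδ : poincareExponent b o G = δ)
include hb hD hGd hδ

/-- The general upper bound needs a decay exponent of at least s. If the given p is smaller, the
trivial exponent s is available and only improves s + cp. -/
theorem dimH_wellApproxSet_le_of_lt {s c : ℝ} (hs : 0 < s) (hc : 0 < c)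
    (h : (((δ - s) / c : ℝ) : EReal) < contentDecay b o G ξ s) :
    dimH (wellApproxSet b o G ξ c) ≤ ENNReal.ofReal s := by
  obtain ⟨p, hp1, hp2⟩ := EReal.lt_iff_exists_real_btwn.1 h
  rw [EReal.coe_lt_coe_iff, div_lt_iff₀ hc] at hp1
  refine dimH_wellApproxSet_le hb hD hGd hδ hs (le_max_right p s) hc ?_ fun σ => ?_
  · nlinarith [le_max_left p s]
  · rcases le_total p s with hps | hps
    · rw [max_eq_right hps]
      exact ⟨2 ^ s, by positivity, 1, one_pos, fun r hr _ => radialContent_le hs.le hr⟩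
    · rw [max_eq_left hps]
      obtain ⟨r₀, hr₀, hr⟩ := exists_radialContent_le hb hp2 σ
      exact ⟨1, one_pos, r₀, hr₀, fun r h1 h2 => by rw [one_mul]; exact hr r h1 h2⟩

theorem dimH_wellApproxSet_le_div {c : ℝ} (hc : 0 < c) :
    dimH (wellApproxSet b o G ξ c) ≤ ENNReal.ofReal (δ / (c + 1)) := by
  refine le_ofReal_of_forall_gt fun s hs => ?_
  have hs0 : 0 < s := hs.trans_le' (by positivity)
  rw [div_lt_iff₀ (by linarith)] at hs
  exact dimH_wellApproxSet_le hb hD hGd hδ hs0 le_rfl hc (by linarith) fun σ =>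
    ⟨2 ^ s, by positivity, 1, one_pos, fun r hr _ => radialContent_le hs0.le hr⟩

theorem le_dimH_wellApproxSet_of_lt (hGt : IsGeneralType G) {s c : ℝ} (hs : 0 < s) (hsδ : s < δ)
    (hc : 0 < c) (h : contentDecay b o G ξ s < (((δ - s) / c : ℝ) : EReal)) :
    ENNReal.ofReal s ≤ dimH (wellApproxSet b o G ξ c) := by
  have h0 : (0 : EReal) < (((δ - s) / c : ℝ) : EReal) := by
    exact_mod_cast div_pos (sub_pos.2 hsδ) hc
  obtain ⟨p, hp1, hp2⟩ := EReal.lt_iff_exists_real_btwn.1 (max_lt h h0)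
  rw [max_lt_iff] at hp1
  rw [EReal.coe_lt_coe_iff, lt_div_iff₀ hc] at hp2
  obtain ⟨σ, hσ⟩ := exists_le_radialContent hb hp1.1
  exact le_dimH_wellApproxSet hb hD hGd hGt hδ hs hc (by exact_mod_cast hp1.2.le) (by linarith) hσ

end Formulas

/-! ### Inclusions among the sets of approximable points -/

section Sets

variable {X : Type*} [MetricSpace X] [GromovHyperbolic X] [MetricSpace (GromovBoundary X)]
  (b : ℝ) (o : X) (G : Subgroup (X ≃ᵢ X)) (ξ : GromovBoundary X)

theorem wellApproxSet_subset_veryWellApproxSet {c : ℝ} (hc : 0 < c) :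
    wellApproxSet b o G ξ c ⊆ veryWellApproxSet b o G ξ := fun _ h =>
  ⟨h.1, h.2.trans_lt' (by exact_mod_cast (by linarith : 1 < 1 + c))⟩

theorem veryWellApproxSet_eq_iUnion :
    veryWellApproxSet b o G ξ = ⋃ k : ℕ, wellApproxSet b o G ξ (1 / (k + 1)) := by
  refine subset_antisymm (fun η h => ?_) (iUnion_subset fun k =>
    wellApproxSet_subset_veryWellApproxSet b o G ξ (by positivity))
  obtain ⟨q, hq1, hq2⟩ := EReal.lt_iff_exists_real_btwn.1 h.2
  have hq : 1 < q := by exact_mod_cast hq1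
  obtain ⟨k, hk⟩ := exists_nat_one_div_lt (sub_pos.2 hq)
  refine mem_iUnion.2 ⟨k, h.1, hq2.le.trans' ?_⟩
  exact_mod_cast (by linarith : 1 + 1 / ((k : ℝ) + 1) ≤ q)

theorem liouvilleSet_subset_wellApproxSet (c : ℝ) :
    liouvilleSet b o G ξ ⊆ wellApproxSet b o G ξ c := fun _ h => ⟨h.1, h.2 ▸ le_top⟩

end Sets

end HypDioph

end

/-- The dimension is at most s where P_ξ(s) > (δ-s)/c and at least s where P_ξ(s) < (δ-s)/c. At
equality, moving s slightly makes the inequality strict, because the right side is strictly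
monotone. VWA is the union of the sets W_{1/(k+1)}, and the Liouville set lies in every W_{c,ξ}. -/
theorem mainTheorem5 {X : Type*} [MetricSpace X] [GromovHyperbolic X]
    (o : X) (b : ℝ) (hb : 1 < b)
    [MetricSpace (GromovBoundary X)] (hD : IsVisualMetric b o)
    (G : Subgroup (X ≃ᵢ X)) (hGd : StronglyDiscrete o G) (hGt : IsGeneralType G)
    (ξ : GromovBoundary X)
    (δ : ℝ≥0) (hδ : poincareExponent b o G = δ) :
    (∀ c : ℝ, 0 < c →
      dimH (wellApproxSet b o G ξ c) =
        ENNReal.ofReal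
          (sSup {s : ℝ | s ∈ Ioo 0 (δ : ℝ) ∧ contentDecay b o G ξ s ≤ ((δ - s) / c : ℝ)}) ∧
      dimH (wellApproxSet b o G ξ c) =
        ENNReal.ofReal
          (infOr δ {s : ℝ | s ∈ Ioo 0 (δ : ℝ) ∧ ((δ - s) / c : ℝ) ≤ contentDecay b o G ξ s}) ∧
      dimH (wellApproxSet b o G ξ c) ≤ ENNReal.ofReal (δ / (c + 1))) ∧
    dimH (veryWellApproxSet b o G ξ) =
      ENNReal.ofReal (sSup {s : ℝ | s ∈ Ioo 0 (δ : ℝ) ∧ contentDecay b o G ξ s < ⊤}) ∧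
    dimH (veryWellApproxSet b o G ξ) =
      ENNReal.ofReal (infOr δ {s : ℝ | s ∈ Ioo 0 (δ : ℝ) ∧ contentDecay b o G ξ s = ⊤}) ∧
    dimH (liouvilleSet b o G ξ) = 0 := by
  have hδ0 : (0 : ℝ) ≤ δ := δ.2
  have hW : ∀ c : ℝ, 0 < c → dimH (wellApproxSet b o G ξ c) ≤ ENNReal.ofReal (δ / (c + 1)) :=
    fun c hc => dimH_wellApproxSet_le_div hb hD hGd hδ hc
  have hWδ : ∀ c : ℝ, 0 < c → dimH (wellApproxSet b o G ξ c) ≤ ENNReal.ofReal δ := fun c hc =>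
    (hW c hc).trans (ENNReal.ofReal_le_ofReal (div_le_self hδ0 (by linarith)))
  have hanti : ∀ {c s t : ℝ}, 0 < c → s < t →
      (((δ - t) / c : ℝ) : EReal) < (((δ - s) / c : ℝ) : EReal) := fun hc hst => by
    rw [EReal.coe_lt_coe_iff]
    exact div_lt_div_of_pos_right (by linarith) hc
  have hVU : dimH (veryWellApproxSet b o G ξ) ≤ ENNReal.ofReal δ := by
    rw [veryWellApproxSet_eq_iUnion, dimH_iUnion]
    exact iSup_le fun k => hWδ _ (by positivity)
  have hVtop : ∀ s : ℝ, 0 < s → contentDecay b o G ξ s = ⊤ →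
      dimH (veryWellApproxSet b o G ξ) ≤ ENNReal.ofReal s := by
    intro s hs h
    rw [veryWellApproxSet_eq_iUnion, dimH_iUnion]
    exact iSup_le fun k => dimH_wellApproxSet_le_of_lt hb hD hGd hδ hs (by positivity)
      (h ▸ EReal.coe_lt_top _)
  have hVlt : ∀ s ∈ Ioo 0 (δ : ℝ), contentDecay b o G ξ s < ⊤ →
      ENNReal.ofReal s ≤ dimH (veryWellApproxSet b o G ξ) := by
    intro s hs h
    obtain ⟨q, hq1, -⟩ := EReal.lt_iff_exists_real_btwn.1 h
    -- With P_ξ(s) < q, taking c = (δ-s)/max(q,1) makes (δ-s)/c exceed P_ξ(s); the 1 keeps c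
    -- positive.
    have hm : 0 < max q 1 := by positivity
    have hds : (0 : ℝ) < δ - s := sub_pos.2 hs.2
    have hc : 0 < (δ - s) / max q 1 := div_pos hds hm
    refine (le_dimH_wellApproxSet_of_lt hb hD hGd hδ hGt hs.1 hs.2 hc ?_).trans
      (dimH_mono (wellApproxSet_subset_veryWellApproxSet b o G ξ hc))
    rw [div_div_cancel₀ hds.ne']
    exact hq1.trans_le (by exact_mod_cast le_max_left q 1)
  refine ⟨fun c hc => ⟨?_, ?_, hW c hc⟩, ?_, ?_, ?_⟩
  · refine eq_ofReal_sSup (fun s hs => hs.1) (hWδ c hc) (fun s hs hsS => ?_)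
      fun s hs t ht hts => ?_
    · exact dimH_wellApproxSet_le_of_lt hb hD hGd hδ hs.1 hc (not_le.1 fun h => hsS ⟨hs, h⟩)
    · exact le_dimH_wellApproxSet_of_lt hb hD hGd hδ hGt ht (hts.trans hs.1.2) hc
        (((contentDecay_mono hb ht.le hts.le).trans hs.2).trans_lt (hanti hc hts))
  · refine eq_ofReal_infOr (fun s hs => hs.1) (hWδ c hc) (fun s hs hsS => ?_)
      fun s hs t hst ht => ?_
    · exact le_dimH_wellApproxSet_of_lt hb hD hGd hδ hGt hs.1 hs.2 hc
        (not_le.1 fun h => hsS ⟨hs, h⟩)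
    · exact dimH_wellApproxSet_le_of_lt hb hD hGd hδ (hs.1.1.trans hst) hc
        ((hanti hc hst).trans_le (hs.2.trans (contentDecay_mono hb hs.1.1.le hst.le)))
  · refine eq_ofReal_sSup (fun s hs => hs.1) hVU (fun s hs hsS => ?_) fun s hs t ht hts => ?_
    · exact hVtop s hs.1 (not_lt_top_iff.1 fun h => hsS ⟨hs, h⟩)
    · exact (ENNReal.ofReal_le_ofReal hts.le).trans (hVlt s hs.1 hs.2)
  · refine eq_ofReal_infOr (fun s hs => hs.1) hVU (fun s hs hsS => ?_)
      fun s hs t hst ht => ?_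
    · exact hVlt s hs (lt_top_iff_ne_top.2 fun h => hsS ⟨hs, h⟩)
    · exact (hVtop s hs.1.1 hs.2).trans (ENNReal.ofReal_le_ofReal hst.le)
  · rw [← nonpos_iff_eq_zero, ← ENNReal.ofReal_zero]
    refine le_ofReal_of_forall_gt fun s hs => ?_
    -- For this c the bound δ/(c+1) is at most s.
    have hc : (0 : ℝ) < δ / s + 1 := by positivity
    refine ((dimH_mono (liouvilleSet_subset_wellApproxSet b o G ξ _)).trans (hW _ hc)).trans
      (ENNReal.ofReal_le_ofReal ?_)
    rw [div_le_iff₀ (by linarith)]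
    have : δ / s * s = (δ : ℝ) := div_mul_cancel₀ _ hs.ne'
    nlinarith
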